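/- **Theorem.** *Model.* For each $n\ge 1$ one observes $$Y_{i_1,i_2}=m_\phi(x_{i_1},x_{i_2})+\varepsilon_{i_1,i_2},\qquad 1\le i_1,i_2\le n,\qquad m_\phi(x,y)=m(x,y)+\tau(x)\mathbf 1_{[0,\phi(x)]}(y),$$ where $m\in C^2[0,1]^2$, $\tau\in C^2[0,1]$ is non-negative, $\phi\in C^2[0,1]$ takes values in $(0,1)$, and the design points $x_i=x_{n,i}$ are equally spaced with $x_{n,i}\in[(i-1)/n,i/n]$. For each $n$ the errors are independent with a common law (not depending on $n$) that has mean $0$, variance $\sigma^2$ and a finite fifth absolute moment. *Kernels.* $K_1,K_2:\mathbb R\to\mathbb R$ vanish outside $[-1,1]$, are three times continuously differentiable on $[-1,1]$ and $K_1^{(j)}(\pm1)=K_2^{(j)}(\pm1)=0$ for $j=0,1,2$ (so that both are of class $C^2$ on $\mathbb R$). $K_1$ is even, $K_1>0$ on $(-1,1)$, $\int_{-1}^1K_1=1$. $K_2$ is odd, $\int_0^1K_2=1$, $K_2'(0)>0$, and $0<\int_0^yK_2(t)\,dt<2$ for all $y\in(0,1)$. *Bandwidth.* For some constants $C_1,C_2>0$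 and $\eta>1$ we have $h=h_n\in[C_1(\ln n)^\eta n^{-1/2},\,C_2n^{-1/3}]$ for all large $n$. *Estimator.* For $z\in\mathbb R^2$ and $\psi\in[-\pi/2,\pi/2]$ let $$\hat M_n(z;\psi,h)=n^{-2}\sum_{i_1,i_2=1}^nY_{i_1,i_2}\,K\{z-(x_{i_1},x_{i_2})^\top;\psi,h\},\qquad K(z;\psi,h)=h^{-2}K(h^{-1}R_{-\psi}z),$$ where $K(z_1,z_2)=K_1(z_1)K_2(z_2)$ and $R_\psi=\begin{pmatrix}\cos\psi&-\sin\psi\\ \sin\psi&\cos\psi\end{pmatrix}$. Let $I\subset(0,1)$ be a compact interval, $x\in I$ and $\tau(x)>0$. Let $(\hat\phi(x),\hat\psi(x))$ be random variables such that, for all large $n$, almost surely $$(\hat\phi(x),\hat\psi(x))\in\operatorname*{argmax}_{y\in[\sqrt2h,\,1-\sqrt2h],\ \psi\in[-\pi/2,\pi/2]}\hat M_n((x,y)^\top;\psi,h),$$ and let $\phi_n(x)$ be such that, for all large $n$, $$\phi_n(x)\in\operatorname*{argmax}_{y\in[\sqrt2h,\,1-\sqrt2h]}\ \max_{\psi\in[-\pi/2,\pi/2]}\mathbb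 E\{\hat M_n((x,y)^\top;\psi,h)\}.$$ *Conclusion.* As $n\to\infty$, $$n\{\hat\phi(x)-\phi_n(x)\}\rightsquigarrow\mathcal N\bigl[0,\ \sigma^2V_\phi^S(x)/\{V_\phi^H(x)\}^2\bigr],$$ where, with $\psi(x)=\arctan\phi'(x)$, $$V_\phi^H(x)=\tau(x)\cos^2\{\psi(x)\}K_2'(0),$$ $$V_\phi^S(x)=\sin^2\{\psi(x)\}\int_{[-1,1]^2}\{K_1'(z_1)K_2(z_2)\}^2dz_1dz_2+\cos^2\{\psi(x)\}\int_{[-1,1]^2}\{K_1(z_1)K_2'(z_2)\}^2dz_1dz_2.$$ If $\sigma^2=0$ the limit is the point mass at $0$. -/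

import Mathlib

open MeasureTheory ProbabilityTheory Set Filter Topology

noncomputable section

namespace JumpCurve

/-- The rotation matrix `R_ψ`. -/
def rot (ψ : ℝ) : Matrix (Fin 2) (Fin 2) ℝ :=
  !![Real.cos ψ, Real.sin (-ψ); Real.sin ψ, Real.cos ψ]

/-- The rotated difference kernel `K(z; ψ, h) = K(h⁻¹ R_{-ψ} z) / h²`
with the product kernel `K(z₁, z₂) = K₁(z₁) K₂(z₂)`. -/
def rotKernel (K₁ K₂ : ℝ → ℝ) (z : Fin 2 → ℝ) (ψ h : ℝ) : ℝ :=
  K₁ ((h⁻¹ • (rot (-ψ)).mulVec z) 0) * K₂ ((h⁻¹ • (rot (-ψ)).mulVec z) 1) / h ^ 2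

/-- The regression function `m_φ(x, y) = m(x, y) + τ(x) 1_{[0, φ(x)]}(y)`. -/
def image (m : ℝ → ℝ → ℝ) (τ φ : ℝ → ℝ) (x y : ℝ) : ℝ :=
  m x y + τ x * (Icc 0 (φ x)).indicator (fun _ => (1 : ℝ)) y

/-- Regular design: for every `n` the points are equally spaced, with one point in each of the
`n` cells of length `1 / n` of `[0, 1]`.  This covers `i / n`, `(i - 1) / n`, `(i - 1/2) / n`
and `(i - 1) / (n - 1)` for `i = 1, …, n` (here the index runs through `0, …, n - 1`). -/
def IsRegularGrid (d : (n : ℕ) → Fin n → ℝ) : Prop :=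
  ∀ n : ℕ, (∃ a δ : ℝ, ∀ i : Fin n, d n i = a + δ * (i : ℕ)) ∧
    ∀ i : Fin n, d n i ∈ Icc (((i : ℕ) : ℝ) / n) ((((i : ℕ) : ℝ) + 1) / n)

/-- The observations `Y_{i₁,i₂} = m_φ(x_{i₁}, x_{i₂}) + ε_{i₁,i₂}`. -/
def obs (m : ℝ → ℝ → ℝ) (τ φ : ℝ → ℝ) {n : ℕ} (d : Fin n → ℝ) (e : Fin n × Fin n → ℝ)
    (i : Fin n × Fin n) : ℝ :=
  image m τ φ (d i.1) (d i.2) + e i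

/-- The contrast `M̂_n(z; ψ, h) = n⁻² ∑ Y_{i₁,i₂} K(z - (x_{i₁}, x_{i₂}); ψ, h)`. -/
def contrast (K₁ K₂ : ℝ → ℝ) {n : ℕ} (d : Fin n → ℝ) (Y : Fin n × Fin n → ℝ)
    (z : Fin 2 → ℝ) (ψ h : ℝ) : ℝ :=
  ((n : ℝ) ^ 2)⁻¹ * ∑ i : Fin n × Fin n, Y i * rotKernel K₁ K₂ (z - ![d i.1, d i.2]) ψ h

/-- Vertical search interval `[√2 h, 1 - √2 h]`: the heights at which every rotation of the
kernel window `[-h, h]²` stays vertically inside the observation window `[0, 1]`. -/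
def heights (h : ℝ) : Set ℝ := Icc (√2 * h) (1 - √2 * h)

/-- The range `[-π/2, π/2]` of the angle. -/
def angles : Set ℝ := Icc (-(Real.pi / 2)) (Real.pi / 2)

/-- `(y₀, ψ₀)` belongs to the argmax of `M y ψ` over `y ∈ heights h`, `ψ ∈ angles`. -/
def IsArgmaxPair (M : ℝ → ℝ → ℝ) (h y₀ ψ₀ : ℝ) : Prop :=
  (y₀, ψ₀) ∈ heights h ×ˢ angles ∧
    IsMaxOn (fun p : ℝ × ℝ => M p.1 p.2) (heights h ×ˢ angles) (y₀, ψ₀)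

/-- `y₀` belongs to the argmax over `y ∈ heights h` of `max_{ψ ∈ angles} M y ψ`. -/
def IsArgmaxProfile (M : ℝ → ℝ → ℝ) (h y₀ : ℝ) : Prop :=
  y₀ ∈ heights h ∧ IsMaxOn (fun y => sSup (M y '' angles)) (heights h) y₀

/-- Regularity common to both kernels: three times continuously differentiable on `[-1, 1]`,
zero outside, with the derivatives of order `0, 1, 2` vanishing at `±1`; the last condition
makes the extension by zero twice continuously differentiable on `ℝ`. -/
structure IsSmoothKernel (K : ℝ → ℝ) : Prop where
  contDiff_two : ContDiff ℝ 2 K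
  contDiffOn_three : ContDiffOn ℝ 3 K (Icc (-1) 1)
  support_subset : Function.support K ⊆ Icc (-1) 1
  deriv_left : ∀ j ≤ 2, iteratedDeriv j K (-1) = 0
  deriv_right : ∀ j ≤ 2, iteratedDeriv j K 1 = 0

/-- The assumptions on the even kernel `K₁`. -/
structure IsEvenKernel (K₁ : ℝ → ℝ) : Prop extends IsSmoothKernel K₁ where
  even : ∀ t, K₁ (-t) = K₁ t
  pos : ∀ t ∈ Ioo (-1 : ℝ) 1, 0 < K₁ t
  integral_eq : ∫ t in (-1 : ℝ)..1, K₁ t = 1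

/-- The assumptions on the odd kernel `K₂`. -/
structure IsOddKernel (K₂ : ℝ → ℝ) : Prop extends IsSmoothKernel K₂ where
  odd : ∀ t, K₂ (-t) = -K₂ t
  integral_eq : ∫ t in (0 : ℝ)..1, K₂ t = 1
  deriv_zero_pos : 0 < deriv K₂ 0

/-- `h_n ∈ [C₁ (ln n)^η / n^{1/2}, C₂ / n^{1/3}]` (for all large `n`) for some constants
`C₁, C₂ > 0` and some `η > 1`. -/
def IsBandwidth (h : ℕ → ℝ) : Prop :=
  ∃ C₁ C₂ η : ℝ, 0 < C₁ ∧ 0 < C₂ ∧ 1 < η ∧ ∀ᶠ n : ℕ in atTop,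
    h n ∈ Icc (C₁ * Real.log n ^ η / (n : ℝ) ^ (1 / 2 : ℝ)) (C₂ / (n : ℝ) ^ (1 / 3 : ℝ))

/-- The angle `ψ(x) = arctan φ'(x)` of the tangent. -/
def slope (φ : ℝ → ℝ) (x : ℝ) : ℝ := Real.arctan (deriv φ x)

/-- `V_φ^H(x) = τ(x) cos²(ψ(x)) K₂'(0)`. -/
def VH (K₂ τ φ : ℝ → ℝ) (x : ℝ) : ℝ :=
  τ x * Real.cos (slope φ x) ^ 2 * deriv K₂ 0

/-- `V_φ^S(x) = sin²(ψ(x)) ∫ (K₁'(z₁) K₂(z₂))² dz + cos²(ψ(x)) ∫ (K₁(z₁) K₂'(z₂))² dz`,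
both integrals over `[-1, 1]²`. -/
def VS (K₁ K₂ φ : ℝ → ℝ) (x : ℝ) : ℝ :=
  Real.sin (slope φ x) ^ 2 *
      (∫ z in Icc (-1 : ℝ) 1 ×ˢ Icc (-1 : ℝ) 1, (deriv K₁ z.1 * K₂ z.2) ^ 2) +
    Real.cos (slope φ x) ^ 2 *
      (∫ z in Icc (-1 : ℝ) 1 ×ˢ Icc (-1 : ℝ) 1, (K₁ z.1 * deriv K₂ z.2) ^ 2)

end JumpCurve

end

/-! Seen through a window of size `h`, the image near `(x, φ x)` is a constant plus `τ x` times the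
indicator of the half-plane below the tangent. For heights `y = φ x + w h` the mean contrast
therefore tends to `τ x` times the integral of `K₁ ⊗ K₂` over a half-plane in rotated coordinates.
Slicing this half-plane parallel to the second axis and using the tail bounds for `K₂`, this limit
is below `τ x` unless `w = 0` and the angle is `slope φ x` (`integral_edgeWeight_lt`); when `|w| →
∞` the limit is `0`, because the window sees a constant and `K₂` has mean zero. Compactness turns
this into a separation statement for the mean contrast (`exists_argmax_neighbourhood`). The noise
part of the contrast is uniformly negligible (`tendsto_measure_noise`), so both the random and the
deterministic maximizer satisfy `(y - φ x) / h → 0` and `ψ → slope φ x` (`argmax_consistent`).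

The rest is an argument with estimating equations. Both maximizers are eventually interior, so the
gradient of the observed contrast vanishes at the random one and that of the mean contrast at the
deterministic one. By the mean value theorem, the Hessian at intermediate points, applied to `((ŷ -
y) / h, ψ' - ψ)`, equals minus the noise gradient at the deterministic maximizer. Since the centring
is at that maximizer, no bias term appears. Parity and integration by parts make the limiting
Hessian diagonal, with entries `-VH` and `-angleCurvature` (`tendsto_hess`). Hence `n (ŷ - y)` is
`VH⁻¹` times `n h` times the noise score in the height, up to a term that vanishes in probability
(`tendsto_maximizer_sub_score`). That score is a weighted sum of independent errors to which a
central limit theorem applies (`tendstoInDistribution_weighted_sum`).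

Two devices keep this uniform. Derivatives of kernel sums with product windows are again
combinations of such sums, so one Riemann-sum limit serves the contrast, the Hessian and the
variance. Convergence in probability is convergence along `probFilter`, so deterministic limit
lemmas apply directly to random heights and angles. -/

noncomputable section

namespace JumpCurve

/-! ### Rotations -/

/-- Rotation of the plane by `ψ`. -/
def rotate (ψ : ℝ) (t : ℝ × ℝ) : ℝ × ℝ :=
  (Real.cos ψ * t.1 - Real.sin ψ * t.2, Real.sin ψ * t.1 + Real.cos ψ * t.2)

/-- Rotation of the plane by `-ψ`. -/
def unrotate (ψ : ℝ) (u : ℝ × ℝ) : ℝ × ℝ :=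
  (Real.cos ψ * u.1 + Real.sin ψ * u.2, -Real.sin ψ * u.1 + Real.cos ψ * u.2)

theorem unrotate_rotate (ψ : ℝ) (t : ℝ × ℝ) : unrotate ψ (rotate ψ t) = t := by
  have h := Real.sin_sq_add_cos_sq ψ
  ext <;> simp only [unrotate, rotate]
  · linear_combination t.1 * h
  · linear_combination t.2 * h

theorem unrotate_add (ψ : ℝ) (u v : ℝ × ℝ) :
    unrotate ψ (u + v) = unrotate ψ u + unrotate ψ v := by
  ext <;> simp only [unrotate, Prod.fst_add, Prod.snd_add] <;> ring

/-- The norm on `ℝ × ℝ` is the sup norm, which rotations do not preserve; the crude factor 2 is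
enough throughout. -/
theorem norm_unrotate_le (ψ : ℝ) (u : ℝ × ℝ) : ‖unrotate ψ u‖ ≤ 2 * ‖u‖ := by
  have h1 : |u.1| ≤ ‖u‖ := norm_fst_le u
  have h2 : |u.2| ≤ ‖u‖ := norm_snd_le u
  have hc := Real.abs_cos_le_one ψ
  have hs := Real.abs_sin_le_one ψ
  have key : ∀ a b : ℝ, |a| ≤ 1 → |b| ≤ 1 → |a * u.1 + b * u.2| ≤ 2 * ‖u‖ := by
    intro a b ha hb
    refine (abs_add_le _ _).trans ?_
    rw [abs_mul, abs_mul]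
    have h0 := norm_nonneg u
    nlinarith [mul_le_mul ha h1 (abs_nonneg _) zero_le_one,
      mul_le_mul hb h2 (abs_nonneg _) zero_le_one]
  rw [Prod.norm_def, max_le_iff]
  refine ⟨key _ _ hc hs, key _ _ (by rwa [abs_neg]) hc⟩

theorem norm_rotate_le (ψ : ℝ) (u : ℝ × ℝ) : ‖rotate ψ u‖ ≤ 2 * ‖u‖ := by
  have : rotate ψ u = unrotate (-ψ) u := by
    ext <;> simp [rotate, unrotate, sub_eq_add_neg]
  rw [this]; exact norm_unrotate_le _ _

theorem measurePreserving_rotate (ψ : ℝ) :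
    MeasurePreserving (rotate ψ) (volume : Measure (ℝ × ℝ)) volume := by
  let L : ℝ × ℝ →ₗ[ℝ] ℝ × ℝ :=
    Matrix.toLin (Module.Basis.finTwoProd ℝ) (Module.Basis.finTwoProd ℝ)
      !![Real.cos ψ, -Real.sin ψ; Real.sin ψ, Real.cos ψ]
  have hL : (L : ℝ × ℝ → ℝ × ℝ) = rotate ψ := by
    funext t
    simp only [L, Matrix.toLin_finTwoProd_apply, rotate]
    rw [neg_mul, ← sub_eq_add_neg]
  have hdet : LinearMap.det L = 1 := by
    simp only [L, LinearMap.det_toLin, Matrix.det_fin_two_of]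
    nlinarith [Real.sin_sq_add_cos_sq ψ]
  refine ⟨(by unfold rotate; fun_prop : Continuous (rotate ψ)).measurable, ?_⟩
  have := Measure.map_linearMap_addHaar_eq_smul_addHaar (volume : Measure (ℝ × ℝ)) (f := L)
    (by rw [hdet]; exact one_ne_zero)
  rw [hL] at this
  rw [this, hdet, inv_one, abs_one, ENNReal.ofReal_one, one_smul]

theorem rotate_unrotate (ψ : ℝ) (t : ℝ × ℝ) : rotate ψ (unrotate ψ t) = t := by
  have h := Real.sin_sq_add_cos_sq ψ
  ext <;> simp only [unrotate, rotate]
  · linear_combination t.1 * h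
  · linear_combination t.2 * h

theorem measurableEmbedding_rotate (ψ : ℝ) : MeasurableEmbedding (rotate ψ) := by
  have h1 : Continuous (rotate ψ) := by unfold rotate; fun_prop
  have h2 : Continuous (unrotate ψ) := by unfold unrotate; fun_prop
  let e : ℝ × ℝ ≃ₜ ℝ × ℝ :=
    { toFun := rotate ψ, invFun := unrotate ψ, left_inv := unrotate_rotate ψ,
      right_inv := rotate_unrotate ψ, continuous_toFun := h1, continuous_invFun := h2 }
  exact e.measurableEmbedding

theorem integral_comp_sub_smul_rotate (H : ℝ × ℝ → ℝ) (z : ℝ × ℝ) (ψ h : ℝ) :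
    ∫ t, H (z - h • rotate ψ t) = (h ^ 2)⁻¹ * ∫ s, H s := by
  have h1 := (measurePreserving_rotate ψ).integral_comp (measurableEmbedding_rotate ψ)
    (fun t => H (z - h • t))
  rw [h1]
  have h2 := Measure.integral_comp_smul (volume : Measure (ℝ × ℝ)) (fun t => H (z - t)) h
  rw [h2, integral_sub_left_eq_self H volume z]
  simp

/-! ### Regular grids -/

/-- The cell of `[0, 1)²` with index `i`. -/
def cell (n : ℕ) (i : Fin n × Fin n) : Set (ℝ × ℝ) :=
  Ico (((i.1 : ℕ) : ℝ) / n) ((((i.1 : ℕ) : ℝ) + 1) / n) ×ˢ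
    Ico (((i.2 : ℕ) : ℝ) / n) ((((i.2 : ℕ) : ℝ) + 1) / n)

theorem measurableSet_cell (n : ℕ) (i : Fin n × Fin n) : MeasurableSet (cell n i) :=
  measurableSet_Ico.prod measurableSet_Ico

/-- The function that is constant equal to `c i` on the cell `i`, and zero outside `[0, 1)²`. -/
def cellFun (n : ℕ) (c : Fin n × Fin n → ℝ) (s : ℝ × ℝ) : ℝ :=
  ∑ i, (cell n i).indicator (fun _ => c i) s

theorem measurable_cellFun (n : ℕ) (c : Fin n × Fin n → ℝ) : Measurable (cellFun n c) := by
  unfold cellFun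
  exact Finset.measurable_sum _ fun i _ => measurable_const.indicator (measurableSet_cell n i)

theorem volume_cell (n : ℕ) (i : Fin n × Fin n) :
    volume.real (cell n i) = ((n : ℝ) ^ 2)⁻¹ := by
  have hn : (0 : ℝ) < n := by exact_mod_cast i.1.pos
  have key : ∀ a : ℝ, (volume : Measure ℝ).real (Ico (a / n) ((a + 1) / n)) = (n : ℝ)⁻¹ := by
    intro a
    rw [Real.volume_real_Ico_of_le (by gcongr; linarith)]
    field_simp; ring
  rw [cell, Measure.volume_eq_prod, measureReal_prod_prod, key, key]
  field_simp

theorem integral_cellFun (n : ℕ) (c : Fin n × Fin n → ℝ) :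
    ∫ s, cellFun n c s = ((n : ℝ) ^ 2)⁻¹ * ∑ i, c i := by
  unfold cellFun
  rw [integral_finsetSum, Finset.mul_sum]
  · refine Finset.sum_congr rfl fun i _ => ?_
    rw [integral_indicator (measurableSet_cell n i), setIntegral_const, volume_cell, smul_eq_mul]
  · intro i _
    refine (integrable_indicator_iff (measurableSet_cell n i)).2 (integrableOn_const ?_)
    rw [cell, Measure.volume_eq_prod, Measure.prod_prod]
    simp only [Real.volume_Ico]
    exact ENNReal.mul_ne_top ENNReal.ofReal_ne_top ENNReal.ofReal_ne_top

theorem index_unique {n : ℕ} {a : ℝ} {i j : Fin n}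
    (hi : a ∈ Ico (((i : ℕ) : ℝ) / n) ((((i : ℕ) : ℝ) + 1) / n))
    (hj : a ∈ Ico (((j : ℕ) : ℝ) / n) ((((j : ℕ) : ℝ) + 1) / n)) : i = j := by
  have hn : (0 : ℝ) < n := by exact_mod_cast i.pos
  simp only [mem_Ico, div_le_iff₀ hn, lt_div_iff₀ hn] at hi hj
  have h1 : ((i : ℕ) : ℝ) < (j : ℕ) + 1 := by linarith
  have h2 : ((j : ℕ) : ℝ) < (i : ℕ) + 1 := by linarith
  ext
  have h1' : (i : ℕ) < (j : ℕ) + 1 := by exact_mod_cast h1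
  have h2' : (j : ℕ) < (i : ℕ) + 1 := by exact_mod_cast h2
  omega

theorem cellFun_of_mem {n : ℕ} (c : Fin n × Fin n → ℝ) {s : ℝ × ℝ} {i : Fin n × Fin n}
    (hs : s ∈ cell n i) : cellFun n c s = c i := by
  unfold cellFun
  rw [Finset.sum_eq_single i, indicator_of_mem hs]
  · intro j _ hj
    refine indicator_of_notMem (fun hs' => hj ?_) _
    exact Prod.ext (index_unique hs'.1 hs.1) (index_unique hs'.2 hs.2)
  · simp

theorem cellFun_of_forall_notMem {n : ℕ} (c : Fin n × Fin n → ℝ) {s : ℝ × ℝ}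
    (hs : ∀ i, s ∉ cell n i) : cellFun n c s = 0 :=
  Finset.sum_eq_zero fun i _ => indicator_of_notMem (hs i) _

theorem exists_index {n : ℕ} (hn : 0 < n) {a : ℝ} (ha : a ∈ Ico (0 : ℝ) 1) :
    ∃ i : Fin n, a ∈ Ico (((i : ℕ) : ℝ) / n) ((((i : ℕ) : ℝ) + 1) / n) := by
  have hn' : (0 : ℝ) < n := by exact_mod_cast hn
  have h0 : 0 ≤ a * n := mul_nonneg ha.1 hn'.le
  have hlt : ⌊a * n⌋₊ < n := by
    rw [Nat.floor_lt h0]; nlinarith [ha.2]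
  refine ⟨⟨⌊a * n⌋₊, hlt⟩, ?_⟩
  simp only [mem_Ico, div_le_iff₀ hn', lt_div_iff₀ hn']
  exact ⟨Nat.floor_le h0, Nat.lt_floor_add_one _⟩

theorem exists_mem_cell {n : ℕ} (hn : 0 < n) {s : ℝ × ℝ}
    (hs : s ∈ Ico (0 : ℝ) 1 ×ˢ Ico (0 : ℝ) 1) : ∃ i, s ∈ cell n i := by
  obtain ⟨i, hi⟩ := exists_index hn hs.1
  obtain ⟨j, hj⟩ := exists_index hn hs.2
  exact ⟨(i, j), hi, hj⟩

/-- One design point in each cell of length `1 / n`. -/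
def InCells {n : ℕ} (d : Fin n → ℝ) : Prop :=
  ∀ i : Fin n, d i ∈ Icc (((i : ℕ) : ℝ) / n) ((((i : ℕ) : ℝ) + 1) / n)

theorem InCells.mem_unit {n : ℕ} {d : Fin n → ℝ} (hd : InCells d) (i : Fin n) :
    d i ∈ Icc (0 : ℝ) 1 := by
  have hn : (0 : ℝ) < n := by exact_mod_cast i.pos
  refine ⟨(by positivity : (0 : ℝ) ≤ ((i : ℕ) : ℝ) / n).trans (hd i).1, (hd i).2.trans ?_⟩
  rw [div_le_one hn]
  exact_mod_cast i.2

theorem InCells.norm_sub_le {n : ℕ} {d : Fin n → ℝ} (hd : InCells d) {s : ℝ × ℝ}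
    {i : Fin n × Fin n} (hs : s ∈ cell n i) : ‖s - (d i.1, d i.2)‖ ≤ (n : ℝ)⁻¹ := by
  have key : ∀ (a : ℝ) (j : Fin n), a ∈ Ico (((j : ℕ) : ℝ) / n) ((((j : ℕ) : ℝ) + 1) / n) →
      |a - d j| ≤ (n : ℝ)⁻¹ := by
    intro a j ha
    have h1 := hd j
    have h2 : ((((j : ℕ) : ℝ) + 1) / n) = ((j : ℕ) : ℝ) / n + (n : ℝ)⁻¹ := by
      rw [add_div, one_div]
    rw [h2] at ha h1
    rw [abs_le]; constructor <;> linarith [ha.1, ha.2, h1.1, h1.2]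
  rw [Prod.norm_def, max_le_iff]
  exact ⟨key _ _ hs.1, key _ _ hs.2⟩

/-! ### Kernel sums -/

/-- The kernel-weighted sum `(n h)⁻² ∑ A_i F(R_{-ψ} (z - x_i) / h)` at `z = (x, y)`. -/
def kernelSum {n : ℕ} (d : Fin n → ℝ) (A : Fin n × Fin n → ℝ) (F : ℝ × ℝ → ℝ)
    (x y ψ h : ℝ) : ℝ :=
  ((n * h) ^ 2)⁻¹ * ∑ i, A i * F (unrotate ψ ((x - d i.1) / h, (y - d i.2) / h))

/-- The sum is the integral of a step function over the grid cells. Substituting `s = z - h R_ψ t`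
moves it to the coordinates of the window, where the domain no longer depends on `h` and dominated
convergence becomes available. -/
theorem kernelSum_eq_integral {n : ℕ} (d : Fin n → ℝ) (A : Fin n × Fin n → ℝ) (F : ℝ × ℝ → ℝ)
    (x y ψ h : ℝ) :
    kernelSum d A F x y ψ h =
      ∫ t, cellFun n (fun i => A i * F (unrotate ψ ((x - d i.1) / h, (y - d i.2) / h)))
        ((x, y) - h • rotate ψ t) := by
  rw [integral_comp_sub_smul_rotate, integral_cellFun, kernelSum, mul_pow, mul_inv]
  ring

theorem aestronglyMeasurable_cellFun_comp {n : ℕ} (c : Fin n × Fin n → ℝ) (z : ℝ × ℝ)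
    (ψ h : ℝ) : AEStronglyMeasurable (fun t => cellFun n c (z - h • rotate ψ t)) volume := by
  refine ((measurable_cellFun n c).comp ?_).aestronglyMeasurable
  have h1 : Continuous (rotate ψ) := by unfold rotate; fun_prop
  exact (by fun_prop : Continuous fun t => z - h • rotate ψ t).measurable

/-- In the rotated and rescaled coordinates, a design point is close to each point of its cell. -/
theorem InCells.norm_unrotate_sub_le {n : ℕ} {d : Fin n → ℝ} (hd : InCells d) {h : ℝ} (hh : 0 < h)
    {x y ψ : ℝ} {t : ℝ × ℝ} {i : Fin n × Fin n} (hs : (x, y) - h • rotate ψ t ∈ cell n i) :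
    ‖unrotate ψ ((x - d i.1) / h, (y - d i.2) / h) - t‖ ≤ 2 / (n * h) := by
  have h1 := hd.norm_sub_le hs
  have h2 : ((x - d i.1) / h, (y - d i.2) / h) =
      rotate ψ t + h⁻¹ • ((x, y) - h • rotate ψ t - (d i.1, d i.2)) := by
    ext
    · simp; field_simp; ring
    · simp; field_simp; ring
  rw [h2, unrotate_add, unrotate_rotate, add_sub_cancel_left]
  refine (norm_unrotate_le _ _).trans ?_
  rw [norm_smul, norm_inv, Real.norm_of_nonneg hh.le]
  have : (2 : ℝ) / (n * h) = 2 * (h⁻¹ * (n : ℝ)⁻¹) := by rw [mul_comm (n : ℝ), div_eq_mul_inv, mul_inv]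
  rw [this]
  gcongr

/-- The square `[-r, r]²`. -/
def square (r : ℝ) : Set (ℝ × ℝ) := Icc (-r) r ×ˢ Icc (-r) r

theorem measurableSet_square (r : ℝ) : MeasurableSet (square r) :=
  measurableSet_Icc.prod measurableSet_Icc

theorem volume_real_square {r : ℝ} (hr : 0 ≤ r) : volume.real (square r) = (2 * r) ^ 2 := by
  rw [square, Measure.volume_eq_prod, measureReal_prod_prod,
    Real.volume_real_Icc_of_le (by linarith)]
  ring

theorem integrable_indicator_square (r C : ℝ) :
    Integrable ((square r).indicator fun _ => C) volume := by
  refine (integrable_indicator_iff (measurableSet_square r)).2 (integrableOn_const ?_)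
  rw [square, Measure.volume_eq_prod, Measure.prod_prod, Real.volume_Icc]
  exact ENNReal.mul_ne_top ENNReal.ofReal_ne_top ENNReal.ofReal_ne_top

theorem mem_square {r : ℝ} {t : ℝ × ℝ} : t ∈ square r ↔ ‖t‖ ≤ r := by
  rw [Prod.norm_def, max_le_iff, Real.norm_eq_abs, Real.norm_eq_abs, abs_le, abs_le]
  rfl

/-- In window coordinates a design point is within `2 / (n h) ≤ 2` of every point of its cell, so
the support radius `r` of `F` grows to at most `r + 2`. This is the dominating function for the
Riemann sums. -/
theorem norm_cellFun_rotate_le {n : ℕ} {d : Fin n → ℝ} (hd : InCells d)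
    {A : Fin n × Fin n → ℝ} {F : ℝ × ℝ → ℝ} {a B r h : ℝ} (ha : 0 ≤ a) (hB : 0 ≤ B)
    (hh : 0 < h) (hnh : 1 ≤ n * h)
    (hA : ∀ i, |A i| ≤ a) (hF : ∀ p, |F p| ≤ B) (hFr : ∀ p, r < ‖p‖ → F p = 0) (x y ψ : ℝ)
    (t : ℝ × ℝ) :
    ‖cellFun n (fun i => A i * F (unrotate ψ ((x - d i.1) / h, (y - d i.2) / h)))
        ((x, y) - h • rotate ψ t)‖ ≤ (square (r + 2)).indicator (fun _ => a * B) t := by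
  have hpos : 0 ≤ (square (r + 2)).indicator (fun _ => a * B) t :=
    indicator_nonneg (fun _ _ => mul_nonneg ha hB) _
  by_cases hex : ∃ i, (x, y) - h • rotate ψ t ∈ cell n i
  · obtain ⟨i, hi⟩ := hex
    rw [cellFun_of_mem _ hi]
    have h1 := hd.norm_unrotate_sub_le hh hi
    have h2 : 2 / ((n : ℝ) * h) ≤ 2 := div_le_self (by norm_num) hnh
    set q := unrotate ψ ((x - d i.1) / h, (y - d i.2) / h)
    by_cases ht : t ∈ square (r + 2)
    · rw [indicator_of_mem ht, norm_mul]
      exact mul_le_mul (hA i) (hF q) (abs_nonneg _) ha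
    · have : r < ‖q‖ := by
        rw [mem_square] at ht
        have := norm_sub_norm_le t q
        rw [norm_sub_rev] at this
        linarith
      rw [hFr q this, mul_zero, norm_zero]; exact hpos
  · push Not at hex
    rw [cellFun_of_forall_notMem _ hex, norm_zero]; exact hpos

/-- Kernel sums of bounded weights with compactly supported kernels are uniformly bounded. -/
theorem abs_kernelSum_le {n : ℕ} {d : Fin n → ℝ} (hd : InCells d) {A : Fin n × Fin n → ℝ}
    {F : ℝ × ℝ → ℝ} {a B r h : ℝ} (ha : 0 ≤ a) (hB : 0 ≤ B) (hr : 0 ≤ r) (hh : 0 < h)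
    (hnh : 1 ≤ n * h)
    (hA : ∀ i, |A i| ≤ a) (hF : ∀ p, |F p| ≤ B) (hFr : ∀ p, r < ‖p‖ → F p = 0) (x y ψ : ℝ) :
    |kernelSum d A F x y ψ h| ≤ a * B * (2 * (r + 2)) ^ 2 := by
  rw [kernelSum_eq_integral, ← Real.norm_eq_abs]
  refine (norm_integral_le_of_norm_le (integrable_indicator_square (r + 2) (a * B))
    (Eventually.of_forall fun t =>
      norm_cellFun_rotate_le hd ha hB hh hnh hA hF hFr x y ψ t)).trans ?_
  rw [integral_indicator (measurableSet_square _), setIntegral_const,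
    volume_real_square (by linarith), smul_eq_mul, mul_comm]

/-- Riemann-sum convergence of kernel sums, along an arbitrary filter. -/
theorem tendsto_kernelSum_sub_integral {ι : Type*} {l : Filter ι} [l.IsCountablyGenerated]
    {N : ι → ℕ} {d : ∀ k, Fin (N k) → ℝ} (hd : ∀ k, InCells (d k))
    {h x y ψ : ι → ℝ} (hh : ∀ᶠ k in l, 0 < h k) (hnh : Tendsto (fun k => N k * h k) l atTop)
    {A : ∀ k, Fin (N k) × Fin (N k) → ℝ} {a : ℝ} (hA : ∀ k i, |A k i| ≤ a)
    {F : ℝ × ℝ → ℝ} (hFc : Continuous F) (hF0 : ∀ p, 1 < ‖p‖ → F p = 0)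
    {c : ι → ℝ × ℝ → ℝ} (hcm : ∀ k, Measurable (c k)) (hc : ∀ k t, |c k t| ≤ a)
    (hlim : ∀ᵐ t : ℝ × ℝ, F t ≠ 0 → ∀ ρ > 0, ∀ᶠ k in l,
      (∀ i, (x k, y k) - h k • rotate (ψ k) t ∈ cell (N k) i → |A k i - c k t| ≤ ρ) ∧
      ((∀ i, (x k, y k) - h k • rotate (ψ k) t ∉ cell (N k) i) → |c k t| ≤ ρ)) :
    Tendsto (fun k => kernelSum (d k) (A k) F (x k) (y k) (ψ k) (h k) - ∫ t, c k t * F t) l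
      (𝓝 0) := by
  rcases l.eq_or_neBot with rfl | hl
  · simp
  have ha : 0 ≤ a := by
    obtain ⟨k⟩ := hl.nonempty
    exact (abs_nonneg _).trans (hc k 0)
  have hFsupp : HasCompactSupport F := by
    refine HasCompactSupport.of_support_subset_isCompact (isCompact_closedBall (0 : ℝ × ℝ) 1) ?_
    intro p hp
    rw [mem_closedBall_zero_iff]
    by_contra hcon
    exact hp (hF0 p (not_le.1 hcon))
  obtain ⟨B, hB⟩ := hFc.bounded_above_of_compact_support hFsupp
  have hB0 : 0 ≤ B := (norm_nonneg _).trans (hB 0)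
  have hFint : Integrable F := hFc.integrable_of_hasCompactSupport hFsupp
  have hcF : ∀ k, Integrable fun t => c k t * F t := fun k =>
    hFint.bdd_mul (hcm k).aestronglyMeasurable (Eventually.of_forall (hc k))
  set f : ι → ℝ × ℝ → ℝ := fun k t =>
    cellFun (N k) (fun i => A k i *
      F (unrotate (ψ k) ((x k - d k i.1) / h k, (y k - d k i.2) / h k)))
        ((x k, y k) - h k • rotate (ψ k) t) with hf
  have hbound : ∀ᶠ k in l, ∀ t, ‖f k t‖ ≤ (square 3).indicator (fun _ => a * B) t := by
    filter_upwards [hh, hnh.eventually_ge_atTop 1] with k hk1 hk2 t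
    have := norm_cellFun_rotate_le (hd k) ha hB0 hk1 hk2 (hA k) hB hF0 (x k) (y k) (ψ k) t
    norm_num at this
    exact this
  have hfm : ∀ k, AEStronglyMeasurable (f k) volume := fun k =>
    aestronglyMeasurable_cellFun_comp _ _ _ _
  have hfi : ∀ᶠ k in l, Integrable (f k) := by
    filter_upwards [hbound] with k hk
    exact (integrable_indicator_square 3 (a * B)).mono' (hfm k) (Eventually.of_forall hk)
  have hmain : Tendsto (fun k => ∫ t, (f k t - c k t * F t)) l (𝓝 (∫ _ : ℝ × ℝ, (0 : ℝ))) := by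
    refine tendsto_integral_filter_of_dominated_convergence
      (fun t => (square 3).indicator (fun _ => a * B) t + a * ‖F t‖)
      (Eventually.of_forall fun k => (hfm k).sub (hcF k).aestronglyMeasurable) ?_
      ((integrable_indicator_square 3 (a * B)).add (hFint.norm.const_mul a)) ?_
    · filter_upwards [hbound] with k hk
      refine Eventually.of_forall fun t => (norm_sub_le _ _).trans (add_le_add (hk t) ?_)
      rw [norm_mul]
      exact mul_le_mul_of_nonneg_right (hc k t) (norm_nonneg _)
    -- If the point belonging to `t` lies in a cell, the error splits into the oscillation of `F`
    -- over a distance `O(1 / (n h))` and the error of the weight. If it lies in no cell, the step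
    -- function is zero and `c` itself must be small. The summands `+ 1` in the denominators only
    -- exclude division by zero.
    · filter_upwards [hlim] with t ht
      rw [Metric.tendsto_nhds]
      intro ε hε
      have hcont := Metric.continuous_iff.1 hFc t (ε / (2 * (a + 1))) (by positivity)
      obtain ⟨δ, hδ, hδF⟩ := hcont
      have hρ : 0 < ε / (2 * (B + 1)) := by positivity
      have hcl : ∀ᶠ k in l, F t ≠ 0 → 
          (∀ i, (x k, y k) - h k • rotate (ψ k) t ∈ cell (N k) i →
            |A k i - c k t| ≤ ε / (2 * (B + 1))) ∧
          ((∀ i, (x k, y k) - h k • rotate (ψ k) t ∉ cell (N k) i) →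
            |c k t| ≤ ε / (2 * (B + 1))) := by
        by_cases hFt : F t = 0
        · exact Eventually.of_forall fun k hk => absurd hFt hk
        · filter_upwards [ht hFt _ hρ] with k hk _ using hk
      filter_upwards [hh, hnh.eventually_gt_atTop (2 / δ), hcl] with k hk1 hk2 hk3
      rw [dist_zero_right]
      have hFtB : ‖F t‖ ≤ B := hB t
      have hsmall : ε / (2 * (B + 1)) * ‖F t‖ < ε / 2 := by
        calc ε / (2 * (B + 1)) * ‖F t‖ ≤ ε / (2 * (B + 1)) * B := by gcongr
          _ < ε / 2 := by
            rw [div_mul_eq_mul_div, div_lt_div_iff₀ (by positivity) (by positivity)]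
            nlinarith
      by_cases hex : ∃ i, (x k, y k) - h k • rotate (ψ k) t ∈ cell (N k) i
      · obtain ⟨i, hi⟩ := hex
        simp only [hf]
        rw [cellFun_of_mem _ hi]
        have h1 := (hd k).norm_unrotate_sub_le hk1 hi
        set q := unrotate (ψ k) ((x k - d k i.1) / h k, (y k - d k i.2) / h k)
        have hpos : 0 < (N k : ℝ) * h k := lt_trans (by positivity) hk2
        have h2 : dist q t < δ := by
          rw [dist_eq_norm]
          refine h1.trans_lt ?_
          rw [div_lt_iff₀ hpos]
          rwa [div_lt_iff₀ hδ, mul_comm] at hk2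
        have h3 := hδF q h2
        rw [Real.dist_eq] at h3
        have e : A k i * F q - c k t * F t = A k i * (F q - F t) + (A k i - c k t) * F t := by
          ring
        rw [e]
        have h4 : ‖A k i * (F q - F t)‖ ≤ ε / 2 := by
          rw [norm_mul]
          calc ‖A k i‖ * ‖F q - F t‖ ≤ a * (ε / (2 * (a + 1))) :=
                mul_le_mul (hA k i) h3.le (norm_nonneg _) ha
            _ ≤ ε / 2 := by
                rw [mul_div_assoc', div_le_div_iff₀ (by positivity) (by positivity)]
                nlinarith
        have h5 : ‖(A k i - c k t) * F t‖ < ε / 2 := by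
          rw [norm_mul]
          by_cases hFt : F t = 0
          · rw [hFt, norm_zero, mul_zero]; positivity
          · exact (mul_le_mul_of_nonneg_right ((hk3 hFt).1 i hi) (norm_nonneg _)).trans_lt hsmall
        linarith [norm_add_le (A k i * (F q - F t)) ((A k i - c k t) * F t)]
      · push Not at hex
        simp only [hf]
        rw [cellFun_of_forall_notMem _ hex, zero_sub, norm_neg, norm_mul]
        by_cases hFt : F t = 0
        · rw [hFt, norm_zero, mul_zero]; exact hε
        · have := (mul_le_mul_of_nonneg_right ((hk3 hFt).2 hex) (norm_nonneg (F t))).trans_lt hsmall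
          exact this.trans (by linarith)
  rw [integral_zero] at hmain
  refine hmain.congr' ?_
  filter_upwards [hfi] with k hk
  rw [integral_sub hk (hcF k), kernelSum_eq_integral]

/-! ### The image near and away from the edge -/

/-- The regularity of the image used below: continuity, and differentiability of the edge at an
interior point `x` with interior height. -/
structure EdgeModel (m : ℝ → ℝ → ℝ) (τ φ : ℝ → ℝ) (x : ℝ) : Prop where
  smooth_cont : ContinuousOn (fun p : ℝ × ℝ => m p.1 p.2) (Icc 0 1 ×ˢ Icc 0 1)
  jump_cont : ContinuousOn τ (Icc 0 1)
  edge_deriv : HasDerivAt φ (deriv φ x) x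
  point_mem : x ∈ Ioo (0 : ℝ) 1
  edge_mem : φ x ∈ Ioo (0 : ℝ) 1

/-- The unit square. -/
def unitSquare : Set (ℝ × ℝ) := Icc 0 1 ×ˢ Icc 0 1

theorem isCompact_unitSquare : IsCompact unitSquare := isCompact_Icc.prod isCompact_Icc

theorem image_eq_of_nonneg (m : ℝ → ℝ → ℝ) (τ φ : ℝ → ℝ) {u v : ℝ} (hv : 0 ≤ v) :
    image m τ φ u v = m u v + τ u * (if v ≤ φ u then 1 else 0) := by
  unfold image
  congr 2
  by_cases h : v ≤ φ u
  · rw [indicator_of_mem (show v ∈ Icc 0 (φ u) from ⟨hv, h⟩), if_pos h]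
  · rw [indicator_of_notMem (fun hh => h hh.2), if_neg h]

section EdgeModel

variable {m : ℝ → ℝ → ℝ} {τ φ : ℝ → ℝ} {x : ℝ}

theorem EdgeModel.exists_bound (M : EdgeModel m τ φ x) :
    ∃ a, 0 ≤ a ∧ |m x (φ x)| + |τ x| ≤ a ∧ ∀ p ∈ unitSquare, |image m τ φ p.1 p.2| ≤ a := by
  obtain ⟨a, ha⟩ := isCompact_unitSquare.exists_bound_of_continuousOn M.smooth_cont
  obtain ⟨b, hb⟩ := isCompact_Icc.exists_bound_of_continuousOn M.jump_cont
  have hx : x ∈ Icc (0 : ℝ) 1 := Ioo_subset_Icc_self M.point_mem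
  have h0 : |m x (φ x)| + |τ x| ≤ a + b :=
    add_le_add (ha (x, φ x) ⟨hx, Ioo_subset_Icc_self M.edge_mem⟩) (hb x hx)
  refine ⟨a + b, le_trans (by positivity) h0, h0, fun p hp => ?_⟩
  rw [image_eq_of_nonneg m τ φ hp.2.1]
  refine (abs_add_le _ _).trans (add_le_add (ha p hp) ?_)
  have := hb p.1 hp.1
  split_ifs
  · simpa using this
  · simpa using (norm_nonneg _).trans this

/-- Since `u - x = O(h)`, the remainder `o(u - x)` of the first-order expansion of `φ` is `o(h)`. -/
theorem EdgeModel.tendsto_edge (M : EdgeModel m τ φ x) {κ : Type*} {L : Filter κ}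
    {h u : κ → ℝ} {v : ℝ} (hh : ∀ᶠ k in L, 0 < h k) (hh0 : Tendsto h L (𝓝 0))
    (hu : Tendsto (fun k => (u k - x) / h k) L (𝓝 v)) :
    Tendsto u L (𝓝 x) ∧ Tendsto (fun k => (φ (u k) - φ x) / h k) L (𝓝 (deriv φ x * v)) := by
  have hux : Tendsto u L (𝓝 x) := by
    have h1 := (hu.mul hh0).add_const x
    rw [mul_zero, zero_add] at h1
    refine h1.congr' ?_
    filter_upwards [hh] with k hk
    field_simp; ring
  refine ⟨hux, ?_⟩
  have ho := (hasDerivAt_iff_isLittleO.1 M.edge_deriv).comp_tendsto hux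
  have hO : (fun k => u k - x) =O[L] h := by
    refine Asymptotics.isBigO_of_div_tendsto_nhds ?_ v hu
    filter_upwards [hh] with k hk hk0
    exact absurd hk0 hk.ne'
  have h2 := (ho.trans_isBigO hO).tendsto_div_nhds_zero
  have h3 := h2.add (hu.const_mul (deriv φ x))
  rw [zero_add] at h3
  refine h3.congr' ?_
  filter_upwards [hh] with k hk
  simp only [Function.comp, smul_eq_mul]
  field_simp; ring

/-- The condition `hne` keeps the rescaled limit point off the tangent, so the points eventually
stay strictly on one side of the curve and the indicator is constant; the rest is continuity at `(x,
φ x)`. -/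
theorem EdgeModel.tendsto_image_near (M : EdgeModel m τ φ x) {κ : Type*} {L : Filter κ}
    {h : κ → ℝ} {p : κ → ℝ × ℝ} {v₁ v₂ : ℝ} (hh : ∀ᶠ k in L, 0 < h k) (hh0 : Tendsto h L (𝓝 0))
    (hp : ∀ᶠ k in L, p k ∈ unitSquare)
    (h1 : Tendsto (fun k => ((p k).1 - x) / h k) L (𝓝 v₁))
    (h2 : Tendsto (fun k => ((p k).2 - φ x) / h k) L (𝓝 v₂)) (hne : v₂ ≠ deriv φ x * v₁) :
    Tendsto (fun k => image m τ φ (p k).1 (p k).2) L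
      (𝓝 (m x (φ x) + τ x * (if v₂ < deriv φ x * v₁ then 1 else 0))) := by
  obtain ⟨hx1, he⟩ := M.tendsto_edge hh hh0 h1
  have hx2 : Tendsto (fun k => (p k).2) L (𝓝 (φ x)) := by
    have h3 := (h2.mul hh0).add_const (φ x)
    rw [mul_zero, zero_add] at h3
    refine h3.congr' ?_
    filter_upwards [hh] with k hk
    field_simp; ring
  have hx : x ∈ Icc (0 : ℝ) 1 := Ioo_subset_Icc_self M.point_mem
  have hm : Tendsto (fun k => m (p k).1 (p k).2) L (𝓝 (m x (φ x))) := by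
    have hc := M.smooth_cont (x, φ x) ⟨hx, Ioo_subset_Icc_self M.edge_mem⟩
    exact hc.tendsto.comp (tendsto_nhdsWithin_iff.2 ⟨(hx1.prodMk_nhds hx2), hp⟩)
  have hτ : Tendsto (fun k => τ (p k).1) L (𝓝 (τ x)) :=
    (M.jump_cont x hx).tendsto.comp (tendsto_nhdsWithin_iff.2 ⟨hx1, hp.mono fun k hk => hk.1⟩)
  have hd := h2.sub he
  have hind : Tendsto (fun k => (if (p k).2 ≤ φ (p k).1 then 1 else 0 : ℝ)) L
      (𝓝 (if v₂ < deriv φ x * v₁ then 1 else 0)) := by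
    refine tendsto_const_nhds.congr' ?_
    rcases lt_or_gt_of_ne hne with hlt | hgt
    · filter_upwards [hh, hd.eventually_lt_const (sub_neg.2 hlt)] with k hk hk2
      rw [if_pos hlt, if_pos]
      rw [← sub_div, div_neg_iff] at hk2
      rcases hk2 with hk2 | hk2 <;> linarith [hk2.1, hk2.2]
    · filter_upwards [hh, hd.eventually_const_lt (sub_pos.2 hgt)] with k hk hk2
      rw [if_neg (not_lt.2 hgt.le), if_neg]
      rw [← sub_div, div_pos_iff] at hk2
      intro hle
      rcases hk2 with hk2 | hk2 <;> linarith [hk2.1, hk2.2]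
  refine (hm.add (hτ.mul hind)).congr' ?_
  filter_upwards [hp] with k hk
  rw [image_eq_of_nonneg m τ φ hk.2.1]

/-- The vertical distance to the edge is large compared with `h`, so the whole window lies on one
side of it. The heights `y` need not converge, hence the comparison with the value at `(x, y k)`
through uniform continuity of `m` rather than with a limit. -/
theorem EdgeModel.tendsto_image_far (M : EdgeModel m τ φ x) {κ : Type*} {L : Filter κ}
    {h y : κ → ℝ} {p : κ → ℝ × ℝ} {v₁ v₂ : ℝ} (hh : ∀ᶠ k in L, 0 < h k)
    (hh0 : Tendsto h L (𝓝 0)) (hp : ∀ᶠ k in L, p k ∈ unitSquare)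
    (hy : ∀ᶠ k in L, y k ∈ Icc (0 : ℝ) 1)
    (h1 : Tendsto (fun k => ((p k).1 - x) / h k) L (𝓝 v₁))
    (h2 : Tendsto (fun k => ((p k).2 - y k) / h k) L (𝓝 v₂))
    (hw : Tendsto (fun k => |(y k - φ x) / h k|) L atTop) :
    Tendsto (fun k => image m τ φ (p k).1 (p k).2 - image m τ φ x (y k)) L (𝓝 0) := by
  obtain ⟨hx1, he⟩ := M.tendsto_edge hh hh0 h1
  have hx : x ∈ Icc (0 : ℝ) 1 := Ioo_subset_Icc_self M.point_mem
  have hx2 : Tendsto (fun k => (p k).2 - y k) L (𝓝 0) := by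
    have h3 := (h2.mul hh0)
    rw [mul_zero] at h3
    refine h3.congr' ?_
    filter_upwards [hh] with k hk
    field_simp
  have hm : Tendsto (fun k => m (p k).1 (p k).2 - m x (y k)) L (𝓝 0) := by
    have huc := isCompact_unitSquare.uniformContinuousOn_of_continuous M.smooth_cont
    rw [Metric.uniformContinuousOn_iff] at huc
    rw [Metric.tendsto_nhds]
    intro ε hε
    obtain ⟨δ, hδ, huc⟩ := huc ε hε
    have h4 := Metric.tendsto_nhds.1 hx1 δ hδ
    have h5 := Metric.tendsto_nhds.1 hx2 δ hδ
    filter_upwards [hp, hy, h4, h5] with k hk1 hk2 hk3 hk4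
    rw [dist_zero_right, ← dist_eq_norm]
    refine huc (p k) hk1 (x, y k) ⟨hx, hk2⟩ ?_
    rw [Prod.dist_eq, max_lt_iff]
    refine ⟨hk3, ?_⟩
    rwa [dist_zero_right, ← dist_eq_norm] at hk4
  have hτ : Tendsto (fun k => τ (p k).1) L (𝓝 (τ x)) :=
    (M.jump_cont x hx).tendsto.comp (tendsto_nhdsWithin_iff.2 ⟨hx1, hp.mono fun k hk => hk.1⟩)
  have hd := (h2.sub he).abs
  have hind : ∀ᶠ k in L, (if (p k).2 ≤ φ (p k).1 then 1 else 0 : ℝ) =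
      (if y k ≤ φ x then 1 else 0 : ℝ) := by
    filter_upwards [hh, hd.eventually_lt_const (lt_add_one _),
      hw.eventually_gt_atTop (|v₂ - deriv φ x * v₁| + 1)] with k hk hk1 hk2
    have hk3 := hk1.trans hk2
    rw [← sub_div, abs_div, abs_div, div_lt_div_iff_of_pos_right (abs_pos.2 hk.ne')] at hk3
    by_cases hle : y k ≤ φ x
    · rw [if_pos hle, if_pos]
      rw [abs_of_nonpos (sub_nonpos.2 hle)] at hk3
      linarith [(abs_lt.1 hk3).2]
    · rw [if_neg hle, if_neg]
      rw [abs_of_pos (sub_pos.2 (not_le.1 hle))] at hk3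
      intro hle2
      linarith [(abs_lt.1 hk3).1]
  have hτ2 : Tendsto (fun k => (τ (p k).1 - τ x) * (if y k ≤ φ x then 1 else 0 : ℝ)) L (𝓝 0) := by
    refine squeeze_zero_norm (a := fun k => ‖τ (p k).1 - τ x‖) (fun k => ?_) ?_
    · rw [norm_mul]
      refine mul_le_of_le_one_right (norm_nonneg _) ?_
      split_ifs <;> simp
    · simpa using (hτ.sub_const (τ x)).norm
  have h6 := hm.add hτ2
  rw [add_zero] at h6
  refine h6.congr' ?_
  filter_upwards [hp, hy, hind] with k hk1 hk2 hk3
  rw [image_eq_of_nonneg m τ φ hk1.2.1, image_eq_of_nonneg m τ φ hk2.1, hk3]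
  ring

/-! ### Limits of kernel sums of the image -/

/-- A continuous window that vanishes outside the open square `(-1, 1)²`. -/
structure IsWindow (F : ℝ × ℝ → ℝ) : Prop where
  cont : Continuous F
  zero : ∀ p, 1 ≤ ‖p‖ → F p = 0

/-- The linear form whose superlevel sets are the half-planes below the tangent, seen in
coordinates rotated by `ψ`. -/
def edgeForm (s ψ : ℝ) (t : ℝ × ℝ) : ℝ :=
  (Real.sin ψ - s * Real.cos ψ) * t.1 + (Real.cos ψ + s * Real.sin ψ) * t.2

/-- The limiting weight jumps only across this line. The form is nonzero: at its own coefficient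
vector it takes the value `1 + s ^ 2`. -/
theorem volume_edgeForm_eq (s ψ w : ℝ) : volume {t : ℝ × ℝ | edgeForm s ψ t = w} = 0 := by
  have hsc := Real.sin_sq_add_cos_sq ψ
  let L : ℝ × ℝ →ₗ[ℝ] ℝ := (Real.sin ψ - s * Real.cos ψ) • LinearMap.fst ℝ ℝ ℝ +
    (Real.cos ψ + s * Real.sin ψ) • LinearMap.snd ℝ ℝ ℝ
  have hL : ∀ t, L t = edgeForm s ψ t := fun t => rfl
  have hker : volume (LinearMap.ker L : Set (ℝ × ℝ)) = 0 := by
    apply Measure.addHaar_submodule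
    rw [Ne, LinearMap.ker_eq_top]
    intro h0
    have h1 : L (Real.sin ψ - s * Real.cos ψ, Real.cos ψ + s * Real.sin ψ) = 0 := by rw [h0]; rfl
    rw [hL, edgeForm] at h1
    nlinarith [sq_nonneg s]
  rcases Set.eq_empty_or_nonempty {t : ℝ × ℝ | edgeForm s ψ t = w} with he | ⟨t₀, ht₀⟩
  · rw [he, measure_empty]
  · have hset : {t : ℝ × ℝ | edgeForm s ψ t = w} =
        (fun t => t + -t₀) ⁻¹' (LinearMap.ker L : Set (ℝ × ℝ)) := by
      ext t
      have ht₀' : edgeForm s ψ t₀ = w := ht₀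
      have e : L (t + -t₀) = edgeForm s ψ t - w := by rw [map_add, map_neg, hL, hL, ht₀']; ring
      rw [mem_preimage, SetLike.mem_coe, LinearMap.mem_ker, e, sub_eq_zero]
      exact Iff.rfl
    rw [hset, measure_preimage_add_right, hker]

/-- Statements about sequences of points become statements uniform over all points in relation `S`
to the index, by taking limits along a filter on pairs. This gives uniformity over the design points
of the cells that meet a given window point. -/
theorem eventually_forall_near {ι κ : Type*} {l : Filter ι} {S : ι → κ → Prop} {Q : ι → κ → Prop} :
    (∀ᶠ q in Filter.comap Prod.fst l ⊓ 𝓟 {q : ι × κ | S q.1 q.2}, Q q.1 q.2) ↔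
      ∀ᶠ k in l, ∀ p, S k p → Q k p := by
  rw [eventually_inf_principal, eventually_comap]
  refine eventually_congr (Eventually.of_forall fun k => ?_)
  constructor
  · intro h p hp; exact h (k, p) rfl hp
  · rintro h ⟨k', p⟩ rfl hp; exact h p hp

/-- Design points whose cell meets a fixed rescaled point converge to that point after rescaling. -/
theorem tendsto_rescaled {ι : Type*} {l : Filter ι} {N : ι → ℕ} {h y ψ : ι → ℝ} {ψ₀ : ℝ}
    (hh : ∀ᶠ k in l, 0 < h k) (hnh : Tendsto (fun k => N k * h k) l atTop)
    (hψ : Tendsto ψ l (𝓝 ψ₀)) (x : ℝ) (t : ℝ × ℝ) {L : Filter (ι × (ℝ × ℝ))}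
    (hL : L = Filter.comap Prod.fst l ⊓ 𝓟 {q : ι × (ℝ × ℝ) |
      ‖(x, y q.1) - h q.1 • rotate (ψ q.1) t - q.2‖ ≤ (N q.1 : ℝ)⁻¹}) :
    Tendsto (fun q => (q.2.1 - x) / h q.1) L (𝓝 (-(rotate ψ₀ t).1)) ∧
    Tendsto (fun q => (q.2.2 - y q.1) / h q.1) L (𝓝 (-(rotate ψ₀ t).2)) := by
  have hfst : Tendsto Prod.fst L l := by
    rw [hL]; exact tendsto_comap.mono_left inf_le_left
  have hinv : Tendsto (fun q : ι × (ℝ × ℝ) => ((N q.1 : ℝ) * h q.1)⁻¹) L (𝓝 0) :=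
    (hnh.comp hfst).inv_tendsto_atTop
  have hR : Tendsto (fun q : ι × (ℝ × ℝ) => rotate (ψ q.1) t) L (𝓝 (rotate ψ₀ t)) :=
    ((by unfold rotate; fun_prop : Continuous fun ψ => rotate ψ t).tendsto ψ₀).comp (hψ.comp hfst)
  have hmem : ∀ᶠ q in L, ‖(x, y q.1) - h q.1 • rotate (ψ q.1) t - q.2‖ ≤ (N q.1 : ℝ)⁻¹ := by
    rw [hL]; exact mem_inf_of_right (mem_principal_self _)
  have hh' := hfst.eventually hh
  constructor
  · have h1 : Tendsto (fun q : ι × (ℝ × ℝ) =>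
        (q.2.1 - x) / h q.1 + (rotate (ψ q.1) t).1) L (𝓝 0) := by
      refine squeeze_zero_norm' ?_ hinv
      filter_upwards [hmem, hh'] with q hq1 hq2
      have := (norm_fst_le _).trans hq1
      simp only [Prod.fst_sub, Prod.smul_fst, smul_eq_mul, Real.norm_eq_abs] at this
      have e : (q.2.1 - x) / h q.1 + (rotate (ψ q.1) t).1 =
          -((x - h q.1 * (rotate (ψ q.1) t).1 - q.2.1) / h q.1) := by field_simp; ring
      rw [e, norm_neg, Real.norm_eq_abs, abs_div, abs_of_pos hq2, mul_inv, div_eq_mul_inv]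
      gcongr
    have h2 := h1.sub ((continuous_fst.tendsto _).comp hR)
    simp only [Function.comp_def, zero_sub] at h2
    exact h2.congr fun q => by ring
  · have h1 : Tendsto (fun q : ι × (ℝ × ℝ) =>
        (q.2.2 - y q.1) / h q.1 + (rotate (ψ q.1) t).2) L (𝓝 0) := by
      refine squeeze_zero_norm' ?_ hinv
      filter_upwards [hmem, hh'] with q hq1 hq2
      have := (norm_snd_le _).trans hq1
      simp only [Prod.snd_sub, Prod.smul_snd, smul_eq_mul, Real.norm_eq_abs] at this
      have e : (q.2.2 - y q.1) / h q.1 + (rotate (ψ q.1) t).2 =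
          -((y q.1 - h q.1 * (rotate (ψ q.1) t).2 - q.2.2) / h q.1) := by field_simp; ring
      rw [e, norm_neg, Real.norm_eq_abs, abs_div, abs_of_pos hq2, mul_inv, div_eq_mul_inv]
      gcongr
    have h2 := h1.sub ((continuous_snd.tendsto _).comp hR)
    simp only [Function.comp_def, zero_sub] at h2
    exact h2.congr fun q => by ring

/-- The weight of the edge in the limit: `m(x, φ(x)) + τ(x)` below the tangent and
`m(x, φ(x))` above. -/
def edgeWeight (m : ℝ → ℝ → ℝ) (τ φ : ℝ → ℝ) (x w ψ : ℝ) (t : ℝ × ℝ) : ℝ :=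
  m x (φ x) + τ x * (if w < edgeForm (deriv φ x) ψ t then 1 else 0)

theorem measurable_edgeWeight (m : ℝ → ℝ → ℝ) (τ φ : ℝ → ℝ) (x w ψ : ℝ) :
    Measurable (edgeWeight m τ φ x w ψ) := by
  unfold edgeWeight
  refine measurable_const.add (measurable_const.mul (Measurable.ite ?_ measurable_const
    measurable_const))
  exact measurableSet_lt measurable_const (by unfold edgeForm; fun_prop)

theorem abs_edgeWeight_le (m : ℝ → ℝ → ℝ) (τ φ : ℝ → ℝ) (x w ψ : ℝ) (t : ℝ × ℝ) :
    |edgeWeight m τ φ x w ψ t| ≤ |m x (φ x)| + |τ x| := by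
  unfold edgeWeight
  refine (abs_add_le _ _).trans (add_le_add le_rfl ?_)
  split_ifs <;> simp

theorem neg_rotate_lt_iff (s ψ w : ℝ) (t : ℝ × ℝ) :
    w - (rotate ψ t).2 < s * -(rotate ψ t).1 ↔ w < edgeForm s ψ t := by
  have : edgeForm s ψ t = (rotate ψ t).2 - s * (rotate ψ t).1 := by
    unfold edgeForm rotate; ring
  rw [this]; constructor <;> intro h <;> linarith

/-- A centre at distance about `w h` above the edge sees, after rescaling, the half-plane below a
line parallel to the tangent. The image converges at every window point off that line, hence almost
everywhere. -/
theorem tendsto_kernelSum_near (M : EdgeModel m τ φ x) {ι : Type*} {l : Filter ι}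
    [l.IsCountablyGenerated] {N : ι → ℕ} {d : ∀ k, Fin (N k) → ℝ} (hd : ∀ k, InCells (d k))
    {h y ψ : ι → ℝ} (hh : ∀ᶠ k in l, 0 < h k) (hh0 : Tendsto h l (𝓝 0))
    (hnh : Tendsto (fun k => N k * h k) l atTop) {F : ℝ × ℝ → ℝ} (hF : IsWindow F) {w ψ₀ : ℝ}
    (hy : Tendsto (fun k => (y k - φ x) / h k) l (𝓝 w)) (hψ : Tendsto ψ l (𝓝 ψ₀)) :
    Tendsto (fun k => kernelSum (d k) (fun i => image m τ φ (d k i.1) (d k i.2)) F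
      x (y k) (ψ k) (h k)) l (𝓝 (∫ t, edgeWeight m τ φ x w ψ₀ t * F t)) := by
  obtain ⟨a, ha0, ha1, ha2⟩ := M.exists_bound
  have key := tendsto_kernelSum_sub_integral (l := l) hd (x := fun _ => x) (y := y) (ψ := ψ) hh hnh
    (A := fun k i => image m τ φ (d k i.1) (d k i.2)) (a := a)
    (fun k i => ha2 (d k i.1, d k i.2) ⟨(hd k).mem_unit _, (hd k).mem_unit _⟩) hF.cont
    (fun p hp => hF.zero p hp.le) (c := fun _ => edgeWeight m τ φ x w ψ₀)
    (fun _ => measurable_edgeWeight m τ φ x w ψ₀)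
    (fun _ t => (abs_edgeWeight_le m τ φ x w ψ₀ t).trans ha1) ?_
  · have := key.add_const (∫ t, edgeWeight m τ φ x w ψ₀ t * F t)
    simpa using this
  have hae : ∀ᵐ t : ℝ × ℝ, edgeForm (deriv φ x) ψ₀ t ≠ w := by
    rw [ae_iff]; simpa using volume_edgeForm_eq (deriv φ x) ψ₀ w
  filter_upwards [hae] with t ht _ ρ hρ
  have hs1 : Tendsto (fun k => x - h k * (rotate (ψ k) t).1) l (𝓝 x) := by
    have : Tendsto (fun k => (rotate (ψ k) t).1) l (𝓝 (rotate ψ₀ t).1) :=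
      ((by unfold rotate; fun_prop : Continuous fun ψ => (rotate ψ t).1).tendsto ψ₀).comp hψ
    simpa using (tendsto_const_nhds (x := x)).sub (hh0.mul this)
  have hs2 : Tendsto (fun k => y k - h k * (rotate (ψ k) t).2) l (𝓝 (φ x)) := by
    have h1 : Tendsto (fun k => (rotate (ψ k) t).2) l (𝓝 (rotate ψ₀ t).2) :=
      ((by unfold rotate; fun_prop : Continuous fun ψ => (rotate ψ t).2).tendsto ψ₀).comp hψ
    have h2 : Tendsto y l (𝓝 (φ x)) := by
      have h3 := (hy.mul hh0).add_const (φ x)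
      rw [mul_zero, zero_add] at h3
      refine h3.congr' ?_
      filter_upwards [hh] with k hk
      field_simp; ring
    simpa using h2.sub (hh0.mul h1)
  have hN : ∀ᶠ k in l, 0 < N k := by
    filter_upwards [hnh.eventually_gt_atTop 0] with k hk
    refine Nat.pos_of_ne_zero fun h0 => ?_
    rw [h0] at hk; simp at hk
  set L : Filter (ι × (ℝ × ℝ)) := Filter.comap Prod.fst l ⊓ 𝓟 {q : ι × (ℝ × ℝ) |
      ‖(x, y q.1) - h q.1 • rotate (ψ q.1) t - q.2‖ ≤ (N q.1 : ℝ)⁻¹} ⊓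
      𝓟 {q | q.2 ∈ unitSquare} with hL
  have hfst : Tendsto Prod.fst L l :=
    tendsto_comap.mono_left (inf_le_left.trans inf_le_left)
  obtain ⟨hr1, hr2⟩ := tendsto_rescaled hh hnh hψ x t (y := y) rfl
  have hr2' : Tendsto (fun q : ι × (ℝ × ℝ) => (q.2.2 - φ x) / h q.1) L
      (𝓝 (w - (rotate ψ₀ t).2)) := by
    have := (hy.comp hfst).add (hr2.mono_left (inf_le_left : L ≤ _))
    rw [← sub_eq_add_neg] at this
    refine this.congr fun q => ?_
    simp only [Function.comp]; ring
  have hlim := M.tendsto_image_near (L := L) (h := fun q => h q.1) (p := fun q => q.2)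
    (hfst.eventually hh) (hh0.comp hfst) (mem_inf_of_right (mem_principal_self _))
    (hr1.mono_left inf_le_left) hr2' (by
      intro h1
      apply ht
      have : edgeForm (deriv φ x) ψ₀ t = (rotate ψ₀ t).2 - deriv φ x * (rotate ψ₀ t).1 := by
        unfold edgeForm rotate; ring
      rw [this]; linarith)
  simp only [neg_rotate_lt_iff] at hlim
  have hev := Metric.tendsto_nhds.1 hlim ρ hρ
  rw [hL, inf_assoc, inf_principal] at hev
  have hev' := (eventually_forall_near (S := fun k p =>
      ‖(x, y k) - h k • rotate (ψ k) t - p‖ ≤ (N k : ℝ)⁻¹ ∧ p ∈ unitSquare)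
      (Q := fun k p => dist (image m τ φ p.1 p.2) (m x (φ x) + τ x *
        (if w < edgeForm (deriv φ x) ψ₀ t then 1 else 0)) < ρ)).1 hev
  filter_upwards [hev', hs1.eventually (Ioo_mem_nhds M.point_mem.1 M.point_mem.2),
    hs2.eventually (Ioo_mem_nhds M.edge_mem.1 M.edge_mem.2), hN] with k hk1 hk2 hk3 hk4
  refine ⟨fun i hi => ?_, fun hno => ?_⟩
  · exact (hk1 (d k i.1, d k i.2) ⟨(hd k).norm_sub_le hi,
      ⟨(hd k).mem_unit _, (hd k).mem_unit _⟩⟩).le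
  · obtain ⟨i, hi⟩ := exists_mem_cell hk4 (s := (x, y k) - h k • rotate (ψ k) t)
      ⟨Ioo_subset_Ico_self hk2, Ioo_subset_Ico_self hk3⟩
    exact absurd hi (hno i)

/-- The open square `(-1, 1)²` lies in the open Euclidean disc of radius `√2`. This is the reason
for the margin `√2 h` in `heights`. -/
theorem IsWindow.rotate_eq_zero {F : ℝ × ℝ → ℝ} (hF : IsWindow F) {ψ : ℝ} {t : ℝ × ℝ}
    (ht : √2 ≤ |(rotate ψ t).2|) : F t = 0 := by
  refine hF.zero t ?_
  by_contra hlt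
  rw [not_le, Prod.norm_def, max_lt_iff, Real.norm_eq_abs, Real.norm_eq_abs] at hlt
  have h1 := sq_lt_one_iff_abs_lt_one t.1 |>.2 hlt.1
  have h2 := sq_lt_one_iff_abs_lt_one t.2 |>.2 hlt.2
  have h3 : (2 : ℝ) ≤ (rotate ψ t).2 ^ 2 := by
    rw [← sq_abs, ← Real.sq_sqrt (show (0 : ℝ) ≤ 2 by norm_num)]
    gcongr
  have h4 : (rotate ψ t).2 ^ 2 ≤ t.1 ^ 2 + t.2 ^ 2 := by
    have hsc := Real.sin_sq_add_cos_sq ψ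
    have : (rotate ψ t).1 ^ 2 + (rotate ψ t).2 ^ 2 = t.1 ^ 2 + t.2 ^ 2 := by
      unfold rotate
      linear_combination (t.1 ^ 2 + t.2 ^ 2) * hsc
    nlinarith [sq_nonneg (rotate ψ t).1]
  linarith

/-- Far from the edge the image is nearly constant over the window, and a window with integral zero
annihilates constants. -/
theorem tendsto_kernelSum_far (M : EdgeModel m τ φ x) {ι : Type*} {l : Filter ι}
    [l.IsCountablyGenerated] {N : ι → ℕ} {d : ∀ k, Fin (N k) → ℝ} (hd : ∀ k, InCells (d k))
    {h y ψ : ι → ℝ} (hh : ∀ᶠ k in l, 0 < h k) (hh0 : Tendsto h l (𝓝 0))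
    (hnh : Tendsto (fun k => N k * h k) l atTop) {F : ℝ × ℝ → ℝ} (hF : IsWindow F)
    (hFint : ∫ t, F t = 0) {ψ₀ : ℝ} (hy : ∀ k, y k ∈ Icc (0 : ℝ) 1)
    (hyh : ∀ᶠ k in l, y k ∈ heights (h k))
    (hw : Tendsto (fun k => |(y k - φ x) / h k|) l atTop) (hψ : Tendsto ψ l (𝓝 ψ₀)) :
    Tendsto (fun k => kernelSum (d k) (fun i => image m τ φ (d k i.1) (d k i.2)) F
      x (y k) (ψ k) (h k)) l (𝓝 0) := by
  obtain ⟨a, ha0, ha1, ha2⟩ := M.exists_bound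
  have hx : x ∈ Icc (0 : ℝ) 1 := Ioo_subset_Icc_self M.point_mem
  have key := tendsto_kernelSum_sub_integral (l := l) hd (x := fun _ => x) (y := y) (ψ := ψ) hh hnh
    (A := fun k i => image m τ φ (d k i.1) (d k i.2)) (a := a)
    (fun k i => ha2 (d k i.1, d k i.2) ⟨(hd k).mem_unit _, (hd k).mem_unit _⟩) hF.cont
    (fun p hp => hF.zero p hp.le) 
    (c := fun k t => if t ∈ {t | |(rotate (ψ k) t).2| < √2} then image m τ φ x (y k) else 0)
    (fun k => Measurable.ite (measurableSet_lt
      (by unfold rotate; fun_prop : Measurable fun t => |(rotate (ψ k) t).2|) measurable_const)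
      measurable_const measurable_const)
    (fun k t => by
      split_ifs
      · exact ha2 (x, y k) ⟨hx, hy k⟩
      · simpa using ha0) ?_
  · have hz : ∀ k, ∫ t, (if t ∈ {t | |(rotate (ψ k) t).2| < √2} then image m τ φ x (y k) else 0) *
        F t = 0 := by
      intro k
      have e : (fun t => (if t ∈ {t | |(rotate (ψ k) t).2| < √2} then image m τ φ x (y k) else 0) *
          F t) = fun t => image m τ φ x (y k) * F t := by
        funext t
        by_cases ht : t ∈ {t | |(rotate (ψ k) t).2| < √2}
        · rw [if_pos ht]
        · rw [hF.rotate_eq_zero (not_lt.1 ht), mul_zero, mul_zero]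
      rw [e, integral_const_mul, hFint, mul_zero]
    simp only [hz, sub_zero] at key
    exact key
  refine Eventually.of_forall fun t hFt ρ hρ => ?_
  have hs1 : Tendsto (fun k => x - h k * (rotate (ψ k) t).1) l (𝓝 x) := by
    have : Tendsto (fun k => (rotate (ψ k) t).1) l (𝓝 (rotate ψ₀ t).1) :=
      ((by unfold rotate; fun_prop : Continuous fun ψ => (rotate ψ t).1).tendsto ψ₀).comp hψ
    simpa using (tendsto_const_nhds (x := x)).sub (hh0.mul this)
  have hN : ∀ᶠ k in l, 0 < N k := by
    filter_upwards [hnh.eventually_gt_atTop 0] with k hk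
    refine Nat.pos_of_ne_zero fun h0 => ?_
    rw [h0] at hk; simp at hk
  set L : Filter (ι × (ℝ × ℝ)) := Filter.comap Prod.fst l ⊓ 𝓟 {q : ι × (ℝ × ℝ) |
      ‖(x, y q.1) - h q.1 • rotate (ψ q.1) t - q.2‖ ≤ (N q.1 : ℝ)⁻¹} ⊓
      𝓟 {q | q.2 ∈ unitSquare} with hL
  have hfst : Tendsto Prod.fst L l :=
    tendsto_comap.mono_left (inf_le_left.trans inf_le_left)
  obtain ⟨hr1, hr2⟩ := tendsto_rescaled hh hnh hψ x t (y := y) rfl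
  have hlim := M.tendsto_image_far (L := L) (h := fun q => h q.1) (y := fun q => y q.1)
    (p := fun q => q.2) (hfst.eventually hh) (hh0.comp hfst)
    (mem_inf_of_right (mem_principal_self _)) (Eventually.of_forall fun q => hy q.1)
    (hr1.mono_left inf_le_left) (hr2.mono_left inf_le_left) (hw.comp hfst)
  have hev := Metric.tendsto_nhds.1 hlim ρ hρ
  rw [hL, inf_assoc, inf_principal] at hev
  have hev' := (eventually_forall_near (S := fun k p =>
      ‖(x, y k) - h k • rotate (ψ k) t - p‖ ≤ (N k : ℝ)⁻¹ ∧ p ∈ unitSquare)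
      (Q := fun k p => dist (image m τ φ p.1 p.2 - image m τ φ x (y k)) 0 < ρ)).1 hev
  have hin : ∀ k, |(rotate (ψ k) t).2| < √2 := fun k => by
    by_contra hcon
    exact hFt (hF.rotate_eq_zero (not_lt.1 hcon))
  filter_upwards [hev', hs1.eventually (Ioo_mem_nhds M.point_mem.1 M.point_mem.2),
    hyh, hN, hh] with k hk1 hk2 hk3 hk4 hk5
  simp only [if_pos (hin k)]
  refine ⟨fun i hi => ?_, fun hno => ?_⟩
  · have := (hk1 (d k i.1, d k i.2) ⟨(hd k).norm_sub_le hi,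
      ⟨(hd k).mem_unit _, (hd k).mem_unit _⟩⟩).le
    rwa [dist_zero_right] at this
  -- Where `F t ≠ 0` the margin `√2 h` keeps the point vertically inside the unit square, so some
  -- cell contains it and this case is void.
  · have hab := abs_lt.1 (hin k)
    have hmul1 := mul_lt_mul_of_pos_left hab.1 hk5
    have hmul2 := mul_lt_mul_of_pos_left hab.2 hk5
    obtain ⟨i, hi⟩ := exists_mem_cell hk4 (s := (x, y k) - h k • rotate (ψ k) t)
      ⟨Ioo_subset_Ico_self hk2, by
        simp only [Prod.snd_sub, Prod.smul_snd, smul_eq_mul]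
        constructor <;> nlinarith [hk3.1, hk3.2]⟩
    exact absurd hi (hno i)

end EdgeModel

/-! ### One-dimensional kernels -/

/-- A continuous function on the line that vanishes outside `(-1, 1)`. -/
structure IsBump (P : ℝ → ℝ) : Prop where
  cont : Continuous P
  zero : ∀ t, 1 ≤ |t| → P t = 0

theorem IsBump.hasCompactSupport {P : ℝ → ℝ} (hP : IsBump P) : HasCompactSupport P := by
  refine HasCompactSupport.of_support_subset_isCompact (isCompact_closedBall (0 : ℝ) 1) ?_
  intro t ht
  rw [mem_closedBall_zero_iff, Real.norm_eq_abs]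
  by_contra hcon
  exact ht (hP.zero t (not_le.1 hcon).le)

theorem IsBump.integrable {P : ℝ → ℝ} (hP : IsBump P) : Integrable P :=
  hP.cont.integrable_of_hasCompactSupport hP.hasCompactSupport

theorem IsBump.mul_left {P f : ℝ → ℝ} (hP : IsBump P) (hf : Continuous f) :
    IsBump fun t => f t * P t :=
  ⟨hf.mul hP.cont, fun t ht => by rw [hP.zero t ht, mul_zero]⟩

theorem IsBump.integral_Ioi {P : ℝ → ℝ} (hP : IsBump P) {a : ℝ} (ha : a ≤ 1) :
    ∫ t in Ioi a, P t = ∫ t in a..1, P t := by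
  rw [intervalIntegral.integral_of_le ha]
  refine setIntegral_eq_of_subset_of_forall_sdiff_eq_zero measurableSet_Ioi
    Ioc_subset_Ioi_self ?_ 
  rintro t ⟨h1, h2⟩
  refine hP.zero t (le_abs.2 (Or.inl ?_))
  by_contra hcon
  exact h2 ⟨h1, (not_le.1 hcon).le⟩

theorem IsBump.integral_eq {P : ℝ → ℝ} (hP : IsBump P) :
    ∫ t, P t = ∫ t in (-1)..1, P t := by
  rw [← hP.integral_Ioi (by norm_num), ← setIntegral_univ]
  refine setIntegral_eq_of_subset_of_forall_sdiff_eq_zero MeasurableSet.univ (subset_univ _) ?_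
  rintro t ⟨_, h2⟩
  have h2' : t ≤ -1 := not_lt.1 h2
  exact hP.zero t (le_abs.2 (Or.inr (by linarith)))

theorem IsBump.isWindow {P Q : ℝ → ℝ} (hP : IsBump P) (hQ : IsBump Q) :
    IsWindow fun p : ℝ × ℝ => P p.1 * Q p.2 := by
  refine ⟨(hP.cont.comp continuous_fst).mul (hQ.cont.comp continuous_snd), fun p hp => ?_⟩
  rw [Prod.norm_def, le_max_iff] at hp
  rcases hp with hp | hp
  · rw [hP.zero _ hp, zero_mul]
  · rw [hQ.zero _ hp, mul_zero]

section Smooth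

variable {K : ℝ → ℝ}

theorem IsSmoothKernel.eq_zero_of_not_mem (hK : IsSmoothKernel K) {t : ℝ} (ht : 1 < |t|) :
    K =ᶠ[𝓝 t] 0 := by
  have hopen : IsOpen {t : ℝ | 1 < |t|} := isOpen_lt continuous_const continuous_abs
  filter_upwards [hopen.mem_nhds ht] with s hs
  by_contra hne
  exact absurd (abs_le.2 (hK.support_subset hne)) (not_le.2 hs)

theorem IsSmoothKernel.contDiff_deriv (hK : IsSmoothKernel K) : ContDiff ℝ 1 (deriv K) := by
  have h := hK.contDiff_two
  have h2 : (2 : WithTop ℕ∞) = 1 + 1 := by norm_num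
  rw [h2, contDiff_succ_iff_deriv] at h
  exact h.2.2

theorem IsSmoothKernel.hasDerivAt (hK : IsSmoothKernel K) (t : ℝ) :
    HasDerivAt K (deriv K t) t :=
  (hK.contDiff_two.differentiable (by norm_num) t).hasDerivAt

theorem IsSmoothKernel.hasDerivAt_deriv (hK : IsSmoothKernel K) (t : ℝ) :
    HasDerivAt (deriv K) (deriv (deriv K) t) t :=
  (hK.contDiff_deriv.differentiable (by norm_num) t).hasDerivAt

theorem IsSmoothKernel.isBump (hK : IsSmoothKernel K) : IsBump K := by
  refine ⟨hK.contDiff_two.continuous, fun t ht => ?_⟩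
  rcases ht.eq_or_lt with h | h
  · rcases eq_or_eq_neg_of_abs_eq h.symm with rfl | rfl
    · simpa using hK.deriv_right 0 (by norm_num)
    · simpa using hK.deriv_left 0 (by norm_num)
  · exact (hK.eq_zero_of_not_mem h).self_of_nhds

theorem IsSmoothKernel.isBump_deriv (hK : IsSmoothKernel K) : IsBump (deriv K) := by
  refine ⟨hK.contDiff_deriv.continuous, fun t ht => ?_⟩
  rcases ht.eq_or_lt with h | h
  · rcases eq_or_eq_neg_of_abs_eq h.symm with rfl | rfl
    · simpa using hK.deriv_right 1 (by norm_num)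
    · simpa using hK.deriv_left 1 (by norm_num)
  · have := (hK.eq_zero_of_not_mem h).deriv.self_of_nhds
    simpa using this

theorem IsSmoothKernel.isBump_deriv_deriv (hK : IsSmoothKernel K) : IsBump (deriv (deriv K)) := by
  refine ⟨hK.contDiff_deriv.continuous_deriv le_rfl, fun t ht => ?_⟩
  rcases ht.eq_or_lt with h | h
  · rcases eq_or_eq_neg_of_abs_eq h.symm with rfl | rfl
    · simpa [iteratedDeriv_succ] using hK.deriv_right 2 (by norm_num)
    · simpa [iteratedDeriv_succ] using hK.deriv_left 2 (by norm_num)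
  · have := (hK.eq_zero_of_not_mem h).deriv.deriv.self_of_nhds
    simpa using this

theorem IsSmoothKernel.intervalIntegral_deriv (hK : IsSmoothKernel K) (a b : ℝ) :
    ∫ t in a..b, deriv K t = K b - K a :=
  intervalIntegral.integral_eq_sub_of_hasDerivAt (fun t _ => hK.hasDerivAt t)
    (hK.isBump_deriv.cont.intervalIntegrable _ _)

theorem IsSmoothKernel.intervalIntegral_deriv_deriv (hK : IsSmoothKernel K) (a b : ℝ) :
    ∫ t in a..b, deriv (deriv K) t = deriv K b - deriv K a :=
  intervalIntegral.integral_eq_sub_of_hasDerivAt (fun t _ => hK.hasDerivAt_deriv t)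
    (hK.isBump_deriv_deriv.cont.intervalIntegrable _ _)

theorem IsSmoothKernel.intervalIntegral_mul_deriv (hK : IsSmoothKernel K) (a b : ℝ) :
    ∫ t in a..b, t * deriv K t = b * K b - a * K a - ∫ t in a..b, K t := by
  have h := intervalIntegral.integral_mul_deriv_eq_deriv_mul (u := fun t => t) (v := K)
    (u' := fun _ => 1) (v' := deriv K) (a := a) (b := b) (fun t _ => hasDerivAt_id t)
    (fun t _ => hK.hasDerivAt t) (continuous_const.intervalIntegrable _ _)
    (hK.isBump_deriv.cont.intervalIntegrable _ _)
  simpa using h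

theorem IsSmoothKernel.integral_deriv (hK : IsSmoothKernel K) : ∫ t, deriv K t = 0 := by
  rw [hK.isBump_deriv.integral_eq, hK.intervalIntegral_deriv, hK.isBump.zero 1 (by norm_num),
    hK.isBump.zero (-1) (by norm_num), sub_zero]

theorem IsSmoothKernel.integral_deriv_deriv (hK : IsSmoothKernel K) :
    ∫ t, deriv (deriv K) t = 0 := by
  rw [hK.isBump_deriv_deriv.integral_eq, hK.intervalIntegral_deriv_deriv,
    hK.isBump_deriv.zero 1 (by norm_num), hK.isBump_deriv.zero (-1) (by norm_num), sub_zero]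

theorem IsSmoothKernel.integral_mul_deriv (hK : IsSmoothKernel K) :
    ∫ t, t * deriv K t = -∫ t, K t := by
  rw [(hK.isBump_deriv.mul_left (f := fun t => t) continuous_id).integral_eq, hK.intervalIntegral_mul_deriv,
    hK.isBump.zero 1 (by norm_num), hK.isBump.zero (-1) (by norm_num), hK.isBump.integral_eq]
  ring

theorem IsSmoothKernel.integral_Ioi_deriv (hK : IsSmoothKernel K) :
    ∫ t in Ioi 0, deriv K t = -K 0 := by
  rw [hK.isBump_deriv.integral_Ioi zero_le_one, hK.intervalIntegral_deriv,
    hK.isBump.zero 1 (by norm_num), zero_sub]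

theorem IsSmoothKernel.integral_Ioi_deriv_deriv (hK : IsSmoothKernel K) :
    ∫ t in Ioi 0, deriv (deriv K) t = -deriv K 0 := by
  rw [hK.isBump_deriv_deriv.integral_Ioi zero_le_one, hK.intervalIntegral_deriv_deriv,
    hK.isBump_deriv.zero 1 (by norm_num), zero_sub]

theorem IsSmoothKernel.integral_Ioi_mul_deriv (hK : IsSmoothKernel K) :
    ∫ t in Ioi 0, t * deriv K t = -∫ t in Ioi 0, K t := by
  rw [(hK.isBump_deriv.mul_left (f := fun t => t) continuous_id).integral_Ioi zero_le_one,
    hK.intervalIntegral_mul_deriv, hK.isBump.zero 1 (by norm_num),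
    hK.isBump.integral_Ioi zero_le_one]
  ring

end Smooth

theorem integral_eq_zero_of_odd {P : ℝ → ℝ} (hP : ∀ t, P (-t) = -P t) : ∫ t, P t = 0 := by
  have h := integral_neg_eq_self P volume
  simp only [hP, integral_neg] at h
  linarith

theorem IsEvenKernel.integral {K₁ : ℝ → ℝ} (hK₁ : IsEvenKernel K₁) : ∫ t, K₁ t = 1 := by
  rw [hK₁.toIsSmoothKernel.isBump.integral_eq, hK₁.integral_eq]

theorem IsEvenKernel.nonneg {K₁ : ℝ → ℝ} (hK₁ : IsEvenKernel K₁) (t : ℝ) : 0 ≤ K₁ t := by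
  by_cases ht : 1 ≤ |t|
  · rw [hK₁.toIsSmoothKernel.isBump.zero t ht]
  · exact (hK₁.pos t (abs_lt.1 (not_le.1 ht))).le

theorem IsEvenKernel.integral_mul {K₁ : ℝ → ℝ} (hK₁ : IsEvenKernel K₁) :
    ∫ t, t * K₁ t = 0 :=
  integral_eq_zero_of_odd fun t => by rw [hK₁.even]; ring

theorem IsEvenKernel.integral_sq_mul_pos {K₁ : ℝ → ℝ} (hK₁ : IsEvenKernel K₁) :
    0 < ∫ t, t ^ 2 * K₁ t := by
  have hb : IsBump fun t => t ^ 2 * K₁ t :=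
    hK₁.toIsSmoothKernel.isBump.mul_left (continuous_pow 2)
  refine hb.cont.integral_pos_of_hasCompactSupport_nonneg_nonzero hb.hasCompactSupport
    (fun t => mul_nonneg (sq_nonneg t) (hK₁.nonneg t)) (x := 1 / 2) ?_
  have := hK₁.pos (1 / 2) (by constructor <;> norm_num)
  positivity

section Odd

variable {K₂ : ℝ → ℝ}

theorem IsOddKernel.integral (hK₂ : IsOddKernel K₂) : ∫ t, K₂ t = 0 :=
  integral_eq_zero_of_odd hK₂.odd

theorem IsOddKernel.apply_zero (hK₂ : IsOddKernel K₂) : K₂ 0 = 0 := by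
  have := hK₂.odd 0
  rw [neg_zero] at this; linarith

theorem IsOddKernel.integral_Ioi (hK₂ : IsOddKernel K₂) : ∫ t in Ioi 0, K₂ t = 1 := by
  rw [hK₂.toIsSmoothKernel.isBump.integral_Ioi zero_le_one, hK₂.integral_eq]

theorem IsOddKernel.intervalIntegral_symm (hK₂ : IsOddKernel K₂) (a : ℝ) :
    ∫ t in (-a)..a, K₂ t = 0 := by
  have h := intervalIntegral.integral_comp_neg (f := K₂) (a := -a) (b := a)
  simp only [hK₂.odd, intervalIntegral.integral_neg, neg_neg] at h
  linarith

/-- The tails of the odd kernel. -/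
theorem IsOddKernel.tail (hK₂ : IsOddKernel K₂)
    (hid : ∀ y ∈ Ioo (0 : ℝ) 1, 0 < (∫ t in (0 : ℝ)..y, K₂ t) ∧ (∫ t in (0 : ℝ)..y, K₂ t) < 2)
    (a : ℝ) : -1 < ∫ t in Ioi a, K₂ t ∧ (a ≠ 0 → ∫ t in Ioi a, K₂ t < 1) := by
  have hb := hK₂.toIsSmoothKernel.isBump
  have hi : ∀ u v : ℝ, IntervalIntegrable K₂ volume u v :=
    fun u v => hb.cont.intervalIntegrable u v
  have hfar : ∀ a : ℝ, 1 ≤ |a| → ∫ t in Ioi a, K₂ t = 0 := by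
    intro a ha
    rcases le_abs.1 ha with h | h
    · refine setIntegral_eq_zero_of_forall_eq_zero fun t ht => hb.zero t (le_abs.2 (Or.inl ?_))
      exact h.trans (le_of_lt ht)
    · rw [hb.integral_Ioi (by linarith), ← hK₂.integral, hb.integral_eq,
        ← intervalIntegral.integral_add_adjacent_intervals (hi a (-1)) (hi (-1) 1)]
      have : ∫ t in a..(-1), K₂ t = 0 := by
        have h0 : ∀ t ∈ uIcc a (-1), K₂ t = 0 := by
          intro t ht
          rw [uIcc_of_le (by linarith)] at ht
          exact hb.zero t (le_abs.2 (Or.inr (by linarith [ht.2])))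
        rw [intervalIntegral.integral_congr (g := fun _ => 0) (fun t ht => h0 t ht)]
        simp
      rw [this, zero_add]
  have hpos : ∀ a ∈ Ioo (0 : ℝ) 1, -1 < (∫ t in a..1, K₂ t) ∧ (∫ t in a..1, K₂ t) < 1 := by
    intro a ha
    -- The tail from `a` is `1` minus the integral from `0` to `a`, which lies strictly between `0`
    -- and `2`.
    have h1 := intervalIntegral.integral_add_adjacent_intervals (hi 0 a) (hi a 1)
    rw [hK₂.integral_eq] at h1
    have h2 := hid a ha
    constructor <;> linarith [h2.1, h2.2]
  by_cases ha : 1 ≤ |a|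
  · rw [hfar a ha]; norm_num
  · rw [not_le, abs_lt] at ha
    rw [hb.integral_Ioi ha.2.le]
    rcases lt_trichotomy a 0 with h | rfl | h
    -- By oddness the part over `(a, -a)` cancels, so the tail from a negative `a` equals the tail
    -- from `-a`.
    · have h1 := intervalIntegral.integral_add_adjacent_intervals (hi a (-a)) (hi (-a) 1)
      have h2 := hK₂.intervalIntegral_symm (-a)
      rw [neg_neg] at h2
      rw [h2, zero_add] at h1
      rw [← h1]
      have h3 := hpos (-a) ⟨by linarith, by linarith [ha.1]⟩
      exact ⟨h3.1, fun _ => h3.2⟩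
    · rw [hK₂.integral_eq]; norm_num
    · exact ⟨(hpos a ⟨h, ha.2⟩).1, fun _ => (hpos a ⟨h, ha.2⟩).2⟩

end Odd

/-! ### Limits at and off the tangent -/

/-- When the window is aligned with the tangent, the coefficient of `t.1` vanishes and that of `t.2`
is positive. -/
theorem edgeForm_slope (φ : ℝ → ℝ) (x : ℝ) (t : ℝ × ℝ) :
    0 < edgeForm (deriv φ x) (slope φ x) t ↔ 0 < t.2 := by
  have hc : 0 < Real.cos (slope φ x) := Real.cos_arctan_pos _
  have hs : Real.sin (slope φ x) = deriv φ x * Real.cos (slope φ x) := by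
    have := Real.tan_mul_cos hc.ne'
    rw [← this, slope, Real.tan_arctan]
  have h1 : Real.cos (slope φ x) + deriv φ x * Real.sin (slope φ x) > 0 := by
    rw [hs]; nlinarith [mul_nonneg (sq_nonneg (deriv φ x)) hc.le]
  unfold edgeForm
  rw [show Real.sin (slope φ x) - deriv φ x * Real.cos (slope φ x) = 0 from sub_eq_zero.2 hs,
    zero_mul, zero_add]
  exact mul_pos_iff_of_pos_left h1

/-- At the tangent angle the weight depends on `t.2` alone, so the integral factors. Every limit of
a score derivative or variance term is read off from this formula. -/
theorem integral_edgeWeight_slope (m : ℝ → ℝ → ℝ) (τ φ : ℝ → ℝ) (x : ℝ) {P Q : ℝ → ℝ}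
    (hQ : IsBump Q) :
    ∫ t, edgeWeight m τ φ x 0 (slope φ x) t * (P t.1 * Q t.2) =
      (∫ t, P t) * (m x (φ x) * (∫ t, Q t) + τ x * ∫ t in Ioi 0, Q t) := by
  have e : (fun t : ℝ × ℝ => edgeWeight m τ φ x 0 (slope φ x) t * (P t.1 * Q t.2)) =
      fun t => P t.1 * (m x (φ x) * Q t.2 + τ x * (Ioi 0).indicator Q t.2) := by
    funext t
    unfold edgeWeight
    simp only [edgeForm_slope]
    by_cases ht : 0 < t.2
    · rw [if_pos ht, indicator_of_mem (show t.2 ∈ Ioi 0 from ht)]; ring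
    · rw [if_neg ht, indicator_of_notMem (show t.2 ∉ Ioi 0 from ht)]; ring
  rw [e, Measure.volume_eq_prod,
    integral_prod_mul P (fun s => m x (φ x) * Q s + τ x * (Ioi 0).indicator Q s), integral_add
      (hQ.integrable.const_mul _) ((hQ.integrable.indicator measurableSet_Ioi).const_mul _),
    integral_const_mul, integral_const_mul, integral_indicator measurableSet_Ioi]

/-- Identification of the edge. The constant part drops out because `K₂` has mean zero. By Fubini
the rest is `τ x` times the average, under the probability density `K₁`, of slice integrals `J u ≤
1`. Equality `J u = 1` forces the boundary line through `(u, 0)` with `β > 0`; unless the line is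
the first axis, which is the excluded case, this happens for at most one `u`. -/
theorem integral_edgeWeight_lt {K₁ K₂ : ℝ → ℝ} (hK₁ : IsEvenKernel K₁) (hK₂ : IsOddKernel K₂)
    (hid : ∀ y ∈ Ioo (0 : ℝ) 1, 0 < (∫ t in (0 : ℝ)..y, K₂ t) ∧ (∫ t in (0 : ℝ)..y, K₂ t) < 2)
    (m : ℝ → ℝ → ℝ) (τ φ : ℝ → ℝ) (x : ℝ) (hτ : 0 < τ x) {w ψ : ℝ} (hψ : ψ ∈ angles)
    (hne : ¬ (w = 0 ∧ ψ = slope φ x)) :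
    ∫ t, edgeWeight m τ φ x w ψ t * (K₁ t.1 * K₂ t.2) < τ x := by
  have hb₁ := hK₁.toIsSmoothKernel.isBump
  have hb₂ := hK₂.toIsSmoothKernel.isBump
  set s := deriv φ x with hs
  set α := Real.sin ψ - s * Real.cos ψ with hα
  set β := Real.cos ψ + s * Real.sin ψ with hβ
  set S : Set (ℝ × ℝ) := {t | w < edgeForm s ψ t} with hS
  have hSm : MeasurableSet S := measurableSet_lt measurable_const (by unfold edgeForm; fun_prop)
  have hprod : Integrable (fun t : ℝ × ℝ => K₁ t.1 * K₂ t.2) (volume.prod volume) :=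
    hb₁.integrable.mul_prod hb₂.integrable
  have hprodS : Integrable (S.indicator fun t : ℝ × ℝ => K₁ t.1 * K₂ t.2)
    (volume.prod volume) := hprod.indicator hSm
  set J : ℝ → ℝ := fun u => ∫ v, {v | w < α * u + β * v}.indicator K₂ v with hJ
  have hJbound : ∀ u, J u ≤ 1 ∧ (J u = 1 → 0 < β ∧ w = α * u) := by
    intro u
    rcases lt_trichotomy β 0 with hβ0 | hβ0 | hβ0
    -- For `β < 0` the slice is a left ray. Its integral is minus a tail, and the strict lower bound
    -- `-1` for tails excludes the value `1`.
    · have hset : {v | w < α * u + β * v} = (Ici ((w - α * u) / β))ᶜ := by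
        ext v
        have hiff : w < α * u + β * v ↔ v < (w - α * u) / β := by
          rw [lt_div_iff_of_neg hβ0]; constructor <;> intro h <;> linarith
        rw [mem_compl_iff, mem_Ici, not_le]
        exact hiff
      have : J u = -∫ v in Ioi ((w - α * u) / β), K₂ v := by
        simp only [hJ]
        rw [hset, integral_indicator measurableSet_Ici.compl, setIntegral_compl measurableSet_Ici
          hb₂.integrable, hK₂.integral, zero_sub, integral_Ici_eq_integral_Ioi]
      have h2 := (hK₂.tail hid ((w - α * u) / β)).1
      rw [this]
      exact ⟨by linarith, fun h => by linarith⟩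
    · have : J u = 0 := by
        simp only [hJ, hβ0, zero_mul, add_zero]
        by_cases h : w < α * u
        · simp [h, hK₂.integral]
        · simp [h]
      rw [this]; norm_num
    · have hset : {v | w < α * u + β * v} = Ioi ((w - α * u) / β) := by
        ext v
        rw [mem_Ioi, div_lt_iff₀ hβ0]
        constructor
        · intro h; have h' : w < α * u + β * v := h; linarith
        · intro h; show w < α * u + β * v; linarith
      have : J u = ∫ v in Ioi ((w - α * u) / β), K₂ v := by
        simp only [hJ]
        rw [hset, integral_indicator measurableSet_Ioi]
      have h2 := (hK₂.tail hid ((w - α * u) / β)).2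
      rw [this]
      by_cases h0 : (w - α * u) / β = 0
      · have h3 := h0
        rw [div_eq_zero_iff, or_iff_left hβ0.ne', sub_eq_zero] at h3
        rw [h0, hK₂.integral_Ioi]
        exact ⟨le_rfl, fun _ => ⟨hβ0, h3⟩⟩
      · have h4 := h2 h0
        exact ⟨h4.le, fun h => absurd h h4.ne⟩
  have hslice : ∀ u, ∫ v, S.indicator (fun t : ℝ × ℝ => K₁ t.1 * K₂ t.2) (u, v) = K₁ u * J u := by
    intro u
    simp only [hJ]
    rw [← integral_const_mul]
    congr 1; funext v
    by_cases h : w < α * u + β * v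
    · rw [indicator_of_mem (show (u, v) ∈ S from h),
        indicator_of_mem (show v ∈ {v | w < α * u + β * v} from h)]
    · rw [indicator_of_notMem (show (u, v) ∉ S from h),
        indicator_of_notMem (show v ∉ {v | w < α * u + β * v} from h), mul_zero]
  have hKJ : Integrable fun u => K₁ u * J u := by
    have := hprodS.integral_prod_left
    simp only [hslice] at this
    exact this
  have hsplit : ∫ t, edgeWeight m τ φ x w ψ t * (K₁ t.1 * K₂ t.2) = τ x * ∫ u, K₁ u * J u := by
    have e : (fun t : ℝ × ℝ => edgeWeight m τ φ x w ψ t * (K₁ t.1 * K₂ t.2)) =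
        fun t => m x (φ x) * (K₁ t.1 * K₂ t.2) +
          τ x * S.indicator (fun t : ℝ × ℝ => K₁ t.1 * K₂ t.2) t := by
      funext t
      unfold edgeWeight
      by_cases ht : w < edgeForm s ψ t
      · rw [if_pos ht, indicator_of_mem (show t ∈ S from ht)]; ring
      · rw [if_neg ht, indicator_of_notMem (show t ∉ S from ht)]; ring
    rw [e, Measure.volume_eq_prod, integral_add (hprod.const_mul _) (hprodS.const_mul _),
      integral_const_mul, integral_const_mul, integral_prod_mul, hK₂.integral, mul_zero, mul_zero,
      zero_add, integral_prod _ hprodS]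
    simp only [hslice]
  rw [hsplit]
  -- If `α ≠ 0`, the equation `w = α u` determines `u`. If `α = 0` and the value `1` occurs, then `w
  -- = 0` and `tan ψ = s`, which is the excluded pair.
  have hexc : ∀ᵐ u : ℝ, J u ≠ 1 := by
    have hsub : {u | ¬ J u ≠ 1}.Subsingleton := by
      intro u hu v hv
      have h1 := (hJbound u).2 (not_not.1 hu)
      have h2 := (hJbound v).2 (not_not.1 hv)
      have hα0 : α ≠ 0 := by
        intro h0
        rw [h0, zero_mul] at h1
        apply hne
        refine ⟨h1.2, ?_⟩
        have hcos : 0 ≤ Real.cos ψ := Real.cos_nonneg_of_mem_Icc hψ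
        have hsin : Real.sin ψ = s * Real.cos ψ := by linarith
        have hcos0 : Real.cos ψ ≠ 0 := by
          intro hc
          have := Real.sin_sq_add_cos_sq ψ
          rw [hsin, hc] at this
          norm_num at this
        have hmem : ψ ∈ Ioo (-(Real.pi / 2)) (Real.pi / 2) := by
          refine ⟨lt_of_le_of_ne hψ.1 ?_, lt_of_le_of_ne hψ.2 ?_⟩
          · rintro rfl; simp at hcos0
          · rintro rfl; simp at hcos0
        have htan : Real.tan ψ = s := by
          rw [Real.tan_eq_sin_div_cos, hsin, mul_div_assoc, div_self hcos0, mul_one]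
        rw [slope, ← hs, ← htan, Real.arctan_tan hmem.1 hmem.2]
      exact mul_left_cancel₀ hα0 (h1.2.symm.trans h2.2)
    rw [ae_iff]
    exact hsub.measure_zero volume
  have hle : ∫ u, K₁ u * J u ≤ 1 := by
    rw [← hK₁.integral]
    exact integral_mono hKJ hb₁.integrable fun u =>
      mul_le_of_le_one_right (hK₁.nonneg u) (hJbound u).1
  have hlt : ∫ u, K₁ u * J u < 1 := by
    refine lt_of_le_of_ne hle fun heq => ?_
    have hz : ∫ u, (K₁ u - K₁ u * J u) = 0 := by
      rw [integral_sub hb₁.integrable hKJ, heq, hK₁.integral, sub_self]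
    rw [integral_eq_zero_iff_of_nonneg (fun u => sub_nonneg.2
      (mul_le_of_le_one_right (hK₁.nonneg u) (hJbound u).1)) (hb₁.integrable.sub hKJ)] at hz
    have hnull : ∀ᵐ u : ℝ, u ∉ Ioo (-1 : ℝ) 1 := by
      filter_upwards [hz, hexc] with u h1 h2 h3
      have h4 := hK₁.pos u h3
      have h5 : K₁ u * (1 - J u) = 0 := by
        have h1' : K₁ u - K₁ u * J u = 0 := h1
        linarith
      rcases mul_eq_zero.1 h5 with h | h
      · exact h4.ne' h
      · exact h2 (by linarith)
    rw [ae_iff] at hnull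
    simp only [not_not] at hnull
    have hvol : volume (Ioo (-1 : ℝ) 1) = 0 := hnull
    rw [Real.volume_Ioo] at hvol
    norm_num at hvol
  nlinarith

/-! ### Bandwidths -/

/-- The consequences of the bandwidth condition that are used. -/
structure BandwidthLimits (h : ℕ → ℝ) : Prop where
  pos : ∀ᶠ n in atTop, 0 < h n
  tendsto_zero : Tendsto h atTop (𝓝 0)
  tendsto_mul : Tendsto (fun n : ℕ => n * h n) atTop atTop
  tendsto_cube : Tendsto (fun n : ℕ => (n : ℝ) ^ 2 * h n ^ 3) atTop atTop

/-- The logarithmic factor is eventually at least `1`, so `h ≥ C₁ / √n`, and `n h` and `n² h³` are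
bounded below by multiples of `√n`. The divergence of `n² h³` is what the union bound over blocks of
height `h` requires. -/
theorem IsBandwidth.limits {h : ℕ → ℝ} (hh : IsBandwidth h) : BandwidthLimits h := by
  obtain ⟨C₁, C₂, η, hC₁, hC₂, hη, hev⟩ := hh
  have hcast : Tendsto (fun n : ℕ => (n : ℝ)) atTop atTop := tendsto_natCast_atTop_atTop
  have hroot : Tendsto (fun n : ℕ => C₁ * √(n : ℝ)) atTop atTop :=
    (Real.tendsto_sqrt_atTop.comp hcast).const_mul_atTop hC₁
  have hroot3 : Tendsto (fun n : ℕ => C₁ ^ 3 * √(n : ℝ)) atTop atTop :=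
    (Real.tendsto_sqrt_atTop.comp hcast).const_mul_atTop (by positivity)
  have hlow : ∀ᶠ n : ℕ in atTop, 0 < (n : ℝ) ∧ C₁ / √(n : ℝ) ≤ h n := by
    filter_upwards [hev, eventually_gt_atTop 0,
      (Real.tendsto_log_atTop.comp hcast).eventually_ge_atTop 1] with n hn hn0 hlog
    have hn0' : (0 : ℝ) < n := by exact_mod_cast hn0
    refine ⟨hn0', le_trans ?_ hn.1⟩
    rw [← Real.sqrt_eq_rpow]
    have : 1 ≤ Real.log n ^ η := Real.one_le_rpow hlog (by linarith)
    gcongr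
    nlinarith
  refine ⟨?_, ?_, ?_, ?_⟩
  · filter_upwards [hlow] with n hn
    have := hn.1
    exact lt_of_lt_of_le (by positivity) hn.2
  · have hup : Tendsto (fun n : ℕ => C₂ / (n : ℝ) ^ (1 / 3 : ℝ)) atTop (𝓝 0) :=
      ((tendsto_rpow_atTop (by norm_num)).comp hcast).const_div_atTop C₂
    refine tendsto_of_tendsto_of_tendsto_of_le_of_le' tendsto_const_nhds hup ?_ ?_
    · filter_upwards [hlow] with n hn
      have := hn.1
      exact le_trans (by positivity) hn.2
    · filter_upwards [hev] with n hn using hn.2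
  · refine tendsto_atTop_mono' _ ?_ hroot
    filter_upwards [hlow] with n hn
    have h0 := hn.1
    calc C₁ * √(n : ℝ) = n * (C₁ / √(n : ℝ)) := by
          field_simp; rw [Real.sq_sqrt h0.le]
      _ ≤ n * h n := by gcongr; exact hn.2
  · refine tendsto_atTop_mono' _ ?_ hroot3
    filter_upwards [hlow] with n hn
    have h0 := hn.1
    calc C₁ ^ 3 * √(n : ℝ) = (n : ℝ) ^ 2 * (C₁ / √(n : ℝ)) ^ 3 := by
          have hs := Real.sq_sqrt h0.le
          have hs0 := Real.sqrt_pos.2 h0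
          rw [div_pow, eq_comm, mul_div_assoc', div_eq_iff (by positivity)]
          calc (n : ℝ) ^ 2 * C₁ ^ 3 = (√(n : ℝ) ^ 2) ^ 2 * C₁ ^ 3 := by rw [hs]
            _ = C₁ ^ 3 * √(n : ℝ) * √(n : ℝ) ^ 3 := by ring
      _ ≤ (n : ℝ) ^ 2 * h n ^ 3 := by gcongr; exact hn.2

/-! ### Identification of the edge by the mean contrast -/

theorem isCompact_angles : IsCompact angles := isCompact_Icc

/-- Otherwise, with `δ = 1 / (k + 1)`, there are near-maximizers outside the neighbourhood along
some sequence. The angles converge along a subsequence. Either the rescaled heights escape to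
infinity and the contrast tends to `0 < τ x`, or they converge along a further subsequence to some
`w`, and the limit is below `τ x` unless `(w, ψ₀)` is the true pair, which contradicts being
outside. -/
theorem exists_argmax_neighbourhood {m : ℝ → ℝ → ℝ} {τ φ : ℝ → ℝ} {x : ℝ}
    (M : EdgeModel m τ φ x) (hτ : 0 < τ x) {K₁ K₂ : ℝ → ℝ} (hK₁ : IsEvenKernel K₁)
    (hK₂ : IsOddKernel K₂)
    (hid : ∀ y ∈ Ioo (0 : ℝ) 1, 0 < (∫ t in (0 : ℝ)..y, K₂ t) ∧ (∫ t in (0 : ℝ)..y, K₂ t) < 2)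
    {d : ∀ n : ℕ, Fin n → ℝ} (hd : ∀ n, InCells (d n)) {h : ℕ → ℝ} (hh : BandwidthLimits h)
    {ρ : ℝ} (hρ : 0 < ρ) :
    ∃ δ > 0, ∀ᶠ n in atTop, ∀ y ∈ heights (h n), ∀ ψ ∈ angles,
      τ x - δ ≤ kernelSum (d n) (fun i => image m τ φ (d n i.1) (d n i.2))
        (fun p => K₁ p.1 * K₂ p.2) x y ψ (h n) →
      |(y - φ x) / h n| < ρ ∧ |ψ - slope φ x| < ρ := by
  by_contra hcon
  push Not at hcon
  have hF : IsWindow fun p : ℝ × ℝ => K₁ p.1 * K₂ p.2 :=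
    hK₁.toIsSmoothKernel.isBump.isWindow hK₂.toIsSmoothKernel.isBump
  have hF0 : ∫ p : ℝ × ℝ, K₁ p.1 * K₂ p.2 = 0 := by
    rw [Measure.volume_eq_prod, integral_prod_mul, hK₂.integral, mul_zero]
  have hsel : ∀ k : ℕ, ∃ n, k ≤ n ∧ 0 < h n ∧ ∃ y ∈ heights (h n), ∃ ψ ∈ angles,
      τ x - 1 / ((k : ℝ) + 1) ≤ kernelSum (d n) (fun i => image m τ φ (d n i.1) (d n i.2))
        (fun p => K₁ p.1 * K₂ p.2) x y ψ (h n) ∧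
      (|(y - φ x) / h n| < ρ → ρ ≤ |ψ - slope φ x|) := by
    intro k
    obtain ⟨n, hn, hn1, hn2⟩ := frequently_atTop.1
      ((hcon (1 / ((k : ℝ) + 1)) (by positivity)).and_eventually hh.pos) k
    exact ⟨n, hn, hn2, hn1⟩
  choose N hNk hpos y hy ψ hψ hge hout using hsel
  have hN : Tendsto N atTop atTop := tendsto_atTop_mono hNk tendsto_id
  obtain ⟨ψ₀, hψ₀, κ, hκ, hψlim⟩ := isCompact_angles.tendsto_subseq hψ
  have hNκ : Tendsto (N ∘ κ) atTop atTop := hN.comp hκ.tendsto_atTop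
  have hone : Tendsto (fun k : ℕ => τ x - 1 / ((k : ℝ) + 1)) atTop (𝓝 (τ x)) := by
    simpa using tendsto_one_div_add_atTop_nhds_zero_nat.const_sub (τ x)
  have hyI : ∀ k, y k ∈ Icc (0 : ℝ) 1 := fun k => by
    have h2 : 0 ≤ √2 * h (N k) := by have := hpos k; positivity
    exact ⟨h2.trans (hy k).1, (hy k).2.trans (by linarith)⟩
  by_cases hw : Tendsto (fun k => |(y (κ k) - φ x) / h (N (κ k))|) atTop atTop
  · have hlim := tendsto_kernelSum_far M (N := N ∘ κ) (d := fun k => d (N (κ k)))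
      (fun k => hd _) (h := fun k => h (N (κ k))) (y := fun k => y (κ k)) (ψ := fun k => ψ (κ k))
      (Eventually.of_forall fun k => hpos _) (hh.tendsto_zero.comp hNκ)
      (hh.tendsto_mul.comp hNκ) hF hF0 (fun k => hyI _) (Eventually.of_forall fun k => hy _)
      hw hψlim
    have := ge_of_tendsto' (hlim.sub (hone.comp hκ.tendsto_atTop))
      (fun k => sub_nonneg.2 (hge (κ k)))
    linarith
  · rw [tendsto_atTop] at hw
    push Not at hw
    obtain ⟨R, hR⟩ := hw
    obtain ⟨w, -, κ', hκ', hwlim⟩ := tendsto_subseq_of_frequently_bounded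
      (Metric.isBounded_closedBall (x := (0 : ℝ)) (r := R))
      (x := fun k => (y (κ k) - φ x) / h (N (κ k))) (hR.mono fun k hk => by
        rw [mem_closedBall_zero_iff, Real.norm_eq_abs]; exact hk.le)
    have hκκ : Tendsto (κ ∘ κ') atTop atTop := hκ.tendsto_atTop.comp hκ'.tendsto_atTop
    have hNκκ : Tendsto (N ∘ κ ∘ κ') atTop atTop := hN.comp hκκ
    have hψlim' := hψlim.comp hκ'.tendsto_atTop
    have hlim := tendsto_kernelSum_near M (N := N ∘ κ ∘ κ') (d := fun k => d (N (κ (κ' k))))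
      (fun k => hd _) (h := fun k => h (N (κ (κ' k)))) (y := fun k => y (κ (κ' k)))
      (ψ := fun k => ψ (κ (κ' k)))
      (Eventually.of_forall fun k => hpos _) (hh.tendsto_zero.comp hNκκ)
      (hh.tendsto_mul.comp hNκκ) hF hwlim hψlim'
    have hge' := ge_of_tendsto' (hlim.sub (hone.comp hκκ))
      (fun k => sub_nonneg.2 (hge (κ (κ' k))))
    have hid' : w = 0 ∧ ψ₀ = slope φ x := by
      by_contra hne
      have := integral_edgeWeight_lt hK₁ hK₂ hid m τ φ x hτ hψ₀ hne
      linarith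
    obtain ⟨rfl, rfl⟩ := hid'
    have e1 : ∀ᶠ k in atTop, |(y (κ (κ' k)) - φ x) / h (N (κ (κ' k)))| < ρ := by
      have := Metric.tendsto_nhds.1 hwlim ρ hρ
      filter_upwards [this] with k hk
      rwa [dist_zero_right, Real.norm_eq_abs] at hk
    have e2 : ∀ᶠ k in atTop, |ψ (κ (κ' k)) - slope φ x| < ρ :=
      Metric.tendsto_nhds.1 hψlim' ρ hρ
    obtain ⟨k, hk1, hk2⟩ := (e1.and e2).exists
    exact absurd hk2 (not_lt.2 (hout _ hk1))

/-! ### Central limit theorem for weighted sums -/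

/-- Second-order Taylor expansion at zero. Applied to `ν` and to the centred Gaussian of equal
variance, it shows that their characteristic functions differ by `o(u²)`. -/
theorem charFun_sub_isLittleO {ν : Measure ℝ} [IsProbabilityMeasure ν] (h2 : MemLp id 2 ν)
    (h0 : ∫ e, e ∂ν = 0) :
    (fun u : ℝ => charFun ν u - (1 - (Var[id; ν] : ℂ) * u ^ 2 / 2)) =o[𝓝 0]
      fun u : ℝ => u ^ 2 := by
  have h2' : MemLp id ((2 : ℕ) : ENNReal) ν := by exact_mod_cast h2
  have hvar : Var[id; ν] = ∫ e, e ^ 2 ∂ν := by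
    rw [variance_of_integral_eq_zero aemeasurable_id (by simpa using h0)]; simp
  have hT : ∀ u : ℝ, taylorWithinEval (charFun ν) 2 univ 0 u =
      1 - (Var[id; ν] : ℂ) * u ^ 2 / 2 := by
    intro u
    rw [taylorWithinEval_charFun_zero h2', hvar]
    simp only [Finset.sum_range_succ, Finset.range_zero, Finset.sum_empty, pow_zero, pow_one, h0,
      Nat.factorial, mul_pow, Complex.I_sq, integral_const, probReal_univ]
    push_cast
    ring_nf
    simp
  simp_rw [← hT]
  convert! taylor_isLittleO_univ (contDiff_charFun h2') using 2
  simp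

/-- Factors are exchanged one at a time; all the others have modulus at most one. -/
theorem norm_prod_sub_prod_le {ι : Type*} (s : Finset ι) {a b : ι → ℂ} (ha : ∀ i, ‖a i‖ ≤ 1)
    (hb : ∀ i, ‖b i‖ ≤ 1) : ‖∏ i ∈ s, a i - ∏ i ∈ s, b i‖ ≤ ∑ i ∈ s, ‖a i - b i‖ := by
  classical
  induction s using Finset.induction_on with
  | empty => simp
  | insert j s hj ih =>
    rw [Finset.prod_insert hj, Finset.prod_insert hj, Finset.sum_insert hj]
    have e : a j * ∏ i ∈ s, a i - b j * ∏ i ∈ s, b i =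
        (a j - b j) * ∏ i ∈ s, a i + b j * (∏ i ∈ s, a i - ∏ i ∈ s, b i) := by ring
    rw [e]
    refine (norm_add_le _ _).trans (add_le_add ?_ ?_)
    · rw [norm_mul, norm_prod]
      exact mul_le_of_le_one_right (norm_nonneg _)
        (Finset.prod_le_one (fun _ _ => norm_nonneg _) fun i _ => ha i)
    · rw [norm_mul]
      exact (mul_le_of_le_one_left (norm_nonneg _) (hb j)).trans ih

/-- The characteristic function of the sum is compared with that of the same weighted sum of
Gaussians, which is explicit. The difference is at most a sum of terms `o(c_i² t²)`, uniformly in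
`i` because the weights are uniformly small, while the sum of squares stays bounded. -/
theorem tendstoInDistribution_weighted_sum {Ω : Type*} [MeasurableSpace Ω] {P : Measure Ω}
    [IsProbabilityMeasure P] {ν : Measure ℝ} [IsProbabilityMeasure ν] (h2 : MemLp id 2 ν)
    (h0 : ∫ e, e ∂ν = 0) {ι : ℕ → Type*} [∀ n, Fintype (ι n)] {ε : ∀ n, ι n → Ω → ℝ}
    (hlaw : ∀ n i, HasLaw (ε n i) ν P) (hind : ∀ n, iIndepFun (ε n) P)
    {c : ∀ n, ι n → ℝ} {M : ℕ → ℝ} (hcM : ∀ n i, |c n i| ≤ M n) (hM : Tendsto M atTop (𝓝 0))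
    {s : ℝ} (hs : Tendsto (fun n => ∑ i, c n i ^ 2) atTop (𝓝 s)) :
    TendstoInDistribution (fun n ω => ∑ i, c n i * ε n i ω) atTop (id : ℝ → ℝ) (fun _ => P)
      (gaussianReal 0 (Real.toNNReal (Var[id; ν] * s))) where
  forall_aemeasurable n :=
    Finset.aemeasurable_fun_sum _ fun i _ => (hlaw n i).aemeasurable.const_mul _
  aemeasurable_limit := aemeasurable_id
  tendsto := by
    set v := Var[id; ν] with hv
    have hv0 : 0 ≤ v := variance_nonneg _ _
    have hs0 : 0 ≤ s := ge_of_tendsto' hs fun n => Finset.sum_nonneg fun i _ => sq_nonneg _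
    set γ := gaussianReal 0 v.toNNReal with hγ
    have hγ2 : MemLp id 2 γ := memLp_id_gaussianReal 2
    have hγ0 : ∫ e, e ∂γ = 0 := integral_id_gaussianReal
    have hγv : Var[id; γ] = v := by rw [hγ, variance_id_gaussianReal, Real.coe_toNNReal _ hv0]
    have hlo : (fun u : ℝ => charFun ν u - charFun γ u) =o[𝓝 0] fun u : ℝ => u ^ 2 := by
      have h1 := charFun_sub_isLittleO h2 h0
      have h3 := charFun_sub_isLittleO hγ2 hγ0
      rw [hγv] at h3
      refine (h1.sub h3).congr_left fun u => ?_
      rw [← hv]; ring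
    refine ProbabilityMeasure.tendsto_iff_tendsto_charFun.2 fun t => ?_
    simp only [ProbabilityMeasure.coe_mk, Measure.map_id]
    have hchar : ∀ n, charFun (P.map fun ω => ∑ i, c n i * ε n i ω) t =
        ∏ i, charFun ν (c n i * t) := by
      intro n
      have hind' : iIndepFun (fun i ω => c n i * ε n i ω) P :=
        (hind n).comp (fun i e => c n i * e) fun i => measurable_const_mul _
      rw [hind'.charFun_map_fun_sum_eq_prod
        (fun i => (hlaw n i).aemeasurable.const_mul _), Finset.prod_apply]
      refine Finset.prod_congr rfl fun i _ => ?_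
      rw [charFun_map_mul_comp (hlaw n i).aemeasurable, (hlaw n i).map_eq]
    have hgauss : ∀ n, ∏ i, charFun γ (c n i * t) =
        Complex.exp (-(v * t ^ 2 / 2 * ∑ i, c n i ^ 2 : ℝ)) := by
      intro n
      simp only [hγ, charFun_gaussianReal]
      rw [← Complex.exp_sum]
      congr 1
      push_cast
      rw [Real.coe_toNNReal _ hv0, Finset.mul_sum, ← Finset.sum_neg_distrib]
      refine Finset.sum_congr rfl fun i _ => ?_
      ring
    simp only [hchar]
    have hlim : Tendsto (fun n => ∏ i, charFun γ (c n i * t)) atTop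
        (𝓝 (charFun (gaussianReal 0 (v * s).toNNReal) t)) := by
      simp only [hgauss, charFun_gaussianReal]
      have hh : Tendsto (fun n => Complex.exp (-(v * t ^ 2 / 2 * ∑ i, c n i ^ 2 : ℝ))) atTop
          (𝓝 (Complex.exp (-(v * t ^ 2 / 2 * s : ℝ)))) := by
        refine (Complex.continuous_exp.tendsto _).comp ?_
        exact ((Complex.continuous_ofReal.tendsto _).comp (hs.const_mul _)).neg
      convert hh using 3
      rw [Real.coe_toNNReal _ (mul_nonneg hv0 hs0)]
      push_cast; ring
    have hdiff : Tendsto (fun n => ∏ i, charFun ν (c n i * t) - ∏ i, charFun γ (c n i * t)) atTop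
        (𝓝 0) := by
      have hsum : Tendsto (fun n => ∑ i, ‖charFun ν (c n i * t) - charFun γ (c n i * t)‖) atTop
          (𝓝 0) := by
        rw [Metric.tendsto_nhds]
        intro r hr
        -- The sum of squares is eventually below `s + 1`; the last `+ 1` keeps the denominator
        -- positive when `t = 0` and makes the final inequality strict.
        have hD : 0 < t ^ 2 * (s + 1) + 1 := by positivity
        have hev := (Asymptotics.isLittleO_iff.1 hlo) (show 0 < r / (t ^ 2 * (s + 1) + 1) by
          positivity)
        obtain ⟨δ, hδ, hball⟩ := Metric.eventually_nhds_iff.1 hev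
        have hMt : Tendsto (fun n => M n * |t|) atTop (𝓝 0) := by simpa using hM.mul_const |t|
        filter_upwards [hMt.eventually_lt_const hδ, hs.eventually_lt_const (lt_add_one s)]
          with n hn1 hn2
        rw [dist_zero_right, Real.norm_of_nonneg (Finset.sum_nonneg fun _ _ => norm_nonneg _)]
        calc ∑ i, ‖charFun ν (c n i * t) - charFun γ (c n i * t)‖
            ≤ ∑ i, r / (t ^ 2 * (s + 1) + 1) * (t ^ 2 * c n i ^ 2) := by
              refine Finset.sum_le_sum fun i _ => ?_
              have := hball (y := c n i * t) (by
                rw [dist_zero_right, norm_mul]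
                exact (mul_le_mul_of_nonneg_right (hcM n i) (norm_nonneg _)).trans_lt hn1)
              refine this.trans (le_of_eq ?_)
              rw [Real.norm_of_nonneg (sq_nonneg _)]; ring
          _ = r / (t ^ 2 * (s + 1) + 1) * (t ^ 2 * ∑ i, c n i ^ 2) := by
              rw [← Finset.mul_sum, ← Finset.mul_sum]
          _ ≤ r / (t ^ 2 * (s + 1) + 1) * (t ^ 2 * (s + 1)) := by gcongr
          _ < r := by
              rw [div_mul_eq_mul_div, div_lt_iff₀ hD]
              nlinarith
      exact squeeze_zero_norm (fun n => norm_prod_sub_prod_le _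
        (fun _ => norm_charFun_le_one _) fun _ => norm_charFun_le_one _) hsum
    simpa using hdiff.add hlim

/-! ### Chebyshev's inequality for weighted sums -/

/-- The function `g` is the identity for the noise itself, and the centred absolute value for local
averages of `|ε|`. -/
theorem measure_abs_weighted_sum_ge_le {Ω : Type*} [MeasurableSpace Ω] {P : Measure Ω}
    [IsProbabilityMeasure P] {ν : Measure ℝ} [IsProbabilityMeasure ν] {g : ℝ → ℝ}
    (hg : Measurable g) (h2 : MemLp g 2 ν) (h0 : ∫ e, g e ∂ν = 0)
    {ι : Type*} [Fintype ι] {ε : ι → Ω → ℝ} (hlaw : ∀ i, HasLaw (ε i) ν P)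
    (hind : iIndepFun ε P) (c : ι → ℝ) {r : ℝ} (hr : 0 < r) :
    P {ω | r ≤ |∑ i, c i * g (ε i ω)|} ≤
      ENNReal.ofReal (Var[g; ν] * (∑ i, c i ^ 2) / r ^ 2) := by
  have hmem : ∀ i, MemLp (fun ω => g (ε i ω)) 2 P := by
    intro i
    have := h2
    rw [← (hlaw i).map_eq] at this
    exact this.comp_of_map (hlaw i).aemeasurable
  have hmean : ∀ i, ∫ ω, g (ε i ω) ∂P = 0 := by
    intro i
    rw [← integral_map (hlaw i).aemeasurable hg.aestronglyMeasurable, (hlaw i).map_eq, h0]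
  have hvar : ∀ i, Var[fun ω => g (ε i ω); P] = Var[g; ν] := by
    intro i
    rw [← (hlaw i).map_eq, variance_map (hg.aemeasurable) (hlaw i).aemeasurable]
    rfl
  have hmem' : ∀ i, MemLp (fun ω => c i * g (ε i ω)) 2 P := fun i => (hmem i).const_mul _
  have hsum : MemLp (fun ω => ∑ i, c i * g (ε i ω)) 2 P :=
    memLp_finsetSum _ fun i _ => hmem' i
  have hexp : ∫ ω, ∑ i, c i * g (ε i ω) ∂P = 0 := by
    rw [integral_finsetSum _ fun i _ => (hmem' i).integrable (by norm_num)]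
    refine Finset.sum_eq_zero fun i _ => ?_
    rw [integral_const_mul, hmean, mul_zero]
  have hV : Var[fun ω => ∑ i, c i * g (ε i ω); P] = Var[g; ν] * ∑ i, c i ^ 2 := by
    have e : (fun ω => ∑ i, c i * g (ε i ω)) = ∑ i, fun ω => c i * g (ε i ω) := by
      funext ω; simp
    rw [e, IndepFun.variance_sum (fun i _ => hmem' i), Finset.mul_sum]
    · refine Finset.sum_congr rfl fun i _ => ?_
      rw [variance_const_mul, hvar, mul_comm]
    · intro i _ j _ hij
      exact (hind.indepFun hij).comp (φ := fun e => c i * g e) (ψ := fun e => c j * g e)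
        (hg.const_mul _) (hg.const_mul _)
  have := meas_ge_le_variance_div_sq hsum hr
  rw [hexp, hV] at this
  simpa using this

/-! ### Uniform law of large numbers for the noise -/

/-- The weight of the observation `i` in a kernel sum. -/
def kernelWeight {n : ℕ} (d : Fin n → ℝ) (F : ℝ × ℝ → ℝ) (x y ψ h : ℝ) (i : Fin n × Fin n) : ℝ :=
  ((n * h) ^ 2)⁻¹ * F (unrotate ψ ((x - d i.1) / h, (y - d i.2) / h))

theorem kernelSum_eq_sum {n : ℕ} (d : Fin n → ℝ) (A : Fin n × Fin n → ℝ) (F : ℝ × ℝ → ℝ)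
    (x y ψ h : ℝ) : kernelSum d A F x y ψ h = ∑ i, kernelWeight d F x y ψ h i * A i := by
  unfold kernelSum kernelWeight
  rw [Finset.mul_sum]
  exact Finset.sum_congr rfl fun i _ => by ring

theorem sum_kernelWeight_sq {n : ℕ} (d : Fin n → ℝ) (F : ℝ × ℝ → ℝ) (x y ψ h : ℝ) :
    ∑ i, kernelWeight d F x y ψ h i ^ 2 =
      ((n * h) ^ 2)⁻¹ * kernelSum d (fun _ => 1) (fun p => F p ^ 2) x y ψ h := by
  unfold kernelSum kernelWeight
  rw [Finset.mul_sum, Finset.mul_sum]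
  exact Finset.sum_congr rfl fun i _ => by ring

section Noise

variable {Ω : Type*} [MeasurableSpace Ω] {P : Measure Ω} [IsProbabilityMeasure P]
  {ν : Measure ℝ} [IsProbabilityMeasure ν]

theorem measure_abs_kernelSum_ge_le {g : ℝ → ℝ} (hg : Measurable g) (h2 : MemLp g 2 ν)
    (h0 : ∫ e, g e ∂ν = 0) {n : ℕ} {d : Fin n → ℝ} (hd : InCells d)
    {ε : Fin n × Fin n → Ω → ℝ} (hlaw : ∀ i, HasLaw (ε i) ν P) (hind : iIndepFun ε P)
    {F : ℝ × ℝ → ℝ} {B R h : ℝ} (hR : 0 ≤ R) (hh : 0 < h) (hnh : 1 ≤ n * h)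
    (hF : ∀ p, |F p| ≤ B) (hFR : ∀ p, R < ‖p‖ → F p = 0) (x y ψ : ℝ) {r : ℝ} (hr : 0 < r) :
    P {ω | r ≤ |kernelSum d (fun i => g (ε i ω)) F x y ψ h|} ≤
      ENNReal.ofReal (Var[g; ν] * (B ^ 2 * (2 * (R + 2)) ^ 2) / r ^ 2 * ((n * h) ^ 2)⁻¹) := by
  simp only [kernelSum_eq_sum]
  refine (measure_abs_weighted_sum_ge_le hg h2 h0 hlaw hind _ hr).trans
    (ENNReal.ofReal_le_ofReal ?_)
  rw [sum_kernelWeight_sq]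
  have hb := abs_kernelSum_le hd (A := fun _ => 1) (F := fun p => F p ^ 2) (a := 1) (B := B ^ 2)
    zero_le_one (sq_nonneg B) hR hh hnh (fun _ => by simp)
    (fun p => by rw [abs_pow]; exact pow_le_pow_left₀ (abs_nonneg _) (hF p) 2)
    (fun p hp => by rw [hFR p hp]; simp) x y ψ
  rw [one_mul] at hb
  have hv : 0 ≤ Var[g; ν] := variance_nonneg _ _
  have hle := (le_abs_self _).trans hb
  calc Var[g; ν] * (((n * h) ^ 2)⁻¹ * kernelSum d (fun _ => 1) (fun p => F p ^ 2) x y ψ h) / r ^ 2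
      ≤ Var[g; ν] * (((n * h) ^ 2)⁻¹ * (B ^ 2 * (2 * (R + 2)) ^ 2)) / r ^ 2 := by gcongr
    _ = _ := by ring

theorem IsWindow.exists_bound {F : ℝ × ℝ → ℝ} (hF : IsWindow F) :
    ∃ B, 0 ≤ B ∧ ∀ p, |F p| ≤ B := by
  have hFsupp : HasCompactSupport F := by
    refine HasCompactSupport.of_support_subset_isCompact (isCompact_closedBall (0 : ℝ × ℝ) 1) ?_
    intro p hp
    rw [mem_closedBall_zero_iff]
    by_contra hcon
    exact hp (hF.zero p (not_le.1 hcon).le)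
  obtain ⟨B, hB⟩ := hF.cont.bounded_above_of_compact_support hFsupp
  exact ⟨B, (norm_nonneg _).trans (hB 0), hB⟩

/-- A finite net of shifts and angles for a window. -/
theorem IsWindow.exists_net {F : ℝ × ℝ → ℝ} (hF : IsWindow F) {ρ : ℝ} (hρ : 0 < ρ) :
    ∃ T : Finset (ℝ × ℝ), ∀ s ∈ Icc (0 : ℝ) 1, ∀ ψ ∈ angles, ∃ q ∈ T, ∀ u : ℝ × ℝ,
      |F (unrotate ψ (u + (0, s))) - F (unrotate q.2 (u + (0, q.1)))| ≤
        ρ * (square 6).indicator (fun _ => 1) u := by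
  set Φ : (ℝ × ℝ) × (ℝ × ℝ) → ℝ := fun w => F (unrotate w.1.2 (w.2 + (0, w.1.1))) with hΦ
  have hΦc : Continuous Φ := by
    refine hF.cont.comp ?_
    unfold unrotate
    fun_prop
  have hC : IsCompact ((Icc (0 : ℝ) 1 ×ˢ angles) ×ˢ square 6) :=
    (isCompact_Icc.prod isCompact_angles).prod (isCompact_Icc.prod isCompact_Icc)
  have huc := hC.uniformContinuousOn_of_continuous hΦc.continuousOn
  rw [Metric.uniformContinuousOn_iff] at huc
  obtain ⟨δ, hδ, huc⟩ := huc ρ hρ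
  obtain ⟨T, hTs, hTf, hT⟩ :=
    (isCompact_Icc.prod isCompact_angles : IsCompact (Icc (0 : ℝ) 1 ×ˢ angles)).finite_cover_balls hδ
  refine ⟨hTf.toFinset, fun s hs ψ hψ => ?_⟩
  have hmem := hT (show (s, ψ) ∈ Icc (0 : ℝ) 1 ×ˢ angles from ⟨hs, hψ⟩)
  simp only [mem_iUnion] at hmem
  obtain ⟨q, hq, hball⟩ := hmem
  refine ⟨q, hTf.mem_toFinset.2 hq, fun u => ?_⟩
  by_cases hu : u ∈ square 6
  · rw [indicator_of_mem hu, mul_one]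
    have := huc ((s, ψ), u) ⟨⟨hs, hψ⟩, hu⟩ (q, u) ⟨hTs hq, hu⟩ (by
      rw [Prod.dist_eq, dist_self, max_eq_left dist_nonneg]; exact hball)
    exact this.le
  · rw [indicator_of_notMem hu, mul_zero]
    -- If `‖u‖ > 6`, a shift by at most `1` leaves a norm above `5`, and unrotating at worst halves
    -- it, so the argument lies outside the support.
    have hz : ∀ (a ψ : ℝ), a ∈ Icc (0 : ℝ) 1 → F (unrotate ψ (u + (0, a))) = 0 := by
      intro a ψ ha
      refine hF.zero _ ?_
      rw [mem_square, not_le] at hu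
      have h1 := norm_rotate_le ψ (unrotate ψ (u + (0, a)))
      rw [rotate_unrotate] at h1
      have h2 : ‖((0 : ℝ), a)‖ ≤ 1 := by
        rw [Prod.norm_def]
        simp only [norm_zero, Real.norm_eq_abs]
        exact max_le zero_le_one (abs_le.2 ⟨by linarith [ha.1], ha.2⟩)
      have h3 := norm_sub_le (u + (0, a)) (0, a)
      rw [add_sub_cancel_right] at h3
      linarith
    rw [hz s ψ hs, hz q.1 q.2 (hTs hq).1]
    simp

/-- The oscillation within one block is controlled by a local average of `|A|`, so unbounded errors
need no pointwise bound. -/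
theorem abs_kernelSum_sub_le {n : ℕ} {d : Fin n → ℝ} (A : Fin n × Fin n → ℝ) {F : ℝ × ℝ → ℝ}
    {x y₀ s ψ s' ψ' h ρ : ℝ} (hh : 0 < h)
    (hnet : ∀ u : ℝ × ℝ, |F (unrotate ψ (u + (0, s))) - F (unrotate ψ' (u + (0, s')))| ≤
        ρ * (square 6).indicator (fun _ => 1) u) :
    |kernelSum d A F x (y₀ + s * h) ψ h - kernelSum d A F x (y₀ + s' * h) ψ' h| ≤
      ρ * kernelSum d (fun i => |A i|) ((square 6).indicator fun _ => 1) x y₀ 0 h := by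
  unfold kernelSum
  rw [← mul_sub, ← Finset.sum_sub_distrib, abs_mul, abs_of_nonneg (by positivity), mul_left_comm]
  refine mul_le_mul_of_nonneg_left ?_ (by positivity)
  refine (Finset.abs_sum_le_sum_abs _ _).trans ?_
  rw [Finset.mul_sum]
  refine Finset.sum_le_sum fun i _ => ?_
  have e : ∀ a : ℝ, ((x - d i.1) / h, (y₀ + a * h - d i.2) / h) =
      ((x - d i.1) / h, (y₀ - d i.2) / h) + (0, a) := by
    intro a
    ext
    · simp
    · simp only [Prod.mk_add_mk]; field_simp; ring
  have e0 : unrotate 0 ((x - d i.1) / h, (y₀ - d i.2) / h) =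
      ((x - d i.1) / h, (y₀ - d i.2) / h) := by
    unfold unrotate; simp
  rw [e, e, e0, ← mul_sub, abs_mul, mul_left_comm]
  exact mul_le_mul_of_nonneg_left (hnet _) (abs_nonneg _)

/-- The heights are cut into about `1 / h` blocks of length `h`. Within a block, rescaled shifts and
angles are replaced by a finite net whose size does not depend on `n`, at the cost of a small
multiple of a local average of `|ε|`. Chebyshev's inequality bounds each exceptional event by a
multiple of `(n h)⁻²`, and the union bound gives `O((n² h³)⁻¹)`. -/
theorem tendsto_measure_noise {d : ∀ n : ℕ, Fin n → ℝ} (hd : ∀ n, InCells (d n)) {h : ℕ → ℝ}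
    (hh : BandwidthLimits h) (h2 : MemLp id 2 ν) (h0 : ∫ e, e ∂ν = 0)
    {ε : ∀ n : ℕ, Fin n × Fin n → Ω → ℝ} (hlaw : ∀ n i, HasLaw (ε n i) ν P)
    (hind : ∀ n, iIndepFun (ε n) P) {F : ℝ × ℝ → ℝ} (hF : IsWindow F) (x : ℝ) {r : ℝ}
    (hr : 0 < r) :
    Tendsto (fun n => P {ω | ∃ y ∈ Icc (0 : ℝ) 1, ∃ ψ ∈ angles,
      r ≤ |kernelSum (d n) (fun i => ε n i ω) F x y ψ (h n)|}) atTop (𝓝 0) := by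
  obtain ⟨B, hB0, hB⟩ := hF.exists_bound
  set A : ℝ := ∫ e, |e| ∂ν with hA
  have hA0 : 0 ≤ A := integral_nonneg fun _ => abs_nonneg _
  set W : ℝ × ℝ → ℝ := (square 6).indicator fun _ => 1 with hW
  have hWb : ∀ p, |W p| ≤ 1 := by
    intro p
    by_cases hp : p ∈ square 6 <;> simp [hW, hp]
  have hW0 : ∀ p, 6 < ‖p‖ → W p = 0 := fun p hp =>
    indicator_of_notMem (fun hm => absurd (mem_square.1 hm) (not_le.2 hp)) _
  -- The factor `256 = (2 * (6 + 2)) ^ 2` comes from `abs_kernelSum_le` with radius `6` and bounds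
  -- the mean part; the `1` bounds the fluctuation off the event `G k`. With net precision `r / (2 *
  -- D)` the oscillation is at most `r / 2`.
  set D : ℝ := 256 * A + 1 with hD
  have hDpos : 0 < D := by positivity
  obtain ⟨T, hT⟩ := hF.exists_net (ρ := r / (2 * D)) (by positivity)
  have hgm : Measurable fun e : ℝ => |e| - A := measurable_norm.sub_const A
  have hg2 : MemLp (fun e : ℝ => |e| - A) 2 ν := h2.norm.sub (memLp_const A)
  have hint : Integrable (fun e : ℝ => |e|) ν := (h2.integrable (by norm_num)).norm
  have hg0 : ∫ e, (|e| - A) ∂ν = 0 := by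
    rw [integral_sub hint (integrable_const A), integral_const, probReal_univ, one_smul, hA,
      sub_self]
  set C₁ : ℝ := Var[id; ν] * (B ^ 2 * (2 * (1 + 2)) ^ 2) / (r / 2) ^ 2 with hC₁
  set C₂ : ℝ := Var[fun e : ℝ => |e| - A; ν] * (1 ^ 2 * (2 * (6 + 2)) ^ 2) / 1 ^ 2 with hC₂
  have hC₁0 : 0 ≤ C₁ := by
    have := variance_nonneg id ν
    positivity
  have hC₂0 : 0 ≤ C₂ := by
    have := variance_nonneg (fun e : ℝ => |e| - A) ν
    positivity
  set C : ℝ := 2 * (T.card * C₁ + C₂) with hC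
  have hlim : Tendsto (fun n : ℕ => ENNReal.ofReal (C * ((n : ℝ) ^ 2 * h n ^ 3)⁻¹)) atTop (𝓝 0) := by
    rw [← ENNReal.ofReal_zero]
    refine (ENNReal.continuous_ofReal.tendsto 0).comp ?_
    simpa using (hh.tendsto_cube.inv_tendsto_atTop).const_mul C
  refine tendsto_of_tendsto_of_tendsto_of_le_of_le' tendsto_const_nhds hlim
    (Eventually.of_forall fun _ => zero_le) ?_
  filter_upwards [hh.pos, hh.tendsto_mul.eventually_ge_atTop 1,
    hh.tendsto_zero.eventually_le_const one_pos] with n hn hnh hn1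
  -- Blocks are numbered from `0` to `⌊1 / h⌋`; the last one may extend beyond height `1`, which is
  -- harmless.
  set N : ℕ := ⌊1 / h n⌋₊ + 1 with hN
  set E : ℕ → ℝ × ℝ → Set Ω := fun k q =>
    {ω | r / 2 ≤ |kernelSum (d n) (fun i => id (ε n i ω)) F x (k * h n + q.1 * h n) q.2 (h n)|}
    with hE
  set G : ℕ → Set Ω := fun k =>
    {ω | 1 ≤ |kernelSum (d n) (fun i => |ε n i ω| - A) W x (k * h n) 0 (h n)|} with hG
  have hsub : {ω | ∃ y ∈ Icc (0 : ℝ) 1, ∃ ψ ∈ angles,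
      r ≤ |kernelSum (d n) (fun i => ε n i ω) F x y ψ (h n)|} ⊆
      ⋃ k ∈ Finset.range N, ((⋃ q ∈ T, E k q) ∪ G k) := by
    rintro ω ⟨y, hy, ψ, hψ, hge⟩
    have hyh : 0 ≤ y / h n := div_nonneg hy.1 hn.le
    have hk : ⌊y / h n⌋₊ ∈ Finset.range N := by
      rw [Finset.mem_range, hN, Nat.lt_succ_iff]
      exact Nat.floor_le_floor (by gcongr; exact hy.2)
    set k := ⌊y / h n⌋₊ with hkdef
    have hs : y / h n - k ∈ Icc (0 : ℝ) 1 :=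
      ⟨sub_nonneg.2 (Nat.floor_le hyh), by linarith [Nat.lt_floor_add_one (y / h n)]⟩
    obtain ⟨q, hq, hnet⟩ := hT _ hs ψ hψ
    have hyeq : y = k * h n + (y / h n - k) * h n := by field_simp; ring
    have hdiff := abs_kernelSum_sub_le (d := d n) (fun i => ε n i ω) (x := x) (y₀ := k * h n) hn hnet
    rw [← hyeq] at hdiff
    simp only [mem_iUnion]
    refine ⟨k, hk, ?_⟩
    by_cases hGk : ω ∈ G k
    · exact Or.inr hGk
    · left
      simp only [mem_iUnion]
      refine ⟨q, hq, ?_⟩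
      have hGk' : |kernelSum (d n) (fun i => |ε n i ω| - A) W x (k * h n) 0 (h n)| < 1 :=
        not_le.1 hGk
      have hone := abs_kernelSum_le (hd n) (A := fun _ => A) (F := W) (a := A) (B := 1) hA0
        zero_le_one (by norm_num : (0 : ℝ) ≤ 6) hn hnh (fun _ => (abs_of_nonneg hA0).le) hWb hW0
        x (k * h n) 0
      have hsplit : kernelSum (d n) (fun i => |ε n i ω|) W x (k * h n) 0 (h n) =
          kernelSum (d n) (fun i => |ε n i ω| - A) W x (k * h n) 0 (h n) +
          kernelSum (d n) (fun _ => A) W x (k * h n) 0 (h n) := by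
        unfold kernelSum
        rw [← mul_add, ← Finset.sum_add_distrib]
        congr 1
        exact Finset.sum_congr rfl fun i _ => by ring
      have hWle : kernelSum (d n) (fun i => |ε n i ω|) W x (k * h n) 0 (h n) ≤ D := by
        rw [hsplit, hD]
        have h3 := le_abs_self (kernelSum (d n) (fun _ => A) W x (k * h n) 0 (h n))
        have h4 := le_abs_self (kernelSum (d n) (fun i => |ε n i ω| - A) W x (k * h n) 0 (h n))
        norm_num at hone
        linarith
      have hdiff2 : r / (2 * D) * kernelSum (d n) (fun i => |ε n i ω|) W x (k * h n) 0 (h n) ≤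
          r / 2 := by
        calc _ ≤ r / (2 * D) * D := by gcongr
          _ = r / 2 := by field_simp
      have h5 := abs_sub_abs_le_abs_sub
        (kernelSum (d n) (fun i => ε n i ω) F x y ψ (h n))
        (kernelSum (d n) (fun i => ε n i ω) F x (k * h n + q.1 * h n) q.2 (h n))
      show r / 2 ≤ |kernelSum (d n) (fun i => ε n i ω) F x (k * h n + q.1 * h n) q.2 (h n)|
      linarith
  have hEle : ∀ k q, P (E k q) ≤ ENNReal.ofReal (C₁ * ((n * h n) ^ 2)⁻¹) := fun k q =>
    measure_abs_kernelSum_ge_le measurable_id h2 h0 (hd n) (hlaw n) (hind n) zero_le_one hn hnh hB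
      (fun p hp => hF.zero p hp.le) _ _ _ (by positivity)
  have hGle : ∀ k, P (G k) ≤ ENNReal.ofReal (C₂ * ((n * h n) ^ 2)⁻¹) := fun k =>
    measure_abs_kernelSum_ge_le hgm hg2 hg0 (hd n) (hlaw n) (hind n) (by norm_num) hn hnh hWb hW0
      _ _ _ one_pos
  have hi0 : 0 ≤ (((n : ℝ) * h n) ^ 2)⁻¹ := by positivity
  calc P {ω | ∃ y ∈ Icc (0 : ℝ) 1, ∃ ψ ∈ angles,
      r ≤ |kernelSum (d n) (fun i => ε n i ω) F x y ψ (h n)|}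
      ≤ P (⋃ k ∈ Finset.range N, ((⋃ q ∈ T, E k q) ∪ G k)) := measure_mono hsub
    _ ≤ ∑ k ∈ Finset.range N, P ((⋃ q ∈ T, E k q) ∪ G k) := measure_biUnion_finset_le _ _
    _ ≤ ∑ k ∈ Finset.range N, ENNReal.ofReal ((T.card * C₁ + C₂) * ((n * h n) ^ 2)⁻¹) := by
        refine Finset.sum_le_sum fun k _ => ?_
        calc P ((⋃ q ∈ T, E k q) ∪ G k) ≤ P (⋃ q ∈ T, E k q) + P (G k) := measure_union_le _ _
          _ ≤ (∑ q ∈ T, P (E k q)) + P (G k) := by gcongr; exact measure_biUnion_finset_le _ _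
          _ ≤ (∑ q ∈ T, ENNReal.ofReal (C₁ * ((n * h n) ^ 2)⁻¹)) +
              ENNReal.ofReal (C₂ * ((n * h n) ^ 2)⁻¹) := by
              gcongr with q hq
              · exact hEle k q
              · exact hGle k
          _ = ENNReal.ofReal ((T.card * C₁ + C₂) * ((n * h n) ^ 2)⁻¹) := by
              rw [Finset.sum_const, nsmul_eq_mul, ← ENNReal.ofReal_natCast,
                ← ENNReal.ofReal_mul (by positivity), ← ENNReal.ofReal_add (by positivity)
                (by positivity)]
              congr 1; ring
    _ = ENNReal.ofReal (N * ((T.card * C₁ + C₂) * ((n * h n) ^ 2)⁻¹)) := by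
        rw [Finset.sum_const, Finset.card_range, nsmul_eq_mul, ← ENNReal.ofReal_natCast,
          ← ENNReal.ofReal_mul (by positivity)]
    _ ≤ ENNReal.ofReal (C * ((n : ℝ) ^ 2 * h n ^ 3)⁻¹) := by
        refine ENNReal.ofReal_le_ofReal ?_
        have hNle : (N : ℝ) ≤ 2 / h n := by
          rw [hN]; push_cast
          have h6 := Nat.floor_le (show 0 ≤ 1 / h n by positivity)
          have h7 : 1 ≤ 1 / h n := by rw [le_div_iff₀ hn]; linarith
          have h8 : 2 / h n = 1 / h n + 1 / h n := by ring
          linarith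
        calc (N : ℝ) * ((T.card * C₁ + C₂) * ((n * h n) ^ 2)⁻¹)
            ≤ 2 / h n * ((T.card * C₁ + C₂) * ((n * h n) ^ 2)⁻¹) := by gcongr
          _ = C * ((n : ℝ) ^ 2 * h n ^ 3)⁻¹ := by
              have hnpos : (n : ℝ) ≠ 0 := by
                intro h9; rw [h9] at hnh; norm_num at hnh
              rw [hC]; field_simp

end Noise

/-! ### Convergence in probability as convergence along a filter -/

section ProbFilter

variable {Ω : Type*} [MeasurableSpace Ω]

/-- The filter of sets of pairs `(n, ω)` whose sections have asymptotically full probability. -/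
def probFilter (P : Measure Ω) : Filter (ℕ × Ω) where
  sets := {s | Tendsto (fun n => P {ω | (n, ω) ∉ s}) atTop (𝓝 0)}
  univ_sets := by simp
  sets_of_superset := by
    intro s t hs hst
    exact tendsto_of_tendsto_of_tendsto_of_le_of_le tendsto_const_nhds hs (fun _ => zero_le)
      fun n => measure_mono fun ω hω hmem => hω (hst hmem)
  inter_sets := by
    intro s t hs ht
    have h := Tendsto.add hs ht
    rw [add_zero] at h
    refine tendsto_of_tendsto_of_tendsto_of_le_of_le tendsto_const_nhds h (fun _ => zero_le)
      fun n => (measure_mono fun ω hω => ?_).trans (measure_union_le _ _)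
    by_cases h1 : (n, ω) ∈ s
    · exact Or.inr fun h2 => hω ⟨h1, h2⟩
    · exact Or.inl h1

variable {P : Measure Ω}

theorem eventually_probFilter {p : ℕ × Ω → Prop} :
    (∀ᶠ q in probFilter P, p q) ↔ Tendsto (fun n => P {ω | ¬ p (n, ω)}) atTop (𝓝 0) :=
  Iff.rfl

theorem tendsto_fst_probFilter : Tendsto Prod.fst (probFilter P) atTop := by
  intro s hs
  refine (tendsto_congr' ?_).2 tendsto_const_nhds
  filter_upwards [hs] with n hn
  have : {ω : Ω | (n, ω) ∉ Prod.fst ⁻¹' s} = ∅ := by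
    ext ω; simpa using hn
  rw [this, measure_empty]

theorem eventually_probFilter_of_ae {p : ℕ → Ω → Prop} (h : ∀ᶠ n in atTop, ∀ᵐ ω ∂P, p n ω) :
    ∀ᶠ q in probFilter P, p q.1 q.2 := by
  rw [eventually_probFilter]
  refine (tendsto_congr' ?_).2 tendsto_const_nhds
  filter_upwards [h] with n hn using ae_iff.1 hn

theorem tendstoInMeasure_of_probFilter {f : ℕ → Ω → ℝ}
    (h : Tendsto (fun q : ℕ × Ω => f q.1 q.2) (probFilter P) (𝓝 0)) :
    TendstoInMeasure P f atTop 0 := by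
  rw [tendstoInMeasure_iff_norm]
  intro r hr
  have := eventually_probFilter.1 (Metric.tendsto_nhds.1 h r hr)
  simpa [dist_zero_right, not_lt] using this

variable [IsProbabilityMeasure P] {ν : Measure ℝ} [IsProbabilityMeasure ν]
  {d : ∀ n : ℕ, Fin n → ℝ} {h : ℕ → ℝ} {ε : ∀ n : ℕ, Fin n × Fin n → Ω → ℝ} {F : ℝ × ℝ → ℝ}

/-- Uniformity over heights and angles allows both to be random and to depend on the errors. -/
theorem tendsto_noise (hd : ∀ n, InCells (d n)) (hh : BandwidthLimits h) (h2 : MemLp id 2 ν)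
    (h0 : ∫ e, e ∂ν = 0) (hlaw : ∀ n i, HasLaw (ε n i) ν P) (hind : ∀ n, iIndepFun (ε n) P)
    (hF : IsWindow F) (x : ℝ) {y ψ : ℕ × Ω → ℝ} (hy : ∀ᶠ q in probFilter P, y q ∈ Icc (0 : ℝ) 1)
    (hψ : ∀ᶠ q in probFilter P, ψ q ∈ angles) :
    Tendsto (fun q : ℕ × Ω => kernelSum (d q.1) (fun i => ε q.1 i q.2) F x (y q) (ψ q) (h q.1))
      (probFilter P) (𝓝 0) := by
  rw [Metric.tendsto_nhds]
  intro r hr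
  have hev : ∀ᶠ q in probFilter P, ∀ y ∈ Icc (0 : ℝ) 1, ∀ ψ ∈ angles,
      |kernelSum (d q.1) (fun i => ε q.1 i q.2) F x y ψ (h q.1)| < r := by
    rw [eventually_probFilter]
    have := tendsto_measure_noise hd hh h2 h0 hlaw hind hF x hr
    convert this using 6 with n ω
    push Not
    rfl
  filter_upwards [hev, hy, hψ] with q h1 h2 h3
  rw [dist_zero_right]
  exact h1 _ h2 _ h3

/-- The product of a null sequence and of a rescaled noise sum is a null sequence. -/
theorem tendsto_mul_noise (hd : ∀ n, InCells (d n)) (hh : BandwidthLimits h) (h2 : MemLp id 2 ν)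
    (h0 : ∫ e, e ∂ν = 0) (hlaw : ∀ n i, HasLaw (ε n i) ν P) (hind : ∀ n, iIndepFun (ε n) P)
    (hF : IsWindow F) (x : ℝ) (y ψ : ℕ → ℝ) {c : ℕ × Ω → ℝ}
    (hc : Tendsto c (probFilter P) (𝓝 0)) :
    Tendsto (fun q : ℕ × Ω => c q * (q.1 * h q.1 *
      kernelSum (d q.1) (fun i => ε q.1 i q.2) F x (y q.1) (ψ q.1) (h q.1)))
      (probFilter P) (𝓝 0) := by
  obtain ⟨B, hB0, hB⟩ := hF.exists_bound
  set C : ℝ := Var[id; ν] * (B ^ 2 * (2 * (1 + 2)) ^ 2) with hC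
  have hC0 : 0 ≤ C := by
    have := variance_nonneg id ν
    positivity
  rw [Metric.tendsto_nhds]
  intro r hr
  rw [eventually_probFilter, ENNReal.tendsto_nhds_zero]
  intro η hη
  -- Tightness: by Chebyshev, `n h` times the noise sum exceeds `b` with probability at most `C /
  -- b²`, and the null factor is eventually below `r / b` with high probability.
  obtain ⟨b, hb0, hb⟩ : ∃ b : ℝ, 0 < b ∧ ENNReal.ofReal (C / b ^ 2) ≤ η / 2 := by
    have hlim : Tendsto (fun b : ℝ => ENNReal.ofReal (C / b ^ 2)) atTop (𝓝 0) := by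
      rw [← ENNReal.ofReal_zero]
      exact (ENNReal.continuous_ofReal.tendsto 0).comp
        ((tendsto_pow_atTop two_ne_zero).const_div_atTop C)
    have h3 : 0 < η / 2 := ENNReal.half_pos hη.ne'
    obtain ⟨b, h4, h5⟩ := ((ENNReal.tendsto_nhds_zero.1 hlim _ h3).and (eventually_gt_atTop 0)).exists
    exact ⟨b, h5, h4⟩
  have hcev := eventually_probFilter.1 (Metric.tendsto_nhds.1 hc (r / b) (by positivity))
  have h3 : 0 < η / 2 := ENNReal.half_pos hη.ne'
  filter_upwards [ENNReal.tendsto_nhds_zero.1 hcev _ h3, hh.pos,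
    hh.tendsto_mul.eventually_ge_atTop 1] with n hn1 hn2 hn3
  have hch := measure_abs_kernelSum_ge_le (P := P) measurable_id h2 h0 (hd n) (hlaw n) (hind n)
    zero_le_one hn2 hn3 hB (fun p hp => hF.zero p hp.le) x (y n) (ψ n)
    (r := b / (n * h n)) (by positivity)
  have hpos : 0 < (n : ℝ) * h n := by linarith
  have e : Var[id; ν] * (B ^ 2 * (2 * (1 + 2)) ^ 2) / (b / (n * h n)) ^ 2 * ((n * h n) ^ 2)⁻¹ =
      C / b ^ 2 := by
    have hn0 : (n : ℝ) ≠ 0 := fun h4 => by rw [h4, zero_mul] at hpos; exact lt_irrefl _ hpos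
    rw [← hC]; field_simp
  rw [e] at hch
  calc _ ≤ P ({ω | ¬ dist (c (n, ω)) 0 < r / b} ∪ {ω | b / (n * h n) ≤
        |kernelSum (d n) (fun i => id (ε n i ω)) F x (y n) (ψ n) (h n)|}) := by
        refine measure_mono fun ω hω => ?_
        by_contra hcon
        simp only [mem_union, not_or] at hcon
        obtain ⟨h4, h5⟩ := hcon
        have h4' : |c (n, ω)| < r / b := by
          have : dist (c (n, ω)) 0 < r / b := not_not.1 h4
          rwa [dist_zero_right] at this
        have h5' : |kernelSum (d n) (fun i => ε n i ω) F x (y n) (ψ n) (h n)| < b / (n * h n) :=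
          not_le.1 h5
        apply hω
        rw [dist_zero_right, norm_mul, norm_mul, Real.norm_of_nonneg hpos.le]
        rw [lt_div_iff₀ hpos, mul_comm] at h5'
        rw [lt_div_iff₀ hb0] at h4'
        calc ‖c (n, ω)‖ * (n * h n *
              ‖kernelSum (d n) (fun i => ε n i ω) F x (y n) (ψ n) (h n)‖)
            ≤ |c (n, ω)| * b := mul_le_mul_of_nonneg_left h5'.le (abs_nonneg _)
          _ < r := h4'
    _ ≤ η / 2 + η / 2 := (measure_union_le _ _).trans (add_le_add hn1 (hch.trans hb))
    _ = η := ENNReal.add_halves η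

end ProbFilter

/-! ### Scores and second derivatives -/

/-- The product window `(a, b) ↦ P a * Q b`. -/
def tensor (P Q : ℝ → ℝ) (p : ℝ × ℝ) : ℝ := P p.1 * Q p.2

theorem IsBump.tensor {P Q : ℝ → ℝ} (hP : IsBump P) (hQ : IsBump Q) : IsWindow (tensor P Q) :=
  hP.isWindow hQ

/-- Turning the angle by `Δψ` moves the window coordinates `(a, b)` in the direction `(b, -a)`, and
raising the centre by `Δy` moves them by `Δy / h` times `(sin ψ, cos ψ)`. Product windows thus
remain product windows after differentiation. -/
theorem hasDerivAt_kernelSum_line {n : ℕ} (d : Fin n → ℝ) (A : Fin n × Fin n → ℝ)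
    {P P' Q Q' : ℝ → ℝ} (hP : ∀ t, HasDerivAt P (P' t) t) (hQ : ∀ t, HasDerivAt Q (Q' t) t)
    (x y ψ h Δy Δψ s : ℝ) :
    HasDerivAt (fun s => kernelSum d A (tensor P Q) x (y + s * Δy) (ψ + s * Δψ) h)
      (Δy / h * (Real.sin (ψ + s * Δψ) *
            kernelSum d A (tensor P' Q) x (y + s * Δy) (ψ + s * Δψ) h +
          Real.cos (ψ + s * Δψ) * kernelSum d A (tensor P Q') x (y + s * Δy) (ψ + s * Δψ) h) +
        Δψ * (kernelSum d A (tensor P' fun t => t * Q t) x (y + s * Δy) (ψ + s * Δψ) h -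
          kernelSum d A (tensor (fun t => t * P t) Q') x (y + s * Δy) (ψ + s * Δψ) h)) s := by
  have hψ : HasDerivAt (fun s => ψ + s * Δψ) Δψ s := by
    simpa using ((hasDerivAt_id s).mul_const Δψ).const_add ψ
  have hsin := hψ.sin
  have hcos := hψ.cos
  have hterm : ∀ i : Fin n × Fin n, HasDerivAt (fun s => A i * tensor P Q
      (unrotate (ψ + s * Δψ) ((x - d i.1) / h, (y + s * Δy - d i.2) / h)))
      (A i * ((P' (unrotate (ψ + s * Δψ) ((x - d i.1) / h, (y + s * Δy - d i.2) / h)).1 *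
        (Δψ * (unrotate (ψ + s * Δψ) ((x - d i.1) / h, (y + s * Δy - d i.2) / h)).2 +
          Real.sin (ψ + s * Δψ) * (Δy / h))) *
          Q (unrotate (ψ + s * Δψ) ((x - d i.1) / h, (y + s * Δy - d i.2) / h)).2 +
        P (unrotate (ψ + s * Δψ) ((x - d i.1) / h, (y + s * Δy - d i.2) / h)).1 *
        (Q' (unrotate (ψ + s * Δψ) ((x - d i.1) / h, (y + s * Δy - d i.2) / h)).2 *
          (-(Δψ * (unrotate (ψ + s * Δψ) ((x - d i.1) / h, (y + s * Δy - d i.2) / h)).1) +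
          Real.cos (ψ + s * Δψ) * (Δy / h))))) s := by
    intro i
    have hu : HasDerivAt (fun s => (y + s * Δy - d i.2) / h) (Δy / h) s := by
      simpa using ((((hasDerivAt_id s).mul_const Δy).const_add y).sub_const (d i.2)).div_const h
    have ha : HasDerivAt (fun s =>
        (unrotate (ψ + s * Δψ) ((x - d i.1) / h, (y + s * Δy - d i.2) / h)).1)
        (Δψ * (unrotate (ψ + s * Δψ) ((x - d i.1) / h, (y + s * Δy - d i.2) / h)).2 +
          Real.sin (ψ + s * Δψ) * (Δy / h)) s := by
      refine ((hcos.mul_const ((x - d i.1) / h)).add (hsin.mul hu)).congr_deriv ?_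
      simp only [unrotate]; ring
    have hb : HasDerivAt (fun s =>
        (unrotate (ψ + s * Δψ) ((x - d i.1) / h, (y + s * Δy - d i.2) / h)).2)
        (-(Δψ * (unrotate (ψ + s * Δψ) ((x - d i.1) / h, (y + s * Δy - d i.2) / h)).1) +
          Real.cos (ψ + s * Δψ) * (Δy / h)) s := by
      refine ((hsin.neg.mul_const ((x - d i.1) / h)).add (hcos.mul hu)).congr_deriv ?_
      simp only [unrotate]; ring
    exact (((hP _).comp s ha).mul ((hQ _).comp s hb)).const_mul (A i)
  have hsum := (HasDerivAt.fun_sum (u := Finset.univ) fun i _ => hterm i).const_mul (((n * h) ^ 2)⁻¹)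
  unfold kernelSum
  refine hsum.congr_deriv ?_
  simp only [Finset.mul_sum, ← Finset.sum_add_distrib, ← Finset.sum_sub_distrib, tensor]
  refine Finset.sum_congr rfl fun i _ => ?_
  ring

section Score

variable (K₁ K₂ : ℝ → ℝ) (ψ : ℝ) (S : (ℝ → ℝ) → (ℝ → ℝ) → ℝ)

/-- `h` times the derivative with respect to the height, in terms of the product sums `S`. -/
def scoreY : ℝ := Real.sin ψ * S (deriv K₁) K₂ + Real.cos ψ * S K₁ (deriv K₂)

/-- The derivative with respect to the angle. -/
def scoreA : ℝ := S (deriv K₁) (fun t => t * K₂ t) - S (fun t => t * K₁ t) (deriv K₂)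

/-- `h` times the derivative of `scoreY` with respect to the height. -/
def hessYY : ℝ :=
  Real.sin ψ * (Real.sin ψ * S (deriv (deriv K₁)) K₂ + Real.cos ψ * S (deriv K₁) (deriv K₂)) +
    Real.cos ψ * (Real.sin ψ * S (deriv K₁) (deriv K₂) + Real.cos ψ * S K₁ (deriv (deriv K₂)))

/-- The derivative of `scoreY` with respect to the angle. -/
def hessYA : ℝ :=
  Real.cos ψ * S (deriv K₁) K₂ - Real.sin ψ * S K₁ (deriv K₂) +
    Real.sin ψ * (S (deriv (deriv K₁)) (fun t => t * K₂ t) -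
      S (fun t => t * deriv K₁ t) (deriv K₂)) +
    Real.cos ψ * (S (deriv K₁) (fun t => t * deriv K₂ t) -
      S (fun t => t * K₁ t) (deriv (deriv K₂)))

/-- `h` times the derivative of `scoreA` with respect to the height. -/
def hessAY : ℝ :=
  Real.sin ψ * S (deriv (deriv K₁)) (fun t => t * K₂ t) +
      Real.cos ψ * S (deriv K₁) (fun t => K₂ t + t * deriv K₂ t) -
    (Real.sin ψ * S (fun t => K₁ t + t * deriv K₁ t) (deriv K₂) +
      Real.cos ψ * S (fun t => t * K₁ t) (deriv (deriv K₂)))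

/-- The derivative of `scoreA` with respect to the angle. -/
def hessAA : ℝ :=
  S (deriv (deriv K₁)) (fun t => t * (t * K₂ t)) -
      S (fun t => t * deriv K₁ t) (fun t => K₂ t + t * deriv K₂ t) -
    (S (fun t => K₁ t + t * deriv K₁ t) (fun t => t * deriv K₂ t) -
      S (fun t => t * (t * K₁ t)) (deriv (deriv K₂)))

end Score

/-- The kernel sums over all product windows. -/
def tensorSum {n : ℕ} (d : Fin n → ℝ) (A : Fin n × Fin n → ℝ) (x y ψ h : ℝ) (P Q : ℝ → ℝ) : ℝ :=
  kernelSum d A (tensor P Q) x y ψ h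

section Derivatives

variable {K₁ K₂ : ℝ → ℝ} {n : ℕ} (d : Fin n → ℝ) (A : Fin n × Fin n → ℝ) (x y ψ h Δy Δψ s : ℝ)

theorem hasDerivAt_contrast_line (hK₁ : IsSmoothKernel K₁) (hK₂ : IsSmoothKernel K₂) :
    HasDerivAt (fun s => kernelSum d A (tensor K₁ K₂) x (y + s * Δy) (ψ + s * Δψ) h)
      (Δy / h * scoreY K₁ K₂ (ψ + s * Δψ) (tensorSum d A x (y + s * Δy) (ψ + s * Δψ) h) +
        Δψ * scoreA K₁ K₂ (tensorSum d A x (y + s * Δy) (ψ + s * Δψ) h)) s :=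
  hasDerivAt_kernelSum_line d A hK₁.hasDerivAt hK₂.hasDerivAt x y ψ h Δy Δψ s

theorem hasDerivAt_scoreY_line (hK₁ : IsSmoothKernel K₁) (hK₂ : IsSmoothKernel K₂) :
    HasDerivAt (fun s => scoreY K₁ K₂ (ψ + s * Δψ)
        (tensorSum d A x (y + s * Δy) (ψ + s * Δψ) h))
      (Δy / h * hessYY K₁ K₂ (ψ + s * Δψ) (tensorSum d A x (y + s * Δy) (ψ + s * Δψ) h) +
        Δψ * hessYA K₁ K₂ (ψ + s * Δψ) (tensorSum d A x (y + s * Δy) (ψ + s * Δψ) h)) s := by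
  have hψ : HasDerivAt (fun s => ψ + s * Δψ) Δψ s := by
    simpa using ((hasDerivAt_id s).mul_const Δψ).const_add ψ
  have h1 := hasDerivAt_kernelSum_line d A hK₁.hasDerivAt_deriv hK₂.hasDerivAt x y ψ h Δy Δψ s
  have h2 := hasDerivAt_kernelSum_line d A hK₁.hasDerivAt hK₂.hasDerivAt_deriv x y ψ h Δy Δψ s
  refine ((hψ.sin.mul h1).add (hψ.cos.mul h2)).congr_deriv ?_
  simp only [hessYY, hessYA, tensorSum]
  ring

theorem hasDerivAt_scoreA_line (hK₁ : IsSmoothKernel K₁) (hK₂ : IsSmoothKernel K₂) :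
    HasDerivAt (fun s => scoreA K₁ K₂ (tensorSum d A x (y + s * Δy) (ψ + s * Δψ) h))
      (Δy / h * hessAY K₁ K₂ (ψ + s * Δψ) (tensorSum d A x (y + s * Δy) (ψ + s * Δψ) h) +
        Δψ * hessAA K₁ K₂ (tensorSum d A x (y + s * Δy) (ψ + s * Δψ) h)) s := by
  have hm : ∀ {f f' : ℝ → ℝ}, (∀ t, HasDerivAt f (f' t) t) →
      ∀ t, HasDerivAt (fun t => t * f t) (f t + t * f' t) t := fun hf t => by
    simpa using (hasDerivAt_id' t).fun_mul (hf t)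
  have h1 := hasDerivAt_kernelSum_line d A hK₁.hasDerivAt_deriv (hm hK₂.hasDerivAt)
    x y ψ h Δy Δψ s
  have h2 := hasDerivAt_kernelSum_line d A (hm hK₁.hasDerivAt) hK₂.hasDerivAt_deriv
    x y ψ h Δy Δψ s
  refine (h1.sub h2).congr_deriv ?_
  simp only [hessAY, hessAA, tensorSum]
  ring

/-- Mean value theorem for the scores along a segment. -/
theorem exists_score_sub_eq (hK₁ : IsSmoothKernel K₁) (hK₂ : IsSmoothKernel K₂) :
    (∃ s ∈ Ioo (0 : ℝ) 1, scoreY K₁ K₂ (ψ + Δψ) (tensorSum d A x (y + Δy) (ψ + Δψ) h) -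
        scoreY K₁ K₂ ψ (tensorSum d A x y ψ h) =
      Δy / h * hessYY K₁ K₂ (ψ + s * Δψ) (tensorSum d A x (y + s * Δy) (ψ + s * Δψ) h) +
        Δψ * hessYA K₁ K₂ (ψ + s * Δψ) (tensorSum d A x (y + s * Δy) (ψ + s * Δψ) h)) ∧
    (∃ s ∈ Ioo (0 : ℝ) 1, scoreA K₁ K₂ (tensorSum d A x (y + Δy) (ψ + Δψ) h) -
        scoreA K₁ K₂ (tensorSum d A x y ψ h) =
      Δy / h * hessAY K₁ K₂ (ψ + s * Δψ) (tensorSum d A x (y + s * Δy) (ψ + s * Δψ) h) +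
        Δψ * hessAA K₁ K₂ (tensorSum d A x (y + s * Δy) (ψ + s * Δψ) h)) := by
  constructor
  · have hD := fun s => hasDerivAt_scoreY_line d A x y ψ h Δy Δψ s hK₁ hK₂
    obtain ⟨s, hs, hs'⟩ := exists_hasDerivAt_eq_slope _ _ zero_lt_one
      (fun s _ => (hD s).continuousAt.continuousWithinAt) (fun s _ => hD s)
    refine ⟨s, hs, ?_⟩
    rw [hs']; simp
  · have hD := fun s => hasDerivAt_scoreA_line d A x y ψ h Δy Δψ s hK₁ hK₂
    obtain ⟨s, hs, hs'⟩ := exists_hasDerivAt_eq_slope _ _ zero_lt_one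
      (fun s _ => (hD s).continuousAt.continuousWithinAt) (fun s _ => hD s)
    refine ⟨s, hs, ?_⟩
    rw [hs']; simp

theorem scoreY_eq_kernelSum : scoreY K₁ K₂ ψ (tensorSum d A x y ψ h) =
    kernelSum d A (fun p => Real.sin ψ * tensor (deriv K₁) K₂ p +
      Real.cos ψ * tensor K₁ (deriv K₂) p) x y ψ h := by
  simp only [scoreY, tensorSum, kernelSum, Finset.mul_sum, ← Finset.sum_add_distrib]
  exact Finset.sum_congr rfl fun i _ => by ring

/-- The scores vanish at interior maximizers. -/
theorem scores_eq_zero (hK₁ : IsSmoothKernel K₁) (hK₂ : IsSmoothKernel K₂) (hh : 0 < h)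
    (hmax : IsMaxOn (fun p : ℝ × ℝ => kernelSum d A (tensor K₁ K₂) x p.1 p.2 h)
      (heights h ×ˢ angles) (y, ψ))
    (hy : y ∈ Ioo (√2 * h) (1 - √2 * h)) (hψ : ψ ∈ Ioo (-(Real.pi / 2)) (Real.pi / 2)) :
    scoreY K₁ K₂ ψ (tensorSum d A x y ψ h) = 0 ∧ scoreA K₁ K₂ (tensorSum d A x y ψ h) = 0 := by
  have key : ∀ Δy Δψ : ℝ, Δy / h * scoreY K₁ K₂ ψ (tensorSum d A x y ψ h) +
      Δψ * scoreA K₁ K₂ (tensorSum d A x y ψ h) = 0 := by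
    intro Δy Δψ
    have hD := hasDerivAt_contrast_line d A x y ψ h Δy Δψ 0 hK₁ hK₂
    simp only [zero_mul, add_zero] at hD
    have hnhds : heights h ×ˢ angles ∈ 𝓝 (y, ψ) :=
      prod_mem_nhds (Icc_mem_nhds hy.1 hy.2) (Icc_mem_nhds hψ.1 hψ.2)
    have hloc : IsLocalMax (fun p : ℝ × ℝ => kernelSum d A (tensor K₁ K₂) x p.1 p.2 h) (y, ψ) :=
      hmax.isLocalMax hnhds
    have hcont : Tendsto (fun s : ℝ => (y + s * Δy, ψ + s * Δψ)) (𝓝 0) (𝓝 (y, ψ)) := by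
      have : Continuous fun s : ℝ => (y + s * Δy, ψ + s * Δψ) := by fun_prop
      simpa using this.tendsto 0
    have hloc' : IsLocalMax
        (fun s => kernelSum d A (tensor K₁ K₂) x (y + s * Δy) (ψ + s * Δψ) h) 0 := by
      have := hcont.eventually hloc
      simpa [IsLocalMax, IsMaxFilter] using this
    exact hloc'.hasDerivAt_eq_zero hD
  have h1 := key 1 0
  have h2 := key 0 1
  simp only [zero_mul, add_zero, zero_div, zero_add, one_mul] at h1 h2
  exact ⟨(mul_eq_zero.1 h1).resolve_left (by positivity), h2⟩

end Derivatives

theorem kernelSum_add {n : ℕ} (d : Fin n → ℝ) (A B : Fin n × Fin n → ℝ) (F : ℝ × ℝ → ℝ)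
    (x y ψ h : ℝ) : kernelSum d (fun i => A i + B i) F x y ψ h =
      kernelSum d A F x y ψ h + kernelSum d B F x y ψ h := by
  unfold kernelSum
  rw [← mul_add, ← Finset.sum_add_distrib]
  congr 1
  exact Finset.sum_congr rfl fun i _ => by ring

theorem IsBump.add {P Q : ℝ → ℝ} (hP : IsBump P) (hQ : IsBump Q) : IsBump fun t => P t + Q t :=
  ⟨hP.cont.add hQ.cont, fun t ht => by rw [hP.zero t ht, hQ.zero t ht, add_zero]⟩

theorem IsBump.mul {P Q : ℝ → ℝ} (hP : IsBump P) (hQ : IsBump Q) : IsBump fun t => P t * Q t :=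
  hQ.mul_left hP.cont

theorem IsBump.id_mul {P : ℝ → ℝ} (hP : IsBump P) : IsBump fun t => t * P t :=
  hP.mul_left (f := fun t => t) continuous_id

/-- The limits of product sums at the edge. -/
def tensorLimit (m : ℝ → ℝ → ℝ) (τ φ : ℝ → ℝ) (x : ℝ) (P Q : ℝ → ℝ) : ℝ :=
  (∫ t, P t) * (m x (φ x) * (∫ t, Q t) + τ x * ∫ t in Ioi 0, Q t)

theorem tendsto_tensorSum_image {m : ℝ → ℝ → ℝ} {τ φ : ℝ → ℝ} {x : ℝ} (M : EdgeModel m τ φ x)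
    {d : ∀ n : ℕ, Fin n → ℝ} (hd : ∀ n, InCells (d n)) {h : ℕ → ℝ} (hh : BandwidthLimits h)
    {κ : Type*} {L : Filter κ} {N : κ → ℕ} {y ψ : κ → ℝ} (hN : Tendsto N L atTop)
    (hy : Tendsto (fun k => (y k - φ x) / h (N k)) L (𝓝 0))
    (hψ : Tendsto ψ L (𝓝 (slope φ x))) {P Q : ℝ → ℝ} (hP : IsBump P) (hQ : IsBump Q) :
    Tendsto (fun k => tensorSum (d (N k)) (fun i => image m τ φ (d (N k) i.1) (d (N k) i.2))
      x (y k) (ψ k) (h (N k)) P Q) L (𝓝 (tensorLimit m τ φ x P Q)) := by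
  -- Dominated convergence needs a countably generated filter, whereas `L` is arbitrary and will be
  -- `probFilter P`. The limit is taken along the pullback filter `l`, which is countably generated,
  -- and `L` is mapped into it.
  set l : Filter (ℕ × ℝ × ℝ) := Filter.comap Prod.fst atTop ⊓
    (Filter.comap (fun q => (q.2.1 - φ x) / h q.1) (𝓝 0) ⊓
      Filter.comap (fun q => q.2.2) (𝓝 (slope φ x))) with hl
  have h1 : Tendsto Prod.fst l atTop := tendsto_comap.mono_left inf_le_left
  have h2 : Tendsto (fun q : ℕ × ℝ × ℝ => (q.2.1 - φ x) / h q.1) l (𝓝 0) :=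
    tendsto_comap.mono_left (inf_le_right.trans inf_le_left)
  have h3 : Tendsto (fun q : ℕ × ℝ × ℝ => q.2.2) l (𝓝 (slope φ x)) :=
    tendsto_comap.mono_left (inf_le_right.trans inf_le_right)
  have key := tendsto_kernelSum_near M (l := l) (N := Prod.fst) (d := fun q => d q.1)
    (fun q => hd q.1) (h := fun q => h q.1) (y := fun q => q.2.1) (ψ := fun q => q.2.2)
    (h1.eventually hh.pos) (hh.tendsto_zero.comp h1) (hh.tendsto_mul.comp h1) (hP.tensor hQ)
    h2 h3
  have hmap : Tendsto (fun k => (N k, y k, ψ k)) L l :=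
    tendsto_inf.2 ⟨tendsto_comap_iff.2 hN, tendsto_inf.2 ⟨tendsto_comap_iff.2 hy,
      tendsto_comap_iff.2 hψ⟩⟩
  have := key.comp hmap
  rw [show (∫ t, edgeWeight m τ φ x 0 (slope φ x) t * JumpCurve.tensor P Q t) =
    tensorLimit m τ φ x P Q from integral_edgeWeight_slope m τ φ x hQ] at this
  exact this

/-! ### Limits of the second derivatives -/

/-- The limit of minus the second derivative in the angle. -/
def angleCurvature (K₁ K₂ τ : ℝ → ℝ) (x : ℝ) : ℝ :=
  τ x * deriv K₂ 0 * ∫ t, t ^ 2 * K₁ t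

/-- Integrals of `K₁'`, `K₁''`, `t K₁` and `(t K₁)'` vanish, as do the full and half-line integrals
of `K₂'` and `(t K₂)'`. This kills the mixed terms. Only the pairings of `K₁` and `t² K₁` with
`K₂''` survive, where `K₂''` has half-line integral `-K₂'(0)`. -/
theorem tendsto_hess {K₁ K₂ : ℝ → ℝ} (hK₁ : IsEvenKernel K₁) (hK₂ : IsOddKernel K₂)
    {m : ℝ → ℝ → ℝ} {τ φ : ℝ → ℝ} {x : ℝ} {κ : Type*} {L : Filter κ} {ψ : κ → ℝ}
    (hψ : Tendsto ψ L (𝓝 (slope φ x))) {S : κ → (ℝ → ℝ) → (ℝ → ℝ) → ℝ}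
    (hS : ∀ P Q, IsBump P → IsBump Q →
      Tendsto (fun k => S k P Q) L (𝓝 (tensorLimit m τ φ x P Q))) :
    Tendsto (fun k => hessYY K₁ K₂ (ψ k) (S k)) L (𝓝 (-VH K₂ τ φ x)) ∧
    Tendsto (fun k => hessYA K₁ K₂ (ψ k) (S k)) L (𝓝 0) ∧
    Tendsto (fun k => hessAY K₁ K₂ (ψ k) (S k)) L (𝓝 0) ∧
    Tendsto (fun k => hessAA K₁ K₂ (S k)) L (𝓝 (-angleCurvature K₁ K₂ τ x)) := by
  have s₁ := hK₁.toIsSmoothKernel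
  have s₂ := hK₂.toIsSmoothKernel
  have a0 := s₁.isBump
  have a1 := s₁.isBump_deriv
  have a2 := s₁.isBump_deriv_deriv
  have b0 := s₂.isBump
  have b1 := s₂.isBump_deriv
  have b2 := s₂.isBump_deriv_deriv
  have hsin := (Real.continuous_sin.tendsto _).comp hψ
  have hcos := (Real.continuous_cos.tendsto _).comp hψ
  have iK1 : ∫ t, deriv K₁ t = 0 := s₁.integral_deriv
  have iK1' : ∫ t, deriv (deriv K₁) t = 0 := s₁.integral_deriv_deriv
  have iK2' : ∫ t, deriv (deriv K₂) t = 0 := s₂.integral_deriv_deriv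
  have hK20 : ∫ t in Ioi 0, deriv K₂ t = 0 := by
    rw [s₂.integral_Ioi_deriv, hK₂.apply_zero, neg_zero]
  have hs1 : ∫ t, (K₁ t + t * deriv K₁ t) = 0 := by
    rw [integral_add a0.integrable a1.id_mul.integrable, s₁.integral_mul_deriv]; ring
  have hs2 : ∫ t, (K₂ t + t * deriv K₂ t) = 0 := by
    rw [integral_add b0.integrable b1.id_mul.integrable, s₂.integral_mul_deriv]; ring
  have hs3 : ∫ t in Ioi 0, (K₂ t + t * deriv K₂ t) = 0 := by
    rw [integral_add b0.integrable.integrableOn b1.id_mul.integrable.integrableOn,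
      s₂.integral_Ioi_mul_deriv]; ring
  have hsq : ∫ t, t * (t * K₁ t) = ∫ t, t ^ 2 * K₁ t := by
    congr 1; funext t; ring
  refine ⟨?_, ?_, ?_, ?_⟩
  · have := (hsin.mul ((hsin.mul (hS _ _ a2 b0)).add (hcos.mul (hS _ _ a1 b1)))).add
      (hcos.mul ((hsin.mul (hS _ _ a1 b1)).add (hcos.mul (hS _ _ a0 b2))))
    refine this.trans_eq ?_
    congr 1
    simp only [tensorLimit, iK1, iK1', iK2', hK₁.integral, s₂.integral_Ioi_deriv_deriv, VH]
    ring
  · have := (((hcos.mul (hS _ _ a1 b0)).sub (hsin.mul (hS _ _ a0 b1))).add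
      (hsin.mul ((hS _ _ a2 b0.id_mul).sub (hS _ _ a1.id_mul b1)))).add
      (hcos.mul ((hS _ _ a1 b1.id_mul).sub (hS _ _ a0.id_mul b2)))
    refine this.trans_eq ?_
    congr 1
    simp only [tensorLimit, iK1, iK1', iK2', s₂.integral_deriv, hK20, hK₁.integral_mul]
    ring
  · have := ((hsin.mul (hS _ _ a2 b0.id_mul)).add (hcos.mul (hS _ _ a1 (b0.add b1.id_mul)))).sub
      ((hsin.mul (hS _ _ (a0.add a1.id_mul) b1)).add (hcos.mul (hS _ _ a0.id_mul b2)))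
    refine this.trans_eq ?_
    congr 1
    simp only [tensorLimit, iK1, iK1', hK₁.integral_mul, hs1]
    ring
  · have := ((hS _ _ a2 b0.id_mul.id_mul).sub (hS _ _ a1.id_mul (b0.add b1.id_mul))).sub
      ((hS _ _ (a0.add a1.id_mul) b1.id_mul).sub (hS _ _ a0.id_mul.id_mul b2))
    refine this.trans_eq ?_
    congr 1
    simp only [tensorLimit, iK1', hs1, hs2, hs3, hsq, iK2', s₂.integral_Ioi_deriv_deriv,
      angleCurvature]
    ring

theorem VH_pos {K₂ τ φ : ℝ → ℝ} (hK₂ : IsOddKernel K₂) {x : ℝ} (hτ : 0 < τ x) :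
    0 < VH K₂ τ φ x := by
  have hc : 0 < Real.cos (slope φ x) := Real.cos_arctan_pos _
  have := hK₂.deriv_zero_pos
  unfold VH; positivity

theorem angleCurvature_pos {K₁ K₂ τ : ℝ → ℝ} (hK₁ : IsEvenKernel K₁) (hK₂ : IsOddKernel K₂)
    {x : ℝ} (hτ : 0 < τ x) : 0 < angleCurvature K₁ K₂ τ x :=
  mul_pos (mul_pos hτ hK₂.deriv_zero_pos) hK₁.integral_sq_mul_pos

/-! ### Consistency -/

theorem slope_mem (φ : ℝ → ℝ) (x : ℝ) : slope φ x ∈ Ioo (-(Real.pi / 2)) (Real.pi / 2) :=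
  Real.arctan_mem_Ioo _

section Consistency

variable {m : ℝ → ℝ → ℝ} {τ φ : ℝ → ℝ} {x : ℝ}
  {d : ∀ n : ℕ, Fin n → ℝ} {h : ℕ → ℝ} {κ : Type*} {L : Filter κ} {N : κ → ℕ} {y ψ : κ → ℝ}

theorem eventually_near_interior (M : EdgeModel m τ φ x) (hh : BandwidthLimits h)
    (hN : Tendsto N L atTop) (hy : Tendsto (fun k => (y k - φ x) / h (N k)) L (𝓝 0))
    (hψ : Tendsto ψ L (𝓝 (slope φ x))) :
    ∀ᶠ k in L, 0 < h (N k) ∧ y k ∈ Ioo (√2 * h (N k)) (1 - √2 * h (N k)) ∧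
      ψ k ∈ Ioo (-(Real.pi / 2)) (Real.pi / 2) := by
  have hh0 : Tendsto (fun k => h (N k)) L (𝓝 0) := hh.tendsto_zero.comp hN
  have hpos := hN.eventually hh.pos
  have hy' : Tendsto y L (𝓝 (φ x)) := by
    have h1 := (hy.mul hh0).add_const (φ x)
    rw [mul_zero, zero_add] at h1
    refine h1.congr' ?_
    filter_upwards [hpos] with k hk
    field_simp; ring
  have h1 : Tendsto (fun k => y k - √2 * h (N k)) L (𝓝 (φ x)) := by
    simpa using hy'.sub (hh0.const_mul √2)
  have h2 : Tendsto (fun k => y k + √2 * h (N k)) L (𝓝 (φ x)) := by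
    simpa using hy'.add (hh0.const_mul √2)
  filter_upwards [hpos, h1.eventually_const_lt M.edge_mem.1, h2.eventually_lt_const M.edge_mem.2,
    hψ.eventually (Ioo_mem_nhds (slope_mem φ x).1 (slope_mem φ x).2)] with k hk h3 h4 h5
  exact ⟨hk, ⟨by linarith, by linarith⟩, h5⟩

/-- The value at the maximizer is at least the value at `(φ x, slope φ x)`, which tends to `τ x`.
With the noise `A` negligible at both points, the maximizer nearly maximizes the mean contrast. The
case `A = 0` covers the deterministic maximizer. -/
theorem argmax_consistent (M : EdgeModel m τ φ x) (hτ : 0 < τ x) {K₁ K₂ : ℝ → ℝ}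
    (hK₁ : IsEvenKernel K₁) (hK₂ : IsOddKernel K₂)
    (hid : ∀ y ∈ Ioo (0 : ℝ) 1, 0 < (∫ t in (0 : ℝ)..y, K₂ t) ∧ (∫ t in (0 : ℝ)..y, K₂ t) < 2)
    (hd : ∀ n, InCells (d n)) (hh : BandwidthLimits h) (hN : Tendsto N L atTop)
    {A : ∀ k, Fin (N k) × Fin (N k) → ℝ}
    (hmax : ∀ᶠ k in L, IsArgmaxPair (fun y ψ => kernelSum (d (N k))
      (fun i => image m τ φ (d (N k) i.1) (d (N k) i.2) + A k i) (tensor K₁ K₂) x y ψ (h (N k)))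
      (h (N k)) (y k) (ψ k))
    (h1 : Tendsto (fun k => kernelSum (d (N k)) (A k) (tensor K₁ K₂) x (y k) (ψ k) (h (N k))) L
      (𝓝 0))
    (h2 : Tendsto (fun k => kernelSum (d (N k)) (A k) (tensor K₁ K₂) x (φ x) (slope φ x)
      (h (N k))) L (𝓝 0)) :
    Tendsto (fun k => (y k - φ x) / h (N k)) L (𝓝 0) ∧ Tendsto ψ L (𝓝 (slope φ x)) := by
  have hb1 := hK₁.toIsSmoothKernel.isBump
  have hb2 := hK₂.toIsSmoothKernel.isBump
  have hz : Tendsto (fun k => (φ x - φ x) / h (N k)) L (𝓝 0) := by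
    simpa using tendsto_const_nhds
  have hmean := tendsto_tensorSum_image M hd hh hN (y := fun _ => φ x)
    (ψ := fun _ => slope φ x) hz tendsto_const_nhds hb1 hb2
  have hval : tensorLimit m τ φ x K₁ K₂ = τ x := by
    simp [tensorLimit, hK₁.integral, hK₂.integral, hK₂.integral_Ioi]
  rw [hval] at hmean
  have hmem := eventually_near_interior M hh hN hz
    (tendsto_const_nhds (x := slope φ x))
  have main : ∀ ρ > 0, ∀ᶠ k in L,
      |(y k - φ x) / h (N k)| < ρ ∧ |ψ k - slope φ x| < ρ := by
    intro ρ hρ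
    obtain ⟨δ, hδ, hev⟩ := exists_argmax_neighbourhood M hτ hK₁ hK₂ hid hd hh hρ
    have h3 := (hmean.add h2).sub h1
    rw [add_zero, sub_zero] at h3
    filter_upwards [hN.eventually hev, hmax, hmem, h3.eventually_const_lt
      (show τ x - δ < τ x by linarith)] with k hk1 hk2 hk3 hk4
    refine hk1 (y k) hk2.1.1 (ψ k) hk2.1.2 ?_
    have hle := hk2.2 (show (φ x, slope φ x) ∈ heights (h (N k)) ×ˢ angles from
      ⟨Ioo_subset_Icc_self hk3.2.1, Ioo_subset_Icc_self hk3.2.2⟩)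
    simp only [mem_ofPred_eq, kernelSum_add] at hle
    simp only [tensorSum] at hk4
    have e : (fun p : ℝ × ℝ => K₁ p.1 * K₂ p.2) = tensor K₁ K₂ := rfl
    rw [e]
    linarith
  constructor
  · rw [Metric.tendsto_nhds]
    intro ρ hρ
    filter_upwards [main ρ hρ] with k hk
    rw [dist_zero_right]; exact hk.1
  · rw [Metric.tendsto_nhds]
    intro ρ hρ
    filter_upwards [main ρ hρ] with k hk using hk.2

end Consistency

/-! ### Profile maximizers -/

theorem continuous_kernelSum_angle {n : ℕ} (d : Fin n → ℝ) (A : Fin n × Fin n → ℝ)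
    {F : ℝ × ℝ → ℝ} (hF : Continuous F) (x y h : ℝ) :
    Continuous fun ψ => kernelSum d A F x y ψ h := by
  unfold kernelSum unrotate
  fun_prop

/-- The profile fixes only the height, while the first-order conditions also need an angle;
compactness of `angles` supplies one. -/
theorem IsArgmaxProfile.exists_pair {M : ℝ → ℝ → ℝ} (hM : ∀ y, Continuous (M y)) {h y₀ : ℝ}
    (hmax : IsArgmaxProfile M h y₀) : ∃ ψ₀, IsArgmaxPair M h y₀ ψ₀ := by
  have hne : angles.Nonempty :=
    ⟨0, by constructor <;> linarith [Real.pi_pos]⟩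
  obtain ⟨ψ₀, hψ₀, hψmax⟩ := isCompact_angles.exists_isMaxOn hne (hM y₀).continuousOn
  refine ⟨ψ₀, ⟨hmax.1, hψ₀⟩, ?_⟩
  rintro ⟨y, ψ⟩ ⟨hy, hψ⟩
  have h1 : M y ψ ≤ sSup (M y '' angles) :=
    le_csSup (isCompact_angles.image (hM y)).bddAbove (mem_image_of_mem _ hψ)
  have h2 : sSup (M y '' angles) ≤ sSup (M y₀ '' angles) := hmax.2 hy
  have h3 : sSup (M y₀ '' angles) ≤ M y₀ ψ₀ := by
    refine csSup_le (hne.image _) ?_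
    rintro _ ⟨ψ', hψ', rfl⟩
    exact hψmax hψ'
  exact h1.trans (h2.trans h3)

/-! ### The contrast as a kernel sum -/

theorem contrast_eq_kernelSum (K₁ K₂ : ℝ → ℝ) {n : ℕ} (d : Fin n → ℝ) (Y : Fin n × Fin n → ℝ)
    (x y ψ h : ℝ) :
    contrast K₁ K₂ d Y ![x, y] ψ h = kernelSum d Y (tensor K₁ K₂) x y ψ h := by
  unfold contrast kernelSum
  rw [mul_pow, mul_inv, mul_assoc, Finset.mul_sum, Finset.mul_sum, Finset.mul_sum]
  refine Finset.sum_congr rfl fun i _ => ?_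
  have e1 : (h⁻¹ • (rot (-ψ)).mulVec (![x, y] - ![d i.1, d i.2])) 0 =
      (unrotate ψ ((x - d i.1) / h, (y - d i.2) / h)).1 := by
    simp [rot, unrotate]
    ring
  have e2 : (h⁻¹ • (rot (-ψ)).mulVec (![x, y] - ![d i.1, d i.2])) 1 =
      (unrotate ψ ((x - d i.1) / h, (y - d i.2) / h)).2 := by
    simp [rot, unrotate]
    ring
  rw [rotKernel, e1, e2, tensor]
  ring

theorem kernelSum_obs (m : ℝ → ℝ → ℝ) (τ φ : ℝ → ℝ) {n : ℕ} (d : Fin n → ℝ)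
    (e : Fin n × Fin n → ℝ) (F : ℝ × ℝ → ℝ) (x y ψ h : ℝ) :
    kernelSum d (obs m τ φ d e) F x y ψ h =
      kernelSum d (fun i => image m τ φ (d i.1) (d i.2)) F x y ψ h + kernelSum d e F x y ψ h :=
  kernelSum_add d _ e F x y ψ h

theorem integral_contrast {Ω : Type*} [MeasurableSpace Ω] {P : Measure Ω}
    [IsProbabilityMeasure P] {ν : Measure ℝ} [IsProbabilityMeasure ν] (h2 : MemLp id 2 ν)
    (h0 : ∫ e, e ∂ν = 0) (K₁ K₂ : ℝ → ℝ) (m : ℝ → ℝ → ℝ) (τ φ : ℝ → ℝ) {n : ℕ}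
    (d : Fin n → ℝ) {ε : Fin n × Fin n → Ω → ℝ} (hlaw : ∀ i, HasLaw (ε i) ν P) (x y ψ h : ℝ) :
    ∫ ω, contrast K₁ K₂ d (obs m τ φ d fun i => ε i ω) ![x, y] ψ h ∂P =
      kernelSum d (fun i => image m τ φ (d i.1) (d i.2)) (tensor K₁ K₂) x y ψ h := by
  have hint : ∀ i, Integrable (ε i) P := by
    intro i
    have := h2.integrable (by norm_num)
    rw [← (hlaw i).map_eq] at this
    exact this.comp_aemeasurable (hlaw i).aemeasurable
  have hmean : ∀ i, ∫ ω, ε i ω ∂P = 0 := by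
    intro i
    rw [← integral_map (f := fun e : ℝ => e) (hlaw i).aemeasurable
      measurable_id.aestronglyMeasurable, (hlaw i).map_eq, h0]
  simp only [contrast_eq_kernelSum, kernelSum_obs]
  rw [integral_add (integrable_const _), integral_const, probReal_univ, one_smul]
  · simp only [kernelSum_eq_sum d (fun i => ε i _)]
    rw [integral_finsetSum _ fun i _ => (hint i).const_mul _]
    simp only [integral_const_mul, hmean, mul_zero, Finset.sum_const_zero, add_zero]
  · simp only [kernelSum_eq_sum d (fun i => ε i _)]
    exact integrable_finsetSum _ fun i _ => (hint i).const_mul _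

/-! ### Scores -/

theorem scoreY_add (K₁ K₂ : ℝ → ℝ) {n : ℕ} (d : Fin n → ℝ) (A B : Fin n × Fin n → ℝ)
    (x y ψ h : ℝ) : scoreY K₁ K₂ ψ (tensorSum d (fun i => A i + B i) x y ψ h) =
      scoreY K₁ K₂ ψ (tensorSum d A x y ψ h) + scoreY K₁ K₂ ψ (tensorSum d B x y ψ h) := by
  simp only [scoreY, tensorSum, kernelSum_add]
  ring

theorem scoreA_add (K₁ K₂ : ℝ → ℝ) {n : ℕ} (d : Fin n → ℝ) (A B : Fin n × Fin n → ℝ)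
    (x y ψ h : ℝ) : scoreA K₁ K₂ (tensorSum d (fun i => A i + B i) x y ψ h) =
      scoreA K₁ K₂ (tensorSum d A x y ψ h) + scoreA K₁ K₂ (tensorSum d B x y ψ h) := by
  simp only [scoreA, tensorSum, kernelSum_add]
  ring

/-- The first coordinate of the solution of a linear system with almost diagonal matrix. -/
theorem exists_tendsto_solution {κ : Type*} {L : Filter κ} {a b c e u v Δ δ : κ → ℝ} {V W : ℝ}
    (hV : 0 < V) (hW : 0 < W) (ha : Tendsto a L (𝓝 (-V))) (hb : Tendsto b L (𝓝 0))
    (hc : Tendsto c L (𝓝 0)) (he : Tendsto e L (𝓝 (-W)))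
    (h1 : ∀ᶠ k in L, -u k = Δ k * a k + δ k * b k)
    (h2 : ∀ᶠ k in L, -v k = Δ k * c k + δ k * e k) :
    ∃ r s : κ → ℝ, Tendsto r L (𝓝 0) ∧ Tendsto s L (𝓝 0) ∧
      ∀ᶠ k in L, Δ k = V⁻¹ * u k + (r k * u k + s k * v k) := by
  have hdet : Tendsto (fun k => a k * e k - b k * c k) L (𝓝 (V * W)) := by
    simpa using (ha.mul he).sub (hb.mul hc)
  have hVW : V * W ≠ 0 := (mul_pos hV hW).ne'
  -- Cramer's rule with `δ` eliminated: the coefficient of `u` is `-e / det → V⁻¹` and that of `v`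
  -- is `b / det → 0`.
  refine ⟨fun k => -e k / (a k * e k - b k * c k) - V⁻¹,
    fun k => b k / (a k * e k - b k * c k), ?_, ?_, ?_⟩
  · have := (he.neg.mul (hdet.inv₀ hVW)).sub_const V⁻¹
    simp only [← div_eq_mul_inv] at this
    rwa [neg_neg, show W / (V * W) - V⁻¹ = 0 by field_simp; ring] at this
  · simpa [div_eq_mul_inv] using hb.mul (hdet.inv₀ hVW)
  · filter_upwards [h1, h2, hdet.eventually_ne hVW] with k k1 k2 k3
    have : Δ k * (a k * e k - b k * c k) = -u k * e k + v k * b k := by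
      rw [k1, show v k = -(Δ k * c k + δ k * e k) by linarith]
      ring
    rw [← eq_div_iff k3] at this
    rw [this]
    ring

/-! ### The variance of the score -/

/-- The window of the score in the height. -/
def scoreWindow (K₁ K₂ : ℝ → ℝ) (ψ : ℝ) (p : ℝ × ℝ) : ℝ :=
  Real.sin ψ * tensor (deriv K₁) K₂ p + Real.cos ψ * tensor K₁ (deriv K₂) p

theorem exists_bound_scoreWindow {K₁ K₂ : ℝ → ℝ} (hK₁ : IsSmoothKernel K₁)
    (hK₂ : IsSmoothKernel K₂) : ∃ B, ∀ ψ p, |scoreWindow K₁ K₂ ψ p| ≤ B := by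
  obtain ⟨B₁, _, h₁⟩ := (hK₁.isBump_deriv.tensor hK₂.isBump).exists_bound
  obtain ⟨B₂, _, h₂⟩ := (hK₁.isBump.tensor hK₂.isBump_deriv).exists_bound
  refine ⟨B₁ + B₂, fun ψ p => (abs_add_le _ _).trans (add_le_add ?_ ?_)⟩
  · rw [abs_mul]
    exact (mul_le_of_le_one_left (abs_nonneg _) (Real.abs_sin_le_one _)).trans (h₁ p)
  · rw [abs_mul]
    exact (mul_le_of_le_one_left (abs_nonneg _) (Real.abs_cos_le_one _)).trans (h₂ p)

theorem kernelSum_sq_scoreWindow (K₁ K₂ : ℝ → ℝ) {n : ℕ} (d : Fin n → ℝ)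
    (A : Fin n × Fin n → ℝ) (x y ψ h : ℝ) :
    kernelSum d A (fun p => scoreWindow K₁ K₂ ψ p ^ 2) x y ψ h =
      Real.sin ψ ^ 2 * tensorSum d A x y ψ h (fun t => deriv K₁ t * deriv K₁ t)
          (fun t => K₂ t * K₂ t) +
        2 * Real.sin ψ * Real.cos ψ * tensorSum d A x y ψ h (fun t => K₁ t * deriv K₁ t)
          (fun t => K₂ t * deriv K₂ t) +
        Real.cos ψ ^ 2 * tensorSum d A x y ψ h (fun t => K₁ t * K₁ t)
          (fun t => deriv K₂ t * deriv K₂ t) := by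
  simp only [tensorSum, kernelSum, Finset.mul_sum, ← Finset.sum_add_distrib]
  refine Finset.sum_congr rfl fun i _ => ?_
  simp only [scoreWindow, tensor]
  ring

theorem IsBump.setIntegral_Icc {P : ℝ → ℝ} (hP : IsBump P) :
    ∫ t in Icc (-1 : ℝ) 1, P t = ∫ t, P t := by
  rw [hP.integral_eq, integral_Icc_eq_integral_Ioc,
    intervalIntegral.integral_of_le (by norm_num)]

theorem setIntegral_square_sq {P Q : ℝ → ℝ} (hP : IsBump P) (hQ : IsBump Q) :
    ∫ z in Icc (-1 : ℝ) 1 ×ˢ Icc (-1 : ℝ) 1, (P z.1 * Q z.2) ^ 2 =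
      (∫ t, P t * P t) * ∫ t, Q t * Q t := by
  rw [← (hP.mul hP).setIntegral_Icc, ← (hQ.mul hQ).setIntegral_Icc, ← setIntegral_prod_mul]
  exact setIntegral_congr_fun (measurableSet_Icc.prod measurableSet_Icc) fun z _ => by ring

section Limits

variable {m : ℝ → ℝ → ℝ} {τ φ : ℝ → ℝ} {x : ℝ} {K₁ K₂ : ℝ → ℝ}
  {d : ∀ n : ℕ, Fin n → ℝ} {h : ℕ → ℝ} {y ψ : ℕ → ℝ}

theorem tendsto_kernelSum_sq_scoreWindow (M : EdgeModel m τ φ x) (hK₁ : IsEvenKernel K₁)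
    (hK₂ : IsOddKernel K₂) (hd : ∀ n, InCells (d n)) (hh : BandwidthLimits h)
    (hy : Tendsto (fun n => (y n - φ x) / h n) atTop (𝓝 0))
    (hψ : Tendsto ψ atTop (𝓝 (slope φ x))) :
    Tendsto (fun n => kernelSum (d n) (fun _ => 1) (fun p => scoreWindow K₁ K₂ (ψ n) p ^ 2)
      x (y n) (ψ n) (h n)) atTop (𝓝 (VS K₁ K₂ φ x)) := by
  -- The constant image `1` without jump turns the edge limits into plain Riemann sums.
  have M' : EdgeModel (fun _ _ => 1) (fun _ => 0) φ x :=
    ⟨continuousOn_const, continuousOn_const, M.edge_deriv, M.point_mem, M.edge_mem⟩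
  have key : ∀ P Q, IsBump P → IsBump Q → Tendsto (fun n => tensorSum (d n) (fun _ => 1)
      x (y n) (ψ n) (h n) P Q) atTop (𝓝 ((∫ t, P t) * ∫ t, Q t)) := by
    intro P Q hP hQ
    have := tendsto_tensorSum_image M' hd hh tendsto_id hy hψ hP hQ
    simpa [tensorLimit, image] using this
  have a0 := hK₁.toIsSmoothKernel.isBump
  have a1 := hK₁.toIsSmoothKernel.isBump_deriv
  have b0 := hK₂.toIsSmoothKernel.isBump
  have b1 := hK₂.toIsSmoothKernel.isBump_deriv
  -- This removes the cross term in the square of the score window.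
  have hodd : ∫ t, K₁ t * deriv K₁ t = 0 := by
    refine integral_eq_zero_of_odd fun t => ?_
    have h1 : deriv (fun t => K₁ (-t)) t = deriv K₁ t := by simp only [hK₁.even]
    rw [deriv_comp_neg] at h1
    rw [hK₁.even, ← h1]; ring
  have hsin := (Real.continuous_sin.tendsto _).comp hψ
  have hcos := (Real.continuous_cos.tendsto _).comp hψ
  simp only [kernelSum_sq_scoreWindow]
  have := (((hsin.pow 2).mul (key _ _ (a1.mul a1) (b0.mul b0))).add
    (((hsin.const_mul 2).mul hcos).mul (key _ _ (a0.mul a1) (b0.mul b1)))).add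
    ((hcos.pow 2).mul (key _ _ (a0.mul a0) (b1.mul b1)))
  refine this.trans_eq ?_
  rw [hodd, VS, setIntegral_square_sq a1 b0, setIntegral_square_sq a0 b1]
  simp

/-- The score in the height at a deterministic point close to the edge is asymptotically
normal. -/
theorem tendstoInDistribution_score {Ω : Type*} [MeasurableSpace Ω] {P : Measure Ω}
    [IsProbabilityMeasure P] {ν : Measure ℝ} [IsProbabilityMeasure ν] (h2 : MemLp id 2 ν)
    (h0 : ∫ e, e ∂ν = 0) {ε : ∀ n : ℕ, Fin n × Fin n → Ω → ℝ}
    (hlaw : ∀ n i, HasLaw (ε n i) ν P) (hind : ∀ n, iIndepFun (ε n) P)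
    (M : EdgeModel m τ φ x) (hK₁ : IsEvenKernel K₁) (hK₂ : IsOddKernel K₂)
    (hd : ∀ n, InCells (d n)) (hh : BandwidthLimits h)
    (hy : Tendsto (fun n => (y n - φ x) / h n) atTop (𝓝 0))
    (hψ : Tendsto ψ atTop (𝓝 (slope φ x))) (c : ℝ) :
    TendstoInDistribution (fun n ω => c * (n * h n * scoreY K₁ K₂ (ψ n)
        (tensorSum (d n) (fun i => ε n i ω) x (y n) (ψ n) (h n)))) atTop (id : ℝ → ℝ) (fun _ => P)
      (gaussianReal 0 (Real.toNNReal (Var[id; ν] * (c ^ 2 * VS K₁ K₂ φ x)))) := by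
  obtain ⟨B, hB⟩ := exists_bound_scoreWindow hK₁.toIsSmoothKernel hK₂.toIsSmoothKernel
  have hB0 : 0 ≤ B := (abs_nonneg _).trans (hB 0 0)
  have hne : ∀ᶠ n : ℕ in atTop, (n : ℝ) * h n ≠ 0 := hh.tendsto_mul.eventually_ne_atTop 0
  have hcM : ∀ n i, |c * (n * h n) * kernelWeight (d n) (scoreWindow K₁ K₂ (ψ n)) x (y n) (ψ n)
      (h n) i| ≤ |c * (n * h n)| * (((n * h n) ^ 2)⁻¹ * B) := by
    intro n i
    have h3 : 0 ≤ ((n * h n) ^ 2)⁻¹ := by positivity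
    rw [abs_mul, kernelWeight, abs_mul _ (scoreWindow _ _ _ _), abs_of_nonneg h3]
    gcongr
    exact hB _ _
  -- Each weight is `O(1 / (n h))`, so no single error dominates.
  have hM : Tendsto (fun n : ℕ => |c * (n * h n)| * (((n * h n) ^ 2)⁻¹ * B)) atTop (𝓝 0) := by
    have h1 : Tendsto (fun n : ℕ => |c| * B * (n * h n)⁻¹) atTop (𝓝 0) := by
      simpa using (tendsto_inv_atTop_zero.comp hh.tendsto_mul).const_mul (|c| * B)
    refine h1.congr' ?_
    filter_upwards [hh.tendsto_mul.eventually_gt_atTop 0] with n hn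
    rw [abs_mul, abs_of_pos hn]
    field_simp
  have hs : Tendsto (fun n => ∑ i, (c * (n * h n) * kernelWeight (d n) (scoreWindow K₁ K₂ (ψ n))
      x (y n) (ψ n) (h n) i) ^ 2) atTop (𝓝 (c ^ 2 * VS K₁ K₂ φ x)) := by
    refine ((tendsto_kernelSum_sq_scoreWindow M hK₁ hK₂ hd hh hy hψ).const_mul (c ^ 2)).congr' ?_
    filter_upwards [hne] with n hn
    simp only [mul_pow, ← Finset.mul_sum]
    have := sum_kernelWeight_sq (d n) (scoreWindow K₁ K₂ (ψ n)) x (y n) (ψ n) (h n)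
    rw [this, mul_pow]
    have h1 : (n : ℝ) ≠ 0 := left_ne_zero_of_mul hn
    have h3 : h n ≠ 0 := right_ne_zero_of_mul hn
    field_simp
  have := tendstoInDistribution_weighted_sum h2 h0 hlaw hind hcM hM hs
  convert this using 3 with n ω
  rw [scoreY_eq_kernelSum]
  change c * (n * h n * kernelSum (d n) (fun i => ε n i ω) (scoreWindow K₁ K₂ (ψ n)) x (y n) (ψ n)
    (h n)) = _
  rw [kernelSum_eq_sum, Finset.mul_sum, Finset.mul_sum]
  exact Finset.sum_congr rfl fun i _ => by ring

end Limits

/-! ### Linearization -/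

section Linearization

variable {Ω : Type*} [MeasurableSpace Ω] {P : Measure Ω} [IsProbabilityMeasure P]
  {ν : Measure ℝ} [IsProbabilityMeasure ν] {d : ∀ n : ℕ, Fin n → ℝ} {h : ℕ → ℝ}
  {ε : ∀ n : ℕ, Fin n × Fin n → Ω → ℝ} {m : ℝ → ℝ → ℝ} {τ φ : ℝ → ℝ} {x : ℝ} {K₁ K₂ : ℝ → ℝ}

theorem tendsto_tensorSum_obs (hd : ∀ n, InCells (d n)) (hh : BandwidthLimits h)
    (h2 : MemLp id 2 ν) (h0 : ∫ e, e ∂ν = 0) (hlaw : ∀ n i, HasLaw (ε n i) ν P)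
    (hind : ∀ n, iIndepFun (ε n) P) (M : EdgeModel m τ φ x) {y ψ : ℕ × Ω → ℝ}
    (hy : Tendsto (fun q => (y q - φ x) / h q.1) (probFilter P) (𝓝 0))
    (hψ : Tendsto ψ (probFilter P) (𝓝 (slope φ x))) {Q R : ℝ → ℝ} (hQ : IsBump Q)
    (hR : IsBump R) :
    Tendsto (fun q => tensorSum (d q.1)
      (fun i => image m τ φ (d q.1 i.1) (d q.1 i.2) + ε q.1 i q.2) x (y q) (ψ q) (h q.1) Q R)
      (probFilter P) (𝓝 (tensorLimit m τ φ x Q R)) := by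
  have hint := eventually_near_interior M hh tendsto_fst_probFilter hy hψ
  have h1 := tendsto_tensorSum_image M hd hh tendsto_fst_probFilter hy hψ hQ hR
  have h3 := tendsto_noise hd hh h2 h0 hlaw hind (hQ.tensor hR) x (y := y) (ψ := ψ)
    (by
      filter_upwards [hint] with q hq
      have : 0 < √2 * h q.1 := mul_pos (by norm_num) hq.1
      exact ⟨by linarith [hq.2.1.1], by linarith [hq.2.1.2]⟩)
    (by
      filter_upwards [hint] with q hq using Ioo_subset_Icc_self hq.2.2)
  simpa only [tensorSum, kernelSum_add, add_zero] using h1.add h3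

theorem tendsto_mul_scoreY_noise (hd : ∀ n, InCells (d n)) (hh : BandwidthLimits h)
    (h2 : MemLp id 2 ν) (h0 : ∫ e, e ∂ν = 0) (hlaw : ∀ n i, HasLaw (ε n i) ν P)
    (hind : ∀ n, iIndepFun (ε n) P) (hK₁ : IsSmoothKernel K₁) (hK₂ : IsSmoothKernel K₂)
    (x : ℝ) (y ψ : ℕ → ℝ) {c : ℕ × Ω → ℝ} (hc : Tendsto c (probFilter P) (𝓝 0)) :
    Tendsto (fun q => c q * (q.1 * h q.1 * scoreY K₁ K₂ (ψ q.1)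
      (tensorSum (d q.1) (fun i => ε q.1 i q.2) x (y q.1) (ψ q.1) (h q.1))))
      (probFilter P) (𝓝 0) := by
  have hbd : ∀ {f : ℝ → ℝ}, (∀ t, |f t| ≤ 1) →
      Tendsto (fun q => c q * f (ψ q.1)) (probFilter P) (𝓝 0) := fun {f} hf => by
    refine squeeze_zero_norm (fun q => ?_) (by simpa using hc.norm)
    rw [norm_mul]
    exact mul_le_of_le_one_right (norm_nonneg _) (hf _)
  have h3 := tendsto_mul_noise hd hh h2 h0 hlaw hind (hK₁.isBump_deriv.tensor hK₂.isBump) x y ψ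
    (hbd Real.abs_sin_le_one)
  have h4 := tendsto_mul_noise hd hh h2 h0 hlaw hind (hK₁.isBump.tensor hK₂.isBump_deriv) x y ψ
    (hbd Real.abs_cos_le_one)
  have := h3.add h4
  rw [add_zero] at this
  refine this.congr fun q => ?_
  simp only [scoreY, tensorSum]
  ring

theorem tendsto_mul_scoreA_noise (hd : ∀ n, InCells (d n)) (hh : BandwidthLimits h)
    (h2 : MemLp id 2 ν) (h0 : ∫ e, e ∂ν = 0) (hlaw : ∀ n i, HasLaw (ε n i) ν P)
    (hind : ∀ n, iIndepFun (ε n) P) (hK₁ : IsSmoothKernel K₁) (hK₂ : IsSmoothKernel K₂)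
    (x : ℝ) (y ψ : ℕ → ℝ) {c : ℕ × Ω → ℝ} (hc : Tendsto c (probFilter P) (𝓝 0)) :
    Tendsto (fun q => c q * (q.1 * h q.1 * scoreA K₁ K₂
      (tensorSum (d q.1) (fun i => ε q.1 i q.2) x (y q.1) (ψ q.1) (h q.1))))
      (probFilter P) (𝓝 0) := by
  have h3 := tendsto_mul_noise hd hh h2 h0 hlaw hind
    (hK₁.isBump_deriv.tensor hK₂.isBump.id_mul) x y ψ hc
  have h4 := tendsto_mul_noise hd hh h2 h0 hlaw hind
    (hK₁.isBump.id_mul.tensor hK₂.isBump_deriv) x y ψ hc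
  have := h3.sub h4
  rw [sub_zero] at this
  refine this.congr fun q => ?_
  simp only [scoreA, tensorSum]
  ring

/-- Points between two sequences that approach the edge approach the edge. -/
theorem tendsto_between {κ : Type*} {L : Filter κ} {a b s : κ → ℝ} {l : ℝ}
    (ha : Tendsto a L (𝓝 l)) (hb : Tendsto b L (𝓝 l)) (hs : ∀ k, s k ∈ Ioo (0 : ℝ) 1) :
    Tendsto (fun k => a k + s k * (b k - a k)) L (𝓝 l) := by
  have h1 : Tendsto (fun k => s k * (b k - a k)) L (𝓝 0) := by
    have h2 : Tendsto (fun k => b k - a k) L (𝓝 0) := by simpa using hb.sub ha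
    refine squeeze_zero_norm (fun k => ?_) (by simpa using h2.norm)
    rw [norm_mul, Real.norm_eq_abs (s k), abs_of_pos (hs k).1]
    exact mul_le_of_le_one_left (norm_nonneg _) (hs k).2.le
  simpa using ha.add h1

/-- The difference of the random and the deterministic maximizer is linear in the score of the
noise, up to a negligible remainder. -/
theorem tendsto_maximizer_sub_score (hd : ∀ n, InCells (d n)) (hh : BandwidthLimits h)
    (h2 : MemLp id 2 ν) (h0 : ∫ e, e ∂ν = 0) (hlaw : ∀ n i, HasLaw (ε n i) ν P)
    (hind : ∀ n, iIndepFun (ε n) P) (M : EdgeModel m τ φ x) (hτ : 0 < τ x)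
    (hK₁ : IsEvenKernel K₁) (hK₂ : IsOddKernel K₂) {ŷ ψ' : ℕ × Ω → ℝ} {y ψ : ℕ → ℝ}
    (hmax : ∀ᶠ q in probFilter P, IsArgmaxPair (fun y ψ => kernelSum (d q.1)
      (fun i => image m τ φ (d q.1 i.1) (d q.1 i.2) + ε q.1 i q.2) (tensor K₁ K₂) x y ψ (h q.1))
      (h q.1) (ŷ q) (ψ' q))
    (hŷ : Tendsto (fun q => (ŷ q - φ x) / h q.1) (probFilter P) (𝓝 0))
    (hψ' : Tendsto ψ' (probFilter P) (𝓝 (slope φ x)))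
    (hmaxdet : ∀ᶠ n in atTop, IsArgmaxPair (fun y ψ => kernelSum (d n)
      (fun i => image m τ φ (d n i.1) (d n i.2)) (tensor K₁ K₂) x y ψ (h n)) (h n) (y n) (ψ n))
    (hy : Tendsto (fun n => (y n - φ x) / h n) atTop (𝓝 0))
    (hψ : Tendsto ψ atTop (𝓝 (slope φ x))) :
    Tendsto (fun q => q.1 * (ŷ q - y q.1) - (VH K₂ τ φ x)⁻¹ * (q.1 * h q.1 *
      scoreY K₁ K₂ (ψ q.1) (tensorSum (d q.1) (fun i => ε q.1 i q.2) x (y q.1) (ψ q.1) (h q.1))))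
      (probFilter P) (𝓝 0) := by
  have s₁ := hK₁.toIsSmoothKernel
  have s₂ := hK₂.toIsSmoothKernel
  have hfst := tendsto_fst_probFilter (P := P)
  have hpos := hfst.eventually hh.pos
  have hy' := hy.comp hfst
  have hψ₀ := hψ.comp hfst
  set A : ∀ q : ℕ × Ω, Fin q.1 × Fin q.1 → ℝ :=
    fun q i => image m τ φ (d q.1 i.1) (d q.1 i.2) + ε q.1 i q.2 with hA
  -- The two scores have different intermediate points, chosen separately for each outcome. No
  -- measurability of the choice is needed, since `probFilter` is defined by outer measure and the
  -- limits hold at any intermediate points.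
  have key := fun q : ℕ × Ω => exists_score_sub_eq (d q.1) (A q) x (y q.1) (ψ q.1) (h q.1)
    (ŷ q - y q.1) (ψ' q - ψ q.1) s₁ s₂
  choose s hs es using fun q => (key q).1
  choose t ht et using fun q => (key q).2
  have hlim : ∀ r : ℕ × Ω → ℝ, (∀ q, r q ∈ Ioo (0 : ℝ) 1) →
      Tendsto (fun q => ψ q.1 + r q * (ψ' q - ψ q.1)) (probFilter P) (𝓝 (slope φ x)) ∧
      ∀ Q R, IsBump Q → IsBump R → Tendsto (fun q => tensorSum (d q.1) (A q) x
        (y q.1 + r q * (ŷ q - y q.1)) (ψ q.1 + r q * (ψ' q - ψ q.1)) (h q.1) Q R)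
        (probFilter P) (𝓝 (tensorLimit m τ φ x Q R)) := by
    intro r hr
    have h1 := tendsto_between hψ₀ hψ' hr
    refine ⟨h1, fun Q R hQ hR => ?_⟩
    refine tendsto_tensorSum_obs hd hh h2 h0 hlaw hind M ?_ h1 hQ hR
    refine (tendsto_between hy' hŷ hr).congr fun q => ?_
    simp only [Function.comp_apply]
    ring
  have hYY := tendsto_hess hK₁ hK₂ (hlim s hs).1 (hlim s hs).2
  have hAA := tendsto_hess hK₁ hK₂ (hlim t ht).1 (hlim t ht).2
  -- The observed scores vanish at the random maximizer and the mean scores at the deterministic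
  -- one, so the increment of the observed scores is minus the noise score at the deterministic
  -- maximizer.
  have hscore : ∀ᶠ q in probFilter P,
      (scoreY K₁ K₂ (ψ' q) (tensorSum (d q.1) (A q) x (ŷ q) (ψ' q) (h q.1)) = 0 ∧
        scoreA K₁ K₂ (tensorSum (d q.1) (A q) x (ŷ q) (ψ' q) (h q.1)) = 0) ∧
      scoreY K₁ K₂ (ψ q.1) (tensorSum (d q.1) (fun i => image m τ φ (d q.1 i.1) (d q.1 i.2))
        x (y q.1) (ψ q.1) (h q.1)) = 0 ∧
      scoreA K₁ K₂ (tensorSum (d q.1) (fun i => image m τ φ (d q.1 i.1) (d q.1 i.2))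
        x (y q.1) (ψ q.1) (h q.1)) = 0 := by
    filter_upwards [hmax, hfst.eventually hmaxdet,
      eventually_near_interior M hh hfst hŷ hψ', eventually_near_interior M hh hfst hy' hψ₀]
      with q q1 q2 q3 q4
    exact ⟨scores_eq_zero _ _ _ _ _ _ s₁ s₂ q3.1 q1.2 q3.2.1 q3.2.2,
      scores_eq_zero _ _ _ _ _ _ s₁ s₂ q4.1 q2.2 q4.2.1 q4.2.2⟩
  obtain ⟨r, r', hr, hr', hΔ⟩ := exists_tendsto_solution (VH_pos (φ := φ) hK₂ hτ)
    (angleCurvature_pos hK₁ hK₂ hτ) hYY.1 hYY.2.1 hAA.2.2.1 hAA.2.2.2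
    (u := fun q => scoreY K₁ K₂ (ψ q.1)
      (tensorSum (d q.1) (fun i => ε q.1 i q.2) x (y q.1) (ψ q.1) (h q.1)))
    (v := fun q => scoreA K₁ K₂
      (tensorSum (d q.1) (fun i => ε q.1 i q.2) x (y q.1) (ψ q.1) (h q.1)))
    (Δ := fun q => (ŷ q - y q.1) / h q.1) (δ := fun q => ψ' q - ψ q.1)
    (by
      filter_upwards [hscore] with q hq
      rw [← es q, add_sub_cancel, add_sub_cancel, hq.1.1, scoreY_add, hq.2.1]
      ring)
    (by
      filter_upwards [hscore] with q hq
      rw [← et q, add_sub_cancel, add_sub_cancel, hq.1.2, scoreA_add, hq.2.2]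
      ring)
  -- As `n (ŷ - y) = n h Δ`, both noise scores acquire the factor `n h`, which keeps them bounded in
  -- probability; the null coefficients `r` and `r'` make the remainder vanish.
  have h3 := (tendsto_mul_scoreY_noise hd hh h2 h0 hlaw hind s₁ s₂ x y ψ hr).add
    (tendsto_mul_scoreA_noise hd hh h2 h0 hlaw hind s₁ s₂ x y ψ hr')
  rw [add_zero] at h3
  refine h3.congr' ?_
  filter_upwards [hΔ, hpos] with q hq hqpos
  have : ŷ q - y q.1 = h q.1 * ((ŷ q - y q.1) / h q.1) := by field_simp
  rw [this, hq]
  ring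

/-- Asymptotic normality of the random maximizer around the deterministic maximizer. -/
theorem tendstoInDistribution_argmax (hd : ∀ n, InCells (d n)) (hh : BandwidthLimits h)
    (h2 : MemLp id 2 ν) (h0 : ∫ e, e ∂ν = 0) (hlaw : ∀ n i, HasLaw (ε n i) ν P)
    (hind : ∀ n, iIndepFun (ε n) P) (M : EdgeModel m τ φ x) (hτ : 0 < τ x)
    (hK₁ : IsEvenKernel K₁) (hK₂ : IsOddKernel K₂)
    (hid : ∀ y ∈ Ioo (0 : ℝ) 1, 0 < (∫ t in (0 : ℝ)..y, K₂ t) ∧ (∫ t in (0 : ℝ)..y, K₂ t) < 2)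
    {φhat ψhat : ℕ → Ω → ℝ} {φdet ψdet : ℕ → ℝ} (hmeas : ∀ n, AEMeasurable (φhat n) P)
    (hmax : ∀ᶠ q in probFilter P, IsArgmaxPair (fun y ψ => kernelSum (d q.1)
      (fun i => image m τ φ (d q.1 i.1) (d q.1 i.2) + ε q.1 i q.2) (tensor K₁ K₂) x y ψ (h q.1))
      (h q.1) (φhat q.1 q.2) (ψhat q.1 q.2))
    (hmaxdet : ∀ᶠ n in atTop, IsArgmaxPair (fun y ψ => kernelSum (d n)
      (fun i => image m τ φ (d n i.1) (d n i.2)) (tensor K₁ K₂) x y ψ (h n)) (h n)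
      (φdet n) (ψdet n)) :
    TendstoInDistribution (fun (n : ℕ) ω => (n : ℝ) * (φhat n ω - φdet n)) atTop (id : ℝ → ℝ)
      (fun _ => P) (gaussianReal 0
        (Real.toNNReal (Var[id; ν] * VS K₁ K₂ φ x / VH K₂ τ φ x ^ 2))) := by
  have hF := hK₁.toIsSmoothKernel.isBump.tensor hK₂.toIsSmoothKernel.isBump
  have hzero : ∀ (n : ℕ) (y ψ h : ℝ),
      kernelSum (d n) (fun _ => 0) (tensor K₁ K₂) x y ψ h = 0 := fun n y ψ h => by
    simp [kernelSum]
  obtain ⟨hydet, hψdet⟩ := argmax_consistent M hτ hK₁ hK₂ hid hd hh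
    (N := fun n : ℕ => n) tendsto_id (y := φdet) (ψ := ψdet) (A := fun n _ => 0)
    (by simpa only [add_zero] using hmaxdet)
    (by simp only [hzero]; exact tendsto_const_nhds)
    (by simp only [hzero]; exact tendsto_const_nhds)
  have hn1 := tendsto_noise hd hh h2 h0 hlaw hind hF x (y := fun q => φhat q.1 q.2)
    (ψ := fun q => ψhat q.1 q.2)
    (by
      filter_upwards [hmax, tendsto_fst_probFilter.eventually hh.pos] with q hq hpos
      have h3 : 0 < √2 * h q.1 := mul_pos (by norm_num) hpos
      exact ⟨by linarith [hq.1.1.1], by linarith [hq.1.1.2]⟩)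
    (by filter_upwards [hmax] with q hq using hq.1.2)
  have hn2 := tendsto_noise hd hh h2 h0 hlaw hind hF x (y := fun _ => φ x)
    (ψ := fun _ => slope φ x)
    (Eventually.of_forall fun _ => Ioo_subset_Icc_self M.edge_mem)
    (Eventually.of_forall fun _ => Ioo_subset_Icc_self (slope_mem φ x))
  have hc := argmax_consistent (L := probFilter P) (N := Prod.fst) (A := fun q i => ε q.1 i q.2)
    (y := fun q => φhat q.1 q.2) (ψ := fun q => ψhat q.1 q.2) M hτ hK₁ hK₂ hid hd hh
    tendsto_fst_probFilter
  obtain ⟨hyhat, hψhat⟩ := hc hmax hn1 hn2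
  have hlin := tendsto_maximizer_sub_score hd hh h2 h0 hlaw hind M hτ hK₁ hK₂
    hmax hyhat hψhat hmaxdet hydet hψdet
  have hclt := tendstoInDistribution_score h2 h0 hlaw hind M hK₁ hK₂ hd hh hydet
    hψdet (VH K₂ τ φ x)⁻¹
  rw [show Var[id; ν] * ((VH K₂ τ φ x)⁻¹ ^ 2 * VS K₁ K₂ φ x) =
    Var[id; ν] * VS K₁ K₂ φ x / VH K₂ τ φ x ^ 2 by rw [inv_pow]; ring] at hclt
  refine tendstoInDistribution_of_tendstoInMeasure_sub _ _ hclt ?_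
    fun n => ((hmeas n).sub_const _).const_mul _
  exact tendstoInMeasure_of_probFilter hlin

end Linearization

end JumpCurve

end

theorem mainTheorem2
    {Ω : Type*} [MeasurableSpace Ω] (P : Measure Ω) [IsProbabilityMeasure P]
    -- kernels; the last hypothesis identifies the location and the slope of the edge
    (K₁ K₂ : ℝ → ℝ) (hK₁ : JumpCurve.IsEvenKernel K₁) (hK₂ : JumpCurve.IsOddKernel K₂)
    (hK₂_ident : ∀ y ∈ Ioo (0 : ℝ) 1,
      0 < (∫ t in (0 : ℝ)..y, K₂ t) ∧ (∫ t in (0 : ℝ)..y, K₂ t) < 2)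
    -- smooth part, jump height, jump location
    (m : ℝ → ℝ → ℝ) (τ φ : ℝ → ℝ)
    (hm : ContDiffOn ℝ 2 (fun p : ℝ × ℝ => m p.1 p.2) (Icc 0 1 ×ˢ Icc 0 1))
    (hτ : ContDiffOn ℝ 2 τ (Icc 0 1)) (hφ : ContDiffOn ℝ 2 φ (Icc 0 1))
    (hτ_nonneg : ∀ t ∈ Icc (0 : ℝ) 1, 0 ≤ τ t)
    (hφ_mem : ∀ t ∈ Icc (0 : ℝ) 1, φ t ∈ Ioo (0 : ℝ) 1)
    -- design and bandwidth
    (d : (n : ℕ) → Fin n → ℝ) (hd : JumpCurve.IsRegularGrid d)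
    (h : ℕ → ℝ) (hh : JumpCurve.IsBandwidth h)
    -- errors: for each `n` independent with common law `ν`
    (ν : Measure ℝ) [IsProbabilityMeasure ν]
    (hν_moment : MemLp id 5 ν) (hν_mean : ∫ e, e ∂ν = 0)
    (ε : (n : ℕ) → Fin n × Fin n → Ω → ℝ)
    (hε_law : ∀ n i, HasLaw (ε n i) ν P) (hε_indep : ∀ n, iIndepFun (ε n) P)
    -- the point
    (a b : ℝ) (ha : 0 < a) (hb : b < 1) (x : ℝ) (hx : x ∈ Icc a b)
    (hτx : 0 < τ x)
    -- the estimators of location and slope at `x`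
    (φhat ψhat : ℕ → Ω → ℝ)
    (hφhat_meas : ∀ n, AEMeasurable (φhat n) P) (hψhat_meas : ∀ n, AEMeasurable (ψhat n) P)
    (hhat : ∀ᶠ n : ℕ in atTop, ∀ᵐ ω ∂P,
      JumpCurve.IsArgmaxPair
        (fun y ψ => JumpCurve.contrast K₁ K₂ (d n)
          (JumpCurve.obs m τ φ (d n) (fun i => ε n i ω)) ![x, y] ψ (h n))
        (h n) (φhat n ω) (ψhat n ω))
    -- the maximizer of the deterministic contrast at `x`
    (φdet : ℕ → ℝ)
    (hdet : ∀ᶠ n : ℕ in atTop,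
      JumpCurve.IsArgmaxProfile
        (fun y ψ => ∫ ω, JumpCurve.contrast K₁ K₂ (d n)
          (JumpCurve.obs m τ φ (d n) (fun i => ε n i ω)) ![x, y] ψ (h n) ∂P)
        (h n) (φdet n)) :
    TendstoInDistribution (fun (n : ℕ) ω => (n : ℝ) * (φhat n ω - φdet n)) atTop (id : ℝ → ℝ)
      (fun _ => P)
      (gaussianReal 0
        (Real.toNNReal
          (Var[id; ν] * JumpCurve.VS K₁ K₂ φ x / JumpCurve.VH K₂ τ φ x ^ 2))) := by
  open JumpCurve in
  have hxm : x ∈ Ioo (0 : ℝ) 1 := ⟨ha.trans_le hx.1, hx.2.trans_lt hb⟩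
  have M : EdgeModel m τ φ x := ⟨hm.continuousOn, hτ.continuousOn,
    ((hφ.differentiableOn (by norm_num)).differentiableAt
      (Icc_mem_nhds hxm.1 hxm.2)).hasDerivAt, hxm, hφ_mem x (Ioo_subset_Icc_self hxm)⟩
  have h2 : MemLp id 2 ν := hν_moment.mono_exponent (by norm_num)
  have hF := hK₁.toIsSmoothKernel.isBump.tensor hK₂.toIsSmoothKernel.isBump
  have hpair : ∀ᶠ n in atTop, ∃ ψ₀, IsArgmaxPair (fun y ψ => kernelSum (d n)
      (fun i => image m τ φ (d n i.1) (d n i.2)) (tensor K₁ K₂) x y ψ (h n)) (h n)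
      (φdet n) ψ₀ := by
    filter_upwards [hdet] with n hn
    simp only [integral_contrast h2 hν_mean K₁ K₂ m τ φ (d n) (hε_law n)] at hn
    exact hn.exists_pair fun y => continuous_kernelSum_angle _ _ hF.cont _ _ _
  obtain ⟨ψdet, hmaxdet⟩ := hpair.choice
  simp only [contrast_eq_kernelSum] at hhat
  exact tendstoInDistribution_argmax (fun n => (hd n).2) hh.limits h2 hν_mean hε_law hε_indep M
    hτx hK₁ hK₂ hK₂_ident hφhat_meas (eventually_probFilter_of_ae hhat) hmaxdet
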